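/- **Complexity of processing in $B_{(1,2)}$.** Let $B_{(1,2)}=\langle a,t\mid t^{-1}at=a^2\rangle$. A *power circuit* $\mathcal P$ is a finite directed acyclic graph without multiple edges, with vertex set $V(\mathcal P)$, edge labels $\mu(e)\in\{1,-1\}$, a set $M(\mathcal P)\subseteq V(\mathcal P)$ of marked vertices, and signs $\nu(v)\in\{1,-1\}$ for $v\in M(\mathcal P)$. Its evaluation is defined by $\mathcal E(v)=0$ if no edge leaves $v$, and otherwise $\mathcal E(v)=2^{\sum_{e}\mu(e)\mathcal E(\beta(e))}$, the sum being over the edges $e$ leaving $v$, with terminus $\beta(e)$; it is required that $\mathcal E(v)\in\mathbb Z$ for all $v$. The circuit represents the integer $\mathcal N(\mathcal P)=\sum_{v\in M(\mathcal P)}\nu(v)\mathcal E(v)$. A *power sequence* $(x_1,\mathcal P_1),\dots,(x_n,\mathcal P_n)$ represents the word $x_1^{\mathcal N(\mathcal P_1)}\cdots x_n^{\mathcal N(\mathcal P_n)}$; two power sequences in the letters $a,t$ are *equivalent* if their words are equal in $B_{(1,2)}$. Time is measured by elementary operations on a random access machine (uniform cost, addition and subtraction of integers as arithmetic operations); a circuit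 with $n$ vertices, numbered $0,\dots,n-1$, is given by $n$, its $n\times n$ matrix of edge labels (with $0$ for "no edge") and its vector of marks (with $0$ for "unmarked"). There are an algorithm and a constant $C$ such that, for every $k\ge 0$ and every power sequence $$(a,\mathcal P_{m_0}),(t,\mathcal P_{\delta_1}),(a,\mathcal P_{m_1}),\dots,(t,\mathcal P_{\delta_k}),(a,\mathcal P_{m_k})\qquad(*)$$ with $$S=\sum_{j=0}^{k}\bigl(|V(\mathcal P_{m_j})|+|M(\mathcal P_{m_j})|\bigr)+\sum_{j=1}^{k}|V(\mathcal P_{\delta_j})|,$$ the algorithm, given $k$ and the circuits of $(*)$, halts after at most $C\cdot\max(k,1)\cdot\max(S,1)^3$ operations (so in time $O(kS^3)$ when $k,S\ge1$) and decides whether the element of $B_{(1,2)}$ represented by $(*)$ is of the form $a^p$ with $p\in\mathbb Z$, and whether it is of the form $t^p$ with $p\in\mathbb Z$. Moreover: 1. If it is of the form $a^p$, then the algorithm outputs a power circuit $\mathcal P$ such that $(*)$ is equivalent to $(a,\mathcal P)$, $$|V(\mathcal P)|\le\sum_{j=0}^{k}\bigl(|V(\mathcal P_{m_j})|+|M(\mathcal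 P_{m_j})|\bigr)+\sum_{j=1}^{k}|V(\mathcal P_{\delta_j})|\quad\text{and}\quad|M(\mathcal P)|=\sum_{j=0}^{k}|M(\mathcal P_{m_j})|.$$ 2. If it is of the form $t^p$, then the algorithm outputs a power circuit $\mathcal P$ such that $(*)$ is equivalent to $(t,\mathcal P)$, $$|V(\mathcal P)|=\sum_{j=1}^{k}|V(\mathcal P_{\delta_j})|\quad\text{and}\quad|M(\mathcal P)|=\sum_{j=1}^{k}|M(\mathcal P_{\delta_j})|.$$ -/

import Mathlib

namespace PowerBS

/-! ### Power circuits -/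

/-- A finite acyclic directed graph without multiple edges, on the vertices `0, …, n - 1`, whose
edges carry signs and some of whose vertices are marked with signs.
`edge v w = 0` means that there is no edge `v → w`, and `edge v w = ±1` that there is one, with
that label; `mark v = 0` means that `v` is not marked, and `mark v = ±1` that it is marked, with
that sign. -/
structure SignedDag where
  n : ℕ
  edge : Fin n → Fin n → SignType
  mark : Fin n → SignType
  acyclic : ∀ v, ¬ Relation.TransGen (fun x y => edge x y ≠ 0) v v

namespace SignedDag

theorem wf (D : SignedDag) : WellFounded (fun w v => D.edge v w ≠ 0) := by
  let r : Fin D.n → Fin D.n → Prop := fun w v =>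
    Relation.TransGen (fun x y => D.edge x y ≠ 0) v w
  have : IsTrans (Fin D.n) r := ⟨fun _ _ _ h₁ h₂ => Relation.TransGen.trans h₂ h₁⟩
  have : Std.Irrefl r := ⟨fun v => D.acyclic v⟩
  refine Subrelation.wf (r := r) ?_ (Finite.wellFounded_of_trans_of_irrefl r)
  intro w v h
  exact Relation.TransGen.single (r := fun x y => D.edge x y ≠ 0) h

/-- The evaluation `ℰ(v)`: it is `0` if no edge leaves `v`, and otherwise `2` to the power
`∑ μ(e) ℰ(β(e))` over the edges `e` that leave `v`. -/
noncomputable def eval (D : SignedDag) : Fin D.n → ℝ :=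
  D.wf.fix fun v ih =>
    if ∀ w, D.edge v w = 0 then 0
    else (2 : ℝ) ^ (∑ w : {w // D.edge v w ≠ 0}, (D.edge v w.1 : ℝ) * ih w.1 w.2)

theorem eval_eq (D : SignedDag) (v : Fin D.n) :
    D.eval v = if ∀ w, D.edge v w = 0 then 0
      else (2 : ℝ) ^ (∑ w, (D.edge v w : ℝ) * D.eval w) := by
  have h : D.eval v = if ∀ w, D.edge v w = 0 then 0
      else (2 : ℝ) ^ (∑ w : {w // D.edge v w ≠ 0}, (D.edge v w.1 : ℝ) * D.eval w.1) := by
    conv_lhs => unfold eval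
    rw [WellFounded.fix_eq]
    rfl
  rw [h]
  have h2 : ∑ w : {w // D.edge v w ≠ 0}, (D.edge v w.1 : ℝ) * D.eval w.1 =
      ∑ w, (D.edge v w : ℝ) * D.eval w := by
    rw [← Finset.sum_subtype (Finset.univ.filter fun w => D.edge v w ≠ 0) (by simp)
      (fun w => (D.edge v w : ℝ) * D.eval w)]
    refine Finset.sum_subset (Finset.subset_univ _) fun w _ hw => ?_
    have h0 : D.edge v w = 0 := by simpa using hw
    simp [h0]
  rw [h2]

end SignedDag

/-- A power circuit: a signed, marked acyclic graph all of whose vertices evaluate to integers. -/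
structure PowerCircuit extends SignedDag where
  integral : ∀ v, ∃ z : ℤ, toSignedDag.eval v = z

namespace PowerCircuit

/-- The number `|V(𝒫)|` of vertices. -/
def numVertices (P : PowerCircuit) : ℕ := P.n

/-- The number `|M(𝒫)|` of marked vertices. -/
def numMarked (P : PowerCircuit) : ℕ := (Finset.univ.filter fun v => P.mark v ≠ 0).card

/-- The integer `𝒩(𝒫) = ∑ ν(v) ℰ(v)`, over the marked vertices, that the circuit represents. -/
noncomputable def number (P : PowerCircuit) : ℤ := ∑ v, (P.mark v : ℤ) * ⌊P.eval v⌋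

theorem number_eq (P : PowerCircuit) : (P.number : ℝ) = ∑ v, (P.mark v : ℝ) * P.eval v := by
  unfold number
  push_cast
  refine Finset.sum_congr rfl fun v _ => ?_
  obtain ⟨z, hz⟩ := P.integral v
  rw [hz]
  cases P.mark v <;> simp

/-- A circuit as a list of integers: the number `n` of vertices, then the `n × n` matrix of edge
labels row by row, then the `n` marks. -/
def encode (P : PowerCircuit) : List ℤ :=
  (P.n : ℤ) :: ((List.ofFn fun v => List.ofFn fun w => (P.edge v w : ℤ)).flatten ++
    List.ofFn fun v => (P.mark v : ℤ))

end PowerCircuit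

/-! ### The group and power sequences -/

/-- The two generators of the Baumslag–Solitar group. -/
inductive Gen
  | a
  | t

/-- The relator of `t⁻¹ a t = a²`. -/
def relators : Set (FreeGroup Gen) :=
  {(FreeGroup.of Gen.t)⁻¹ * FreeGroup.of Gen.a * FreeGroup.of Gen.t * (FreeGroup.of Gen.a ^ 2)⁻¹}

/-- The Baumslag–Solitar group `B₍₁,₂₎ = ⟨a, t ∣ t⁻¹ a t = a²⟩`. -/
abbrev B12 : Type := PresentedGroup relators

/-- A power sequence `(x₁, 𝒫₁), …, (xₙ, 𝒫ₙ)`. -/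
abbrev PowerSequence (X : Type) : Type := List (X × PowerCircuit)

/-- The word `x₁ ^ 𝒩(𝒫₁) ⋯ xₙ ^ 𝒩(𝒫ₙ)` represented by a power sequence. -/
noncomputable def PowerSequence.word {X : Type} (s : PowerSequence X) : FreeGroup X :=
  (s.map fun q => FreeGroup.of q.1 ^ q.2.number).prod

/-- The element of `B₍₁,₂₎` represented by a power sequence. -/
noncomputable def PowerSequence.toB12 (s : PowerSequence Gen) : B12 :=
  PresentedGroup.mk relators s.word

/-- The power sequence
`(a, m 0), (t, d 1), (a, m 1), …, (t, d k), (a, m k)`; here `d j` is indexed from `0`. -/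
def alternating {k : ℕ} (m : Fin (k + 1) → PowerCircuit) (d : Fin k → PowerCircuit) :
    PowerSequence Gen :=
  (Gen.a, m 0) :: (List.ofFn fun j : Fin k => [(Gen.t, d j), (Gen.a, m j.succ)]).flatten

/-- The size parameter of the sequence `alternating m d`. -/
def size {k : ℕ} (m : Fin (k + 1) → PowerCircuit) (d : Fin k → PowerCircuit) : ℕ :=
  ∑ j, ((m j).numVertices + (m j).numMarked) + ∑ j, (d j).numVertices

/-- The input: `k`, followed by the circuits in the order in which they stand in the sequence. -/
def encodeInput {k : ℕ} (m : Fin (k + 1) → PowerCircuit) (d : Fin k → PowerCircuit) : List ℤ :=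
  (k : ℤ) :: ((alternating m d).map fun q => q.2.encode).flatten

/-- An answer: `0` for "no", and `1` followed by a circuit for "yes". -/
def encodeAnswer : Option PowerCircuit → List ℤ
  | none => [0]
  | some P => 1 :: P.encode

/-! ### Random access machines

Programs for a random access machine with integer registers and finitely many integer arrays (those
named in the program). The arithmetic operations are addition and subtraction, and all elementary
operations have cost `1`. -/

/-- Expressions: constants, registers, array entries, sums and differences. -/
inductive Expr
  | lit (z : ℤ)
  | reg (x : ℕ)
  | get (A : ℕ) (e : Expr)
  | add (e f : Expr)
  | sub (e f : Expr)

/-- Programs. Tests are of the form `e > 0`. -/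
inductive Prog
  | skip
  | assign (x : ℕ) (e : Expr)
  | store (A : ℕ) (e f : Expr)
  | seq (p q : Prog)
  | ite (e : Expr) (p q : Prog)
  | loop (e : Expr) (p : Prog)

/-- The contents of the registers and of the arrays. -/
structure State where
  reg : ℕ → ℤ
  arr : ℕ → ℤ → ℤ

/-- The value of an expression. -/
def Expr.eval (σ : State) : Expr → ℤ
  | lit z => z
  | reg x => σ.reg x
  | get A e => σ.arr A (e.eval σ)
  | add e f => e.eval σ + f.eval σ
  | sub e f => e.eval σ - f.eval σ

/-- The number of elementary operations in the evaluation of an expression. -/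
def Expr.cost : Expr → ℕ
  | lit _ => 1
  | reg _ => 1
  | get _ e => e.cost + 1
  | add e f => e.cost + f.cost + 1
  | sub e f => e.cost + f.cost + 1

def State.setReg (σ : State) (x : ℕ) (z : ℤ) : State :=
  { σ with reg := Function.update σ.reg x z }

def State.setArr (σ : State) (A : ℕ) (i z : ℤ) : State :=
  { σ with arr := Function.update σ.arr A (Function.update (σ.arr A) i z) }

/-- `Runs p σ T τ`: started in the state `σ`, the program `p` halts in the state `τ` after exactly
`T` elementary operations. -/
inductive Runs : Prog → State → ℕ → State → Prop
  | skip (σ : State) : Runs Prog.skip σ 1 σ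
  | assign (σ : State) (x : ℕ) (e : Expr) :
      Runs (Prog.assign x e) σ (e.cost + 1) (σ.setReg x (e.eval σ))
  | store (σ : State) (A : ℕ) (e f : Expr) :
      Runs (Prog.store A e f) σ (e.cost + f.cost + 1) (σ.setArr A (e.eval σ) (f.eval σ))
  | seq {p q : Prog} {σ τ ρ : State} {T U : ℕ} :
      Runs p σ T τ → Runs q τ U ρ → Runs (Prog.seq p q) σ (T + U) ρ
  | ite_true {e : Expr} {p q : Prog} {σ τ : State} {T : ℕ} :
      0 < e.eval σ → Runs p σ T τ → Runs (Prog.ite e p q) σ (e.cost + 1 + T) τ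
  | ite_false {e : Expr} {p q : Prog} {σ τ : State} {T : ℕ} :
      ¬ 0 < e.eval σ → Runs q σ T τ → Runs (Prog.ite e p q) σ (e.cost + 1 + T) τ
  | loop_true {e : Expr} {p : Prog} {σ τ ρ : State} {T U : ℕ} :
      0 < e.eval σ → Runs p σ T τ → Runs (Prog.loop e p) τ U ρ →
      Runs (Prog.loop e p) σ (e.cost + 1 + T + U) ρ
  | loop_false {e : Expr} {p : Prog} {σ : State} :
      ¬ 0 < e.eval σ → Runs (Prog.loop e p) σ (e.cost + 1) σ

/-- The initial state: the input stands in array `0` from index `0` on, all else is `0`. -/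
def initial (input : List ℤ) : State where
  reg := fun _ => 0
  arr := fun A i => if A = 0 ∧ 0 ≤ i then input.getD i.toNat 0 else 0

/-- On the given input the program halts after exactly `T` elementary operations, with the length
of the output in register `0` and the output itself in array `1` from index `0` on. -/
def Computes (p : Prog) (input output : List ℤ) (T : ℕ) : Prop :=
  ∃ τ, Runs p (initial input) T τ ∧ τ.reg 0 = output.length ∧
    ∀ i : ℕ, ∀ h : i < output.length, τ.arr 1 i = output[i]

end PowerBS

/-!
The group acts on `ℚ` by affine maps: `a` is the translation `x ↦ x + 1`, and `t` is the
contraction `x ↦ x / 2`. Every element has a normal form `t ^ i * a ^ n * t ^ (-j)`, and so the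
action is faithful (`action_injective`). If an element acts as `x ↦ 2 ^ (-δ) * x + b`, then it is
of the form `a ^ p` if and only if `δ = 0` and `b` is an integer, and of the form `t ^ p` if and
only if `b = 0` (`eq_a_zpow_iff`, `eq_t_zpow_iff`).

For a power sequence, all circuits are put together into one directed acyclic graph with `N`
vertices (`Merged.ofSeq`). Then `δ` is the sum of the numbers of the circuits for `t`, and `b` is
the sum of the terms `± 2 ^ f v` over the marked vertices `v` of the circuits for `a` that have a
successor, where `f v` is the exponent of the value of `v` minus the sum of the preceding circuits
for `t` (`Merged.action_toB12`, `Merged.Valid.shift_eq`). One has to decide whether `δ = 0`,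
whether `b = 0`, and whether `b` is an integer.

The values of the vertices can be iterated exponentials, which cannot be computed. But only signed
sums with small coefficients matter, and whether such a sum of powers of two vanishes, what sign it
has, or which small integer it is, does not depend on long gaps between the exponents. Two integers
are said to agree up to `L` if they are equal, or both exceed `L`, or both are less than `-L`. If
two systems of exponents have differences that agree up to `L`, then so do the sums of powers of
two with these exponents, provided that the absolute values of the coefficients add up to at most
`2 ^ L` (`agree_sum`): after a gap of more than `L`, a nonzero partial sum outweighs all the
rest. Surrogate values are therefore computed in rounds. A round computes the exponents of all
vertices from the current surrogates, sorts them, cuts the gaps down to `L + 1`, and takes the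
powers of two with these exponents as the new surrogates. One round makes the surrogates right for
the vertices of one more rank (`Approximates.step`), so that `N` rounds suffice. Coefficients of
absolute value up to `4` are needed, and `L = N + 3` is enough for them. A surrogate has about
`N ^ 2` binary digits, but it arises from `1` by `O(N ^ 2)` doublings. A round costs `O(N ^ 2)`
operations: the edges are scanned once, the exponents are sorted by at most `N` searches, and each
of at most `N` gaps takes at most `L + 1` doublings. All rounds together cost `O(N ^ 3)`.

With the surrogates one decides `δ = 0`. The exponents `f v`, together with an anchor for the
exponent `0`, are treated by one more round after a shift that makes them nonnegative
(`sum_zpow_eq_zero_iff`, `decides_of_weights`). This shows the signs of the `f v`, and whether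
`b = 0`. The terms with `f v ≥ 0` are integers. The others sum up to a number of absolute value
at most their number, so that `b` is an integer if and only if this sum is one of the integers
`± q` with `q ≤ N`; this is tested with the weight of the anchor (`Merged.shift_int_iff`).

The answer for `t` consists of the circuits for `t` (`Merged.Valid.exists_t_circuit`). For the
answer for `a`, the union of all circuits gets one new vertex for every marked vertex `v` of the
circuits for `a` (`Merged.Valid.exists_a_circuit`). If `f v ≥ 0`, then its value is `2 ^ f v`: it
has the successors of `v`, and the marked vertices of the preceding circuits for `t` with the opposite
signs. These are different vertices, so that no multiple edges arise. Of the new vertices with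
`f v < 0`, a number of `q` get the value `1` and the others the value `0`.
-/

namespace PowerBS

/-! ### Reasoning about programs -/

infixr:65 " ;; " => Prog.seq

@[simp] theorem State.setReg_reg (σ : State) (x : ℕ) (z : ℤ) (y : ℕ) :
    (σ.setReg x z).reg y = if y = x then z else σ.reg y := by
  simp [State.setReg, Function.update_apply]

@[simp] theorem State.setReg_arr (σ : State) (x : ℕ) (z : ℤ) :
    (σ.setReg x z).arr = σ.arr := rfl

@[simp] theorem State.setArr_reg (σ : State) (A : ℕ) (i z : ℤ) :
    (σ.setArr A i z).reg = σ.reg := rfl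

@[simp] theorem State.setArr_arr (σ : State) (A : ℕ) (i z : ℤ) (B : ℕ) (j : ℤ) :
    (σ.setArr A i z).arr B j = if B = A ∧ j = i then z else σ.arr B j := by
  by_cases h : B = A
  · subst h
    simp [State.setArr, Function.update_apply]
  · simp [State.setArr, h]

namespace Prog

/-- The registers that a program may write. -/
def wregs : Prog → List ℕ
  | skip => []
  | assign x _ => [x]
  | store _ _ _ => []
  | seq p q => p.wregs ++ q.wregs
  | ite _ p q => p.wregs ++ q.wregs
  | loop _ p => p.wregs

/-- The arrays that a program may write. -/
def warrs : Prog → List ℕ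
  | skip => []
  | assign _ _ => []
  | store A _ _ => [A]
  | seq p q => p.warrs ++ q.warrs
  | ite _ p q => p.warrs ++ q.warrs
  | loop _ p => p.warrs

/-- Whether a program contains no loop. -/
def flat : Prog → Bool
  | skip => true
  | assign _ _ => true
  | store _ _ _ => true
  | seq p q => p.flat && q.flat
  | ite _ p q => p.flat && q.flat
  | loop _ _ => false

/-- The effect of a program without loops (loops are skipped). -/
def exec : Prog → State → State
  | skip, σ => σ
  | assign x e, σ => σ.setReg x (e.eval σ)
  | store A e f, σ => σ.setArr A (e.eval σ) (f.eval σ)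
  | seq p q, σ => q.exec (p.exec σ)
  | ite e p q, σ => if 0 < e.eval σ then p.exec σ else q.exec σ
  | loop _ _, σ => σ

/-- A bound on the running time of a program without loops. -/
def time : Prog → ℕ
  | skip => 1
  | assign _ e => e.cost + 1
  | store _ e f => e.cost + f.cost + 1
  | seq p q => p.time + q.time
  | ite e p q => e.cost + 1 + max p.time q.time
  | loop _ _ => 0

/-- The loop `for x = 0, …, n - 1 do p`, where `n` is the content of a register. -/
def forTo (x n : ℕ) (p : Prog) : Prog :=
  assign x (.lit 0) ;; loop (.sub (.reg n) (.reg x)) (p ;; assign x (.add (.reg x) (.lit 1)))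

/-- Execution of `p` if the expression `e` is not zero. -/
def ifNonzero (e : Expr) (p : Prog) : Prog :=
  ite e p (ite (.sub (.lit 0) e) p skip)

/-- Execution of `p` if the expression `e` is zero. -/
def ifZero (e : Expr) (p q : Prog) : Prog :=
  ite e q (ite (.sub (.lit 0) e) q p)

end Prog

/-- `τ` agrees with `σ` outside the registers and arrays that `p` may write. -/
def Frame (p : Prog) (σ τ : State) : Prop :=
  (∀ x, x ∉ p.wregs → τ.reg x = σ.reg x) ∧ ∀ A, A ∉ p.warrs → τ.arr A = σ.arr A

theorem Frame.refl (p : Prog) (σ : State) : Frame p σ σ := ⟨fun _ _ => rfl, fun _ _ => rfl⟩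

theorem Frame.trans {p : Prog} {σ τ ρ : State} (h : Frame p σ τ) (h' : Frame p τ ρ) :
    Frame p σ ρ :=
  ⟨fun x hx => (h'.1 x hx).trans (h.1 x hx), fun A hA => (h'.2 A hA).trans (h.2 A hA)⟩

theorem Frame.weaken {p q : Prog} {σ τ : State} (h : Frame p σ τ)
    (hr : ∀ x ∈ p.wregs, x ∈ q.wregs) (ha : ∀ x ∈ p.warrs, x ∈ q.warrs) : Frame q σ τ :=
  ⟨fun x hx => h.1 x fun h' => hx (hr x h'), fun x hx => h.2 x fun h' => hx (ha x h')⟩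

theorem Runs.frame {p : Prog} {σ τ : State} {T : ℕ} (h : Runs p σ T τ) : Frame p σ τ := by
  induction h with
  | skip σ => exact Frame.refl _ _
  | assign σ x e =>
    refine ⟨fun y hy => ?_, fun _ _ => rfl⟩
    have : y ≠ x := by simpa [Prog.wregs] using hy
    simp [this]
  | store σ A e f =>
    refine ⟨fun _ _ => rfl, fun B hB => ?_⟩
    have : B ≠ A := by simpa [Prog.warrs] using hB
    funext j
    simp [this]
  | seq _ _ h₁ h₂ =>
    exact (h₁.weaken (by simp +contextual [Prog.wregs]) (by simp +contextual [Prog.warrs])).trans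
      (h₂.weaken (by simp +contextual [Prog.wregs]) (by simp +contextual [Prog.warrs]))
  | ite_true _ _ h =>
    exact h.weaken (by simp +contextual [Prog.wregs]) (by simp +contextual [Prog.warrs])
  | ite_false _ _ h =>
    exact h.weaken (by simp +contextual [Prog.wregs]) (by simp +contextual [Prog.warrs])
  | loop_true _ _ _ h₁ h₂ =>
    exact (h₁.weaken (by simp [Prog.wregs]) (by simp [Prog.warrs])).trans h₂
  | loop_false _ => exact Frame.refl _ _

/-- Total correctness with a time bound: started in `σ`, the program `p` halts after at most `B`
operations, in a state that satisfies `R`. -/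
def Spec (p : Prog) (σ : State) (B : ℕ) (R : State → Prop) : Prop :=
  ∃ T τ, Runs p σ T τ ∧ T ≤ B ∧ R τ

namespace Spec

variable {p q : Prog} {σ : State} {B B' B₁ B₂ : ℕ} {R R' R₁ : State → Prop}

theorem mono (h : Spec p σ B R) (hB : B ≤ B') (hR : ∀ τ, Frame p σ τ → R τ → R' τ) :
    Spec p σ B' R' := by
  obtain ⟨T, τ, h, hT, hτ⟩ := h
  exact ⟨T, τ, h, hT.trans hB, hR τ h.frame hτ⟩

theorem seq (h : Spec p σ B₁ R₁) (h' : ∀ τ, Frame p σ τ → R₁ τ → Spec q τ B₂ R) :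
    Spec (p ;; q) σ (B₁ + B₂) R := by
  obtain ⟨T, τ, h, hT, hτ⟩ := h
  obtain ⟨U, ρ, h', hU, hρ⟩ := h' τ h.frame hτ
  exact ⟨T + U, ρ, .seq h h', by omega, hρ⟩

theorem ite {e : Expr} (h : 0 < e.eval σ → Spec p σ B R) (h' : ¬ 0 < e.eval σ → Spec q σ B R) :
    Spec (.ite e p q) σ (e.cost + 1 + B) R := by
  by_cases he : 0 < e.eval σ
  · obtain ⟨T, τ, h, hT, hτ⟩ := h he
    exact ⟨_, τ, .ite_true he h, by omega, hτ⟩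
  · obtain ⟨T, τ, h, hT, hτ⟩ := h' he
    exact ⟨_, τ, .ite_false he h, by omega, hτ⟩

theorem runs_exec (hp : p.flat = true) (σ : State) :
    ∃ T, Runs p σ T (p.exec σ) ∧ T ≤ p.time := by
  induction p generalizing σ with
  | skip => exact ⟨_, .skip σ, le_rfl⟩
  | assign x e => exact ⟨_, .assign σ x e, le_rfl⟩
  | store A e f => exact ⟨_, .store σ A e f, le_rfl⟩
  | seq p q hp' hq' =>
    simp only [Prog.flat, Bool.and_eq_true] at hp
    obtain ⟨T, h, hT⟩ := hp' hp.1 σ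
    obtain ⟨U, h', hU⟩ := hq' hp.2 (p.exec σ)
    exact ⟨_, .seq h h', by simp only [Prog.time]; omega⟩
  | ite e p q hp' hq' =>
    simp only [Prog.flat, Bool.and_eq_true] at hp
    obtain ⟨T, h, hT⟩ := hp' hp.1 σ
    obtain ⟨U, h', hU⟩ := hq' hp.2 σ
    by_cases he : 0 < e.eval σ
    · refine ⟨e.cost + 1 + T, ?_, by simp only [Prog.time]; omega⟩
      simp only [Prog.exec, he, if_true]
      exact .ite_true he h
    · refine ⟨e.cost + 1 + U, ?_, by simp only [Prog.time]; omega⟩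
      simp only [Prog.exec, he, if_false]
      exact .ite_false he h'
  | loop e p => simp [Prog.flat] at hp

theorem of_flat (hp : p.flat = true) (hB : p.time ≤ B) (hR : R (p.exec σ)) : Spec p σ B R := by
  obtain ⟨T, h, hT⟩ := runs_exec hp σ
  exact ⟨T, _, h, hT.trans hB, hR⟩

/-- The rule for a bounded loop with the invariant `I`: the iteration `j` leads from `I j` to
`I (j + 1)`. What the loop body does not write need not be mentioned in the invariant. -/
theorem forTo {x n N : ℕ} (I : ℕ → State → Prop) (hn : σ.reg n = N)
    (hx : x ∉ p.wregs) (hnp : n ∉ (Prog.forTo x n p).wregs)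
    (h0 : I 0 (σ.setReg x 0))
    (hstep : ∀ j < N, ∀ τ, Frame (Prog.forTo x n p) σ τ → τ.reg x = j → I j τ →
      Spec p τ B (fun ρ => I (j + 1) (ρ.setReg x (j + 1)))) :
    Spec (Prog.forTo x n p) σ (N * (B + 8) + 6) (I N) := by
  have key : ∀ i j : ℕ, j + i = N → ∀ τ, Frame (Prog.forTo x n p) σ τ → τ.reg x = j → I j τ →
      Spec (.loop (.sub (.reg n) (.reg x)) (p ;; .assign x (.add (.reg x) (.lit 1)))) τ
        (i * (B + 8) + 4) (I N) := by
    intro i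
    induction i with
    | zero =>
      intro j hj τ hF hτ hI
      obtain rfl : j = N := by omega
      refine ⟨_, τ, .loop_false ?_, ?_, hI⟩
      · simp [Expr.eval, hτ, hF.1 n hnp, hn]
      · simp [Expr.cost]
    | succ i ih =>
      intro j hj τ hF hτ hI
      obtain ⟨T, ρ, hr, hT, hρ⟩ := hstep j (by omega) τ hF hτ hI
      have hρx : ρ.reg x = j := by rw [hr.frame.1 x hx, hτ]
      have hr2 : Runs (p ;; .assign x (.add (.reg x) (.lit 1))) τ (T + 4)
          (ρ.setReg x (j + 1)) := by
        refine .seq hr ?_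
        have := Runs.assign ρ x (.add (.reg x) (.lit 1))
        simpa [Expr.eval, Expr.cost, hρx] using this
      obtain ⟨U, ω, hu, hU, hω⟩ := ih (j + 1) (by omega) (ρ.setReg x (j + 1))
        (hF.trans (hr2.frame.weaken (by simp +contextual [Prog.forTo, Prog.wregs])
          (by simp +contextual [Prog.forTo, Prog.warrs]))) (by simp) hρ
      refine ⟨_, ω, .loop_true ?_ hr2 hu, ?_, hω⟩
      · simp [Expr.eval, hτ, hF.1 n hnp, hn]
        omega
      · simp only [Expr.cost]
        have : (i + 1) * (B + 8) = i * (B + 8) + (B + 8) := by ring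
        omega
  have h1 := Runs.assign σ x (.lit 0)
  have h2 : Frame (Prog.forTo x n p) σ (σ.setReg x 0) :=
    h1.frame.weaken (by simp [Prog.forTo, Prog.wregs]) (by simp [Prog.warrs])
  obtain ⟨U, ω, hu, hU, hω⟩ := key N 0 (by omega) (σ.setReg x 0) h2 (by simp) h0
  exact ⟨_, ω, .seq h1 hu, by simp only [Expr.cost]; omega, hω⟩

end Spec

/-- The list `ℓ` is the output written so far. -/
def Out (σ : State) (ℓ : List ℤ) : Prop :=
  σ.reg 0 = ℓ.length ∧ ∀ i : ℕ, ∀ h : i < ℓ.length, σ.arr 1 i = ℓ[i]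

/-- Append the value of an expression to the output. -/
def Prog.emit (e : Expr) : Prog :=
  .store 1 (.reg 0) e ;; .assign 0 (.add (.reg 0) (.lit 1))

theorem Out.congr {σ τ : State} {ℓ : List ℤ} (h : Out σ ℓ) (h0 : τ.reg 0 = σ.reg 0)
    (h1 : τ.arr 1 = σ.arr 1) : Out τ ℓ := by
  simpa [Out, h0, h1] using h

theorem Out.emit {σ : State} {ℓ : List ℤ} (h : Out σ ℓ) (e : Expr) :
    Out ((Prog.emit e).exec σ) (ℓ ++ [e.eval σ]) := by
  constructor
  · simp [Prog.emit, Prog.exec, Expr.eval, h.1]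
  · intro i hi
    simp only [List.length_append, List.length_singleton] at hi
    rcases Nat.lt_succ_iff_lt_or_eq.1 hi with hi' | rfl
    · have : (i : ℤ) ≠ ℓ.length := by exact_mod_cast hi'.ne
      simp [Prog.emit, Prog.exec, h.1, Expr.eval, this, List.getElem_append_left hi', h.2 i hi']
    · simp [Prog.emit, Prog.exec, h.1, Expr.eval]

theorem Spec.emit {σ : State} {ℓ : List ℤ} {B : ℕ} {z : ℤ} (h : Out σ ℓ) (e : Expr)
    (hz : e.eval σ = z) (hB : e.cost + 6 ≤ B) :
    Spec (Prog.emit e) σ B (fun τ => Out τ (ℓ ++ [z])) :=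
  Spec.of_flat rfl (by simp only [Prog.emit, Prog.time, Expr.cost]; omega) (hz ▸ h.emit e)

/-- A bounded loop whose iteration `j` appends the list `g j` to the output. -/
theorem Spec.forTo_emit {p : Prog} {σ : State} {B x n N : ℕ} {ℓ : List ℤ} (g : ℕ → List ℤ)
    (J : ℕ → State → Prop) (hn : σ.reg n = N)
    (hx : x ∉ p.wregs) (hnp : n ∉ (Prog.forTo x n p).wregs) (hx0 : x ≠ 0) (h : Out σ ℓ)
    (hJ : J 0 (σ.setReg x 0))
    (hstep : ∀ j < N, ∀ τ ℓ', Frame (Prog.forTo x n p) σ τ → τ.reg x = j → J j τ → Out τ ℓ' →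
      Spec p τ B (fun ρ => J (j + 1) (ρ.setReg x (j + 1)) ∧ Out ρ (ℓ' ++ g j))) :
    Spec (Prog.forTo x n p) σ (N * (B + 8) + 6)
      (fun τ => J N τ ∧ Out τ (ℓ ++ (List.range N).flatMap g)) := by
  refine Spec.forTo (fun j τ => J j τ ∧ Out τ (ℓ ++ (List.range j).flatMap g)) hn hx hnp
    ⟨hJ, ?_⟩ ?_
  · rw [List.range_zero, List.flatMap_nil, List.append_nil]
    exact h.congr (by simp [hx0.symm]) rfl
  · rintro j hj τ hF hτ ⟨hJτ, hO⟩
    refine (hstep j hj τ _ hF hτ hJτ hO).mono le_rfl ?_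
    rintro ρ - ⟨h1, h2⟩
    refine ⟨h1, Out.congr (σ := ρ) ?_ (by simp [hx0.symm]) rfl⟩
    simpa [List.range_succ, List.append_assoc] using h2

/-! ### Surrogates for large integers -/

/-- Two integers agree up to `L` if they become equal when everything of absolute value greater
than `L` is replaced by `∞` or `-∞`. -/
def Agree (L : ℕ) (a b : ℤ) : Prop :=
  a = b ∨ (L < a ∧ L < b) ∨ (a < -L ∧ b < -L)

namespace Agree

variable {L : ℕ} {a b c : ℤ}

theorem refl (a : ℤ) : Agree L a a := Or.inl rfl

theorem trans (h : Agree L a b) (h' : Agree L b c) : Agree L a c := by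
  unfold Agree at *; omega

theorem neg (h : Agree L a b) : Agree L (-a) (-b) := by
  unfold Agree at *; omega

theorem nonneg_iff (h : Agree L a b) : 0 ≤ a ↔ 0 ≤ b := by
  unfold Agree at *; omega

theorem eq_zero_iff (h : Agree L a b) : a = 0 ↔ b = 0 := by
  unfold Agree at *; omega

end Agree

/-- A nonzero multiple of a power of two, followed by a gap of more than `L`, outweighs the rest:
only its sign is visible up to `L`. -/
theorem agree_of_dominant {L m n m' n' : ℕ} {K A R R' : ℤ} (hK : K ≤ 2 ^ L) (hA : A ≠ 0)
    (hm : n + L + 1 ≤ m) (hm' : n' + L + 1 ≤ m') (hR : |R| ≤ K * 2 ^ n)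
    (hR' : |R'| ≤ K * 2 ^ n') : Agree L (A * 2 ^ m + R) (A * 2 ^ m' + R') := by
  have key : ∀ {m n : ℕ} {R : ℤ}, n + L + 1 ≤ m → |R| ≤ K * 2 ^ n → (L : ℤ) < 2 ^ m - |R| := by
    intro m n R hm hR
    have h1 : (2 : ℤ) ^ (n + L + 1) ≤ 2 ^ m := pow_le_pow_right₀ (by norm_num) hm
    have h2 : (2 : ℤ) ^ (n + L + 1) = 2 * (2 ^ n * 2 ^ L) := by ring
    have h3 : K * 2 ^ n ≤ 2 ^ L * 2 ^ n := by gcongr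
    have h4 : (2 : ℤ) ^ L ≤ 2 ^ n * 2 ^ L := le_mul_of_one_le_left (by positivity)
      (one_le_pow₀ (by norm_num))
    have h5 : (L : ℤ) < 2 ^ L := by exact_mod_cast Nat.lt_two_pow_self
    linarith
  have k1 := key hm hR
  have k2 := key hm' hR'
  have p1 : (0 : ℤ) < 2 ^ m := by positivity
  have p2 : (0 : ℤ) < 2 ^ m' := by positivity
  have a1 := neg_abs_le R
  have a2 := neg_abs_le R'
  have b1 := le_abs_self R
  have b2 := le_abs_self R'
  rcases lt_or_gt_of_ne hA with h | h
  · right; right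
    constructor <;> nlinarith
  · right; left
    constructor <;> nlinarith

theorem abs_sum_mul_two_pow_le {ι : Type*} (s : Finset ι) (c : ι → ℤ) (x : ι → ℕ) {n : ℕ} {K : ℤ}
    (hx : ∀ i ∈ s, x i ≤ n) (hc : ∑ i ∈ s, |c i| ≤ K) : |∑ i ∈ s, c i * 2 ^ x i| ≤ K * 2 ^ n := by
  calc |∑ i ∈ s, c i * 2 ^ x i| ≤ ∑ i ∈ s, |c i * 2 ^ x i| := Finset.abs_sum_le_sum_abs _ _
    _ ≤ ∑ i ∈ s, |c i| * 2 ^ n := by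
        refine Finset.sum_le_sum fun i hi => ?_
        rw [abs_mul, abs_of_pos (by positivity : (0 : ℤ) < 2 ^ x i)]
        gcongr
        · norm_num
        · exact hx i hi
    _ = (∑ i ∈ s, |c i|) * 2 ^ n := by rw [Finset.sum_mul]
    _ ≤ K * 2 ^ n := by gcongr

/-- The induction behind `agree_sum`, from the greatest exponent downwards: `A * 2 ^ x t` is the
partial sum over the exponents that have been treated, as a multiple of the least of their powers
of two, and `s` is the set of the remaining indices. -/
theorem agree_pivot {ι : Type*} {L : ℕ} {K : ℤ} (hK : K ≤ 2 ^ L) (u : Finset ι) (c : ι → ℤ)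
    (x y : ι → ℕ) (h0 : ∀ i ∈ u, Agree L (x i) (y i))
    (h : ∀ i ∈ u, ∀ j ∈ u, Agree L (x i - x j) (y i - y j)) (s : Finset ι) :
    ∀ t ∈ u, s ⊆ u → (∀ i ∈ s, x i ≤ x t) → ∑ i ∈ s, |c i| ≤ K → ∀ A : ℤ,
      Agree L (A * 2 ^ x t + ∑ i ∈ s, c i * 2 ^ x i) (A * 2 ^ y t + ∑ i ∈ s, c i * 2 ^ y i) := by
  classical
  induction s using Finset.induction_on_max_value x with
  | empty =>
    intro t ht _ _ hc A
    simp only [Finset.sum_empty, add_zero] at hc ⊢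
    rcases h0 t ht with h | h | h
    · have : x t = y t := by exact_mod_cast h
      rw [this]; exact .refl _
    · by_cases hA : A = 0
      · simp [hA, Agree.refl]
      · have := agree_of_dominant (R := 0) (R' := 0) (K := 0) (n := 0) (n' := 0) (m := x t)
          (m' := y t) (L := L) (by positivity) hA (by omega) (by omega) (by simp) (by simp)
        simpa using this
    · omega
  | insert a s ha hmax ih =>
    intro t ht hs hle hc A
    have hau : a ∈ u := hs (Finset.mem_insert_self _ _)
    have hsu : s ⊆ u := fun i hi => hs (Finset.mem_insert_of_mem hi)
    rw [Finset.sum_insert ha] at hc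
    have hc' : ∑ i ∈ s, |c i| ≤ K := by
      have := abs_nonneg (c a)
      linarith
    have ih' := ih a hau hsu hmax hc'
    have hat : x a ≤ x t := hle a (Finset.mem_insert_self _ _)
    simp only [Finset.sum_insert ha]
    by_cases hA : A = 0
    · simpa [hA] using ih' (c a)
    -- A gap of at most `L` is the same on both sides, and `A` can absorb it.
    rcases h t ht a hau with hd | hd | hd
    · have hx : x t = (x t - x a) + x a := by omega
      have hy : y t = (x t - x a) + y a := by omega
      have := ih' (A * 2 ^ (x t - x a) + c a)
      rw [add_mul, add_mul, mul_assoc, mul_assoc, ← pow_add, ← pow_add, ← hx, ← hy, add_assoc,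
        add_assoc] at this
      exact this
    · have hya : ∀ i ∈ insert a s, y i ≤ y a := by
        intro i hi
        have hx : x i ≤ x a := by
          rcases Finset.mem_insert.1 hi with rfl | hi
          · exact le_rfl
          · exact hmax i hi
        have := (h a hau i (hs hi)).nonneg_iff
        omega
      have hxa : ∀ i ∈ insert a s, x i ≤ x a := by
        intro i hi
        rcases Finset.mem_insert.1 hi with rfl | hi
        · exact le_rfl
        · exact hmax i hi
      have b1 := abs_sum_mul_two_pow_le (insert a s) c x (K := K) hxa
        (by rwa [Finset.sum_insert ha])
      have b2 := abs_sum_mul_two_pow_le (insert a s) c y (K := K) hya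
        (by rwa [Finset.sum_insert ha])
      rw [Finset.sum_insert ha] at b1 b2
      exact agree_of_dominant hK hA (by omega) (by omega) b1 b2
    · omega

/-- If the exponents `x` and `y` have the same differences, up to `L`, then the sums of powers of
two with these exponents agree up to `L`, provided that the coefficients are small. From the top
exponent downwards the partial sums are either equal, or they are followed by a gap of more than
`L` on both sides; a nonzero partial sum before such a gap outweighs all that follows. -/
theorem agree_sum {ι : Type*} {L : ℕ} {K : ℤ} (hK : K ≤ 2 ^ L) (s : Finset ι) (c : ι → ℤ)
    (x y : ι → ℕ) (hc : ∑ i ∈ s, |c i| ≤ K) (h0 : ∀ i ∈ s, Agree L (x i) (y i))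
    (h : ∀ i ∈ s, ∀ j ∈ s, Agree L (x i - x j) (y i - y j)) :
    Agree L (∑ i ∈ s, c i * 2 ^ x i) (∑ i ∈ s, c i * 2 ^ y i) := by
  rcases s.eq_empty_or_nonempty with rfl | hs
  · simp [Agree.refl]
  · obtain ⟨t, ht, hmax⟩ := s.exists_max_image x hs
    simpa using agree_pivot hK s c x y h0 h s t ht subset_rfl hmax hc 0

/-- The function `y` compresses the points of `D`: it shifts them so that short gaps are kept
and long gaps stay long. -/
def Compresses (L : ℕ) (D : Set ℤ) (y : ℤ → ℕ) : Prop :=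
  y 0 = 0 ∧ ∀ u ∈ insert 0 D, ∀ v ∈ insert 0 D, Agree L (u - v) (y u - y v)

/-- The numbers `W i` are the powers of two with the exponents `X i`, after a compression of these
exponents; a negative exponent stands for a summand that is absent, of weight `0`. -/
def Weights (L n : ℕ) (X W : ℕ → ℤ) : Prop :=
  ∃ y : ℤ → ℕ, Compresses L {u | ∃ i < n, X i = u ∧ 0 ≤ u} y ∧
    ∀ i < n, W i = if X i < 0 then 0 else 2 ^ y (X i)

/-- A system of exponents `f`, known through surrogates `F` with the same differences up to `L`:
after a shift by the least surrogate and a compression, the weights detect the vanishing of sums of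
powers of two with small coefficients. -/
theorem sum_zpow_eq_zero_iff {L n : ℕ} {K : ℤ} (hK : K ≤ 2 ^ L) {s : Finset ℕ}
    (hs : ∀ i ∈ s, i < n) {f F X W : ℕ → ℤ} {b : ℕ} (hb : b ∈ s) (hmin : ∀ i ∈ s, F b ≤ F i)
    (h : ∀ i ∈ s, ∀ j ∈ s, Agree L (f i - f j) (F i - F j)) (hX : ∀ i ∈ s, X i = F i - F b)
    (hW : Weights L n X W) {c : ℕ → ℤ} (hc : ∑ i ∈ s, |c i| ≤ K) :
    ∑ i ∈ s, (c i : ℚ) * 2 ^ f i = 0 ↔ ∑ i ∈ s, c i * W i = 0 := by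
  obtain ⟨y, ⟨hy0, hy⟩, hW⟩ := hW
  have hf : ∀ i ∈ s, 0 ≤ f i - f b := fun i hi =>
    (h i hi b hb).nonneg_iff.2 (by have := hmin i hi; omega)
  have hX0 : ∀ i ∈ s, 0 ≤ X i := fun i hi => by
    have := hmin i hi
    rw [hX i hi]; omega
  have hmem : ∀ i ∈ s, X i ∈ insert 0 {u | ∃ i < n, X i = u ∧ 0 ≤ u} := fun i hi =>
    Or.inr ⟨i, hs i hi, rfl, hX0 i hi⟩
  have key := agree_sum hK s c (fun i => (f i - f b).toNat) (fun i => y (X i)) hc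
    (fun i hi => by
      rw [Int.toNat_of_nonneg (hf i hi)]
      refine (h i hi b hb).trans ?_
      have := hy _ (hmem i hi) 0 (Or.inl rfl)
      simpa [hy0, hX i hi] using this)
    (fun i hi j hj => by
      rw [Int.toNat_of_nonneg (hf i hi), Int.toNat_of_nonneg (hf j hj)]
      have h1 := hy _ (hmem i hi) _ (hmem j hj)
      have h2 := h i hi j hj
      rw [show f i - f b - (f j - f b) = f i - f j by ring]
      rw [show X i - X j = F i - F j by rw [hX i hi, hX j hj]; ring] at h1
      exact h2.trans h1)
  have e1 : ∑ i ∈ s, (c i : ℚ) * 2 ^ f i =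
      2 ^ f b * ((∑ i ∈ s, c i * 2 ^ (f i - f b).toNat : ℤ) : ℚ) := by
    push_cast
    rw [Finset.mul_sum]
    refine Finset.sum_congr rfl fun i hi => ?_
    rw [← zpow_natCast (2 : ℚ) (f i - f b).toNat, Int.toNat_of_nonneg (hf i hi),
      mul_left_comm, ← zpow_add₀ (by norm_num)]
    congr 2
    ring
  have e2 : ∑ i ∈ s, c i * W i = ∑ i ∈ s, c i * 2 ^ y (X i) := by
    refine Finset.sum_congr rfl fun i hi => ?_
    rw [hW i (hs i hi), if_neg (not_lt.2 (hX0 i hi))]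
  rw [e1, e2, ← key.eq_zero_iff, mul_eq_zero, Int.cast_eq_zero]
  simp [zpow_ne_zero]

/-- The values `E v` of a graph on the vertices `0, …, N - 1`, in integers: `e v w` is the label of
the edge from `v` to `w`, or `0`, and `h` is a rank function that decreases along the edges. -/
structure Evaluates (N : ℕ) (e : ℕ → ℕ → ℤ) (E : ℕ → ℤ) (h : ℕ → ℕ) : Prop where
  abs_le : ∀ v w, |e v w| ≤ 1
  rank : ∀ v < N, ∀ w < N, e v w ≠ 0 → h w < h v
  leaf : ∀ v < N, (∀ w < N, e v w = 0) → E v = 0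
  exponent_nonneg : ∀ v < N, 0 ≤ ∑ w ∈ Finset.range N, e v w * E w
  node : ∀ v < N, ¬ (∀ w < N, e v w = 0) →
    E v = 2 ^ (∑ w ∈ Finset.range N, e v w * E w).toNat

/-- Sums of the surrogate values `W v`, over vertices of rank less than `r` and with small
coefficients, agree with those of the true values `E v`. -/
def Approximates (L N : ℕ) (E : ℕ → ℤ) (h : ℕ → ℕ) (r : ℕ) (W : ℕ → ℤ) : Prop :=
  ∀ c : ℕ → ℤ, (∀ w < N, r ≤ h w → c w = 0) → ∑ w ∈ Finset.range N, |c w| ≤ 4 * N →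
    Agree L (∑ w ∈ Finset.range N, c w * E w) (∑ w ∈ Finset.range N, c w * W w)

theorem sum_abs_le {N : ℕ} {b : ℤ} {c : ℕ → ℤ} (h : ∀ w < N, |c w| ≤ b) :
    ∑ w ∈ Finset.range N, |c w| ≤ b * N := by
  calc ∑ w ∈ Finset.range N, |c w| ≤ ∑ w ∈ Finset.range N, b :=
        Finset.sum_le_sum fun w hw => h w (Finset.mem_range.1 hw)
    _ = b * N := by simp [mul_comm]

/-- One round of the computation of the surrogate values: if they are right for the vertices of
rank less than `r`, then the weights for the exponents computed from them are right for the vertices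
of rank at most `r`. The exponents of the other vertices are arbitrary, but additional points do
not harm a compression. -/
theorem Approximates.step {L N r : ℕ} {e : ℕ → ℕ → ℤ} {E W X W' : ℕ → ℤ} {h : ℕ → ℕ}
    (hL : 4 * (N : ℤ) ≤ 2 ^ L) (hE : Evaluates N e E h) (hW : Approximates L N E h r W)
    (hX : ∀ v < N, (∀ w < N, e v w = 0) → X v = -1)
    (hX' : ∀ v < N, ¬ (∀ w < N, e v w = 0) → X v = ∑ w ∈ Finset.range N, e v w * W w)
    (hW' : Weights L N X W') : Approximates L N E h (r + 1) W' := by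
  classical
  obtain ⟨y, ⟨hy0, hy⟩, hW'⟩ := hW'
  intro c hc hcs
  set s := (Finset.range N).filter fun v => h v < r + 1 ∧ ¬ (∀ w < N, e v w = 0) with hs
  set x : ℕ → ℤ := fun v => ∑ w ∈ Finset.range N, e v w * E w with hx
  have hsm : ∀ v ∈ s, v < N ∧ h v < r + 1 ∧ ¬ (∀ w < N, e v w = 0) := by
    intro v hv
    simpa [hs] using hv
  have hdiff : ∀ u ∈ s, ∀ v ∈ s, Agree L (x u - x v) (X u - X v) := by
    intro u hu v hv
    obtain ⟨hu, hu', hu''⟩ := hsm u hu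
    obtain ⟨hv, hv', hv''⟩ := hsm v hv
    have := hW (fun w => e u w - e v w) (fun w hw hrw => ?_) ?_
    · simpa only [sub_mul, Finset.sum_sub_distrib, hX' u hu hu'', hX' v hv hv''] using this
    · have h1 : e u w = 0 := by
        by_contra h1
        have := hE.rank u hu w hw h1
        omega
      have h2 : e v w = 0 := by
        by_contra h1
        have := hE.rank v hv w hw h1
        omega
      rw [h1, h2, sub_zero]
    · refine (sum_abs_le (b := 2) fun w _ => ?_).trans (by nlinarith)
      have h1 := abs_le.1 (hE.abs_le u w)
      have h2 := abs_le.1 (hE.abs_le v w)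
      rw [abs_le]; constructor <;> linarith
  have hsingle : ∀ u ∈ s, Agree L (x u) (X u) := by
    intro u hu
    obtain ⟨hu, hu', hu''⟩ := hsm u hu
    have := hW (fun w => e u w) (fun w hw hrw => ?_) ?_
    · simpa only [hX' u hu hu''] using this
    · by_contra h1
      have := hE.rank u hu w hw h1
      omega
    · exact (sum_abs_le (b := 1) fun w _ => hE.abs_le u w).trans (by nlinarith)
  have hx0 : ∀ u ∈ s, 0 ≤ x u := fun u hu => hE.exponent_nonneg u (hsm u hu).1
  have hX0 : ∀ u ∈ s, 0 ≤ X u := fun u hu => (hsingle u hu).nonneg_iff.1 (hx0 u hu)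
  have hmem : ∀ i ∈ s, X i ∈ insert 0 {u | ∃ i < N, X i = u ∧ 0 ≤ u} := fun i hi =>
    Or.inr ⟨i, (hsm i hi).1, rfl, hX0 i hi⟩
  have hss : s ⊆ Finset.range N := Finset.filter_subset _ _
  have key := agree_sum hL s c (fun i => (x i).toNat) (fun i => y (X i))
    ((Finset.sum_le_sum_of_subset_of_nonneg hss fun _ _ _ => abs_nonneg _).trans hcs)
    (fun i hi => by
      rw [Int.toNat_of_nonneg (hx0 i hi)]
      refine (hsingle i hi).trans ?_
      have := hy _ (hmem i hi) 0 (Or.inl rfl)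
      simpa [hy0] using this)
    (fun i hi j hj => by
      rw [Int.toNat_of_nonneg (hx0 i hi), Int.toNat_of_nonneg (hx0 j hj)]
      exact (hdiff i hi j hj).trans (hy _ (hmem i hi) _ (hmem j hj)))
  have e1 : ∑ w ∈ Finset.range N, c w * E w = ∑ i ∈ s, c i * 2 ^ (x i).toNat := by
    rw [← Finset.sum_subset hss]
    · exact Finset.sum_congr rfl fun i hi => by rw [hE.node i (hsm i hi).1 (hsm i hi).2.2]
    · intro i hi his
      have hi := Finset.mem_range.1 hi
      by_cases hr : h i < r + 1
      · have : ∀ w < N, e i w = 0 := by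
          by_contra h'
          exact his (Finset.mem_filter.2 ⟨Finset.mem_range.2 hi, hr, h'⟩)
        rw [hE.leaf i hi this, mul_zero]
      · rw [hc i hi (by omega), zero_mul]
  have e2 : ∑ w ∈ Finset.range N, c w * W' w = ∑ i ∈ s, c i * 2 ^ y (X i) := by
    rw [← Finset.sum_subset hss]
    · exact Finset.sum_congr rfl fun i hi => by
        rw [hW' i (hsm i hi).1, if_neg (not_lt.2 (hX0 i hi))]
    · intro i hi his
      have hi := Finset.mem_range.1 hi
      by_cases hr : h i < r + 1
      · have : ∀ w < N, e i w = 0 := by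
          by_contra h'
          exact his (Finset.mem_filter.2 ⟨Finset.mem_range.2 hi, hr, h'⟩)
        rw [hW' i hi, hX i hi this]
        simp
      · rw [hc i hi (by omega), zero_mul]
  rw [e1, e2]
  exact key

theorem Approximates.zero (L N : ℕ) (E : ℕ → ℤ) (h : ℕ → ℕ) (W : ℕ → ℤ) :
    Approximates L N E h 0 W := by
  intro c hc _
  rw [Finset.sum_eq_zero, Finset.sum_eq_zero]
  · exact .refl _
  all_goals
    intro w hw
    rw [hc w (Finset.mem_range.1 hw) (Nat.zero_le _), zero_mul]

/-! ### The affine action of the group -/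

/-- The generators as affine bijections of `ℚ`: `a` is the translation `x ↦ x + 1`, and `t` is the
contraction `x ↦ x / 2`. -/
def genPerm : Gen → Equiv.Perm ℚ
  | Gen.a => Equiv.addRight 1
  | Gen.t => ⟨fun x => x / 2, fun x => x * 2, fun x => by ring, fun x => by ring⟩

theorem genPerm_relators : ∀ r ∈ relators, FreeGroup.lift genPerm r = 1 := by
  rintro r rfl
  simp only [map_mul, map_inv, map_pow, FreeGroup.lift_apply_of]
  rw [mul_inv_eq_one, mul_assoc, inv_mul_eq_iff_eq_mul]
  ext x
  simp only [genPerm, Equiv.Perm.mul_apply, pow_two, Equiv.coe_addRight, Equiv.coe_fn_mk]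
  ring

/-- The affine action of the group on `ℚ`. -/
def action : B12 →* Equiv.Perm ℚ := PresentedGroup.toGroup genPerm_relators

theorem action_a_zpow (p : ℤ) (x : ℚ) :
    action ((PresentedGroup.of Gen.a : B12) ^ p) x = x + p := by
  have h : ∀ (n : ℕ) (x : ℚ), action ((PresentedGroup.of Gen.a : B12) ^ n) x = x + n := by
    intro n x
    rw [map_pow, action, PresentedGroup.toGroup.of]
    induction n generalizing x with
    | zero => simp
    | succ n ih =>
      rw [pow_succ, Equiv.Perm.mul_apply, ih]
      simp only [genPerm, Equiv.coe_addRight]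
      push_cast
      ring
  obtain ⟨n, rfl | rfl⟩ := p.eq_nat_or_neg
  · rw [zpow_natCast, h, Int.cast_natCast]
  · rw [zpow_neg, zpow_natCast, map_inv, Equiv.Perm.inv_eq_iff_eq, h]
    simp

theorem action_t_pow (n : ℕ) (x : ℚ) :
    action ((PresentedGroup.of Gen.t : B12) ^ n) x = 2 ^ (-(n : ℤ)) * x := by
  rw [map_pow, action, PresentedGroup.toGroup.of]
  induction n generalizing x with
  | zero => simp
  | succ n ih =>
    rw [pow_succ, Equiv.Perm.mul_apply, ih]
    simp only [genPerm, Equiv.coe_fn_mk, zpow_neg, zpow_natCast]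
    rw [pow_succ, mul_inv]
    ring

theorem action_t_pow_inv (n : ℕ) (x : ℚ) :
    action ((PresentedGroup.of Gen.t : B12) ^ n)⁻¹ x = 2 ^ (n : ℤ) * x := by
  rw [map_inv, Equiv.Perm.inv_eq_iff_eq, action_t_pow, ← mul_assoc, ← zpow_add₀ (by norm_num)]
  simp

theorem action_t_zpow (p : ℤ) (x : ℚ) :
    action ((PresentedGroup.of Gen.t : B12) ^ p) x = 2 ^ (-p) * x := by
  obtain ⟨n, rfl | rfl⟩ := p.eq_nat_or_neg
  · rw [zpow_natCast, action_t_pow]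
  · rw [zpow_neg, zpow_natCast, action_t_pow_inv, neg_neg]

theorem t_mul_a_sq : (PresentedGroup.of Gen.t : B12) * PresentedGroup.of Gen.a ^ 2 =
    PresentedGroup.of Gen.a * PresentedGroup.of Gen.t := by
  have h : PresentedGroup.mk relators ((FreeGroup.of Gen.t)⁻¹ * FreeGroup.of Gen.a *
      FreeGroup.of Gen.t * (FreeGroup.of Gen.a ^ 2)⁻¹) = 1 :=
    PresentedGroup.one_of_mem rfl
  simp only [map_mul, map_inv, map_pow] at h
  rw [mul_inv_eq_one, mul_assoc, inv_mul_eq_iff_eq_mul] at h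
  exact h.symm

theorem t_pow_inv_mul_a_zpow (j : ℕ) (n : ℤ) :
    ((PresentedGroup.of Gen.t : B12) ^ j)⁻¹ * PresentedGroup.of Gen.a ^ n =
      PresentedGroup.of Gen.a ^ (2 ^ j * n) * ((PresentedGroup.of Gen.t : B12) ^ j)⁻¹ := by
  have h : ∀ j : ℕ, SemiconjBy ((PresentedGroup.of Gen.t : B12) ^ j)
      (PresentedGroup.of Gen.a ^ 2 ^ j) (PresentedGroup.of Gen.a) := by
    intro j
    induction j with
    | zero => simp
    | succ j ih =>
      have h1 : SemiconjBy (PresentedGroup.of Gen.t : B12) (PresentedGroup.of Gen.a ^ 2)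
        (PresentedGroup.of Gen.a) := t_mul_a_sq
      have h2 := h1.pow_right (2 ^ j)
      rw [← pow_mul, ← pow_succ'] at h2
      rw [pow_succ (PresentedGroup.of Gen.t : B12)]
      exact ih.mul_left h2
  have h1 := ((h j).zpow_right n).eq
  rw [← zpow_natCast (_ : B12) (2 ^ j), ← zpow_mul, Nat.cast_pow, Nat.cast_ofNat] at h1
  rw [inv_mul_eq_iff_eq_mul, ← mul_assoc, h1, mul_inv_cancel_right]

/-- The relation `a t = t a²` moves positive powers of `t` to the left and negative ones to the
right. -/
theorem exists_normal_form (g : B12) : ∃ (i j : ℕ) (n : ℤ),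
    g = PresentedGroup.of Gen.t ^ i * PresentedGroup.of Gen.a ^ n *
      (PresentedGroup.of Gen.t ^ j)⁻¹ := by
  have hg : g ∈ Subgroup.closure (Set.range (PresentedGroup.of (rels := relators))) := by
    rw [PresentedGroup.closure_range_of]; trivial
  induction hg using Subgroup.closure_induction_right with
  | one => exact ⟨0, 0, 0, by simp⟩
  | mul_right x hx y hy ih =>
    obtain ⟨i, j, n, rfl⟩ := ih
    obtain ⟨_ | _, rfl⟩ := hy
    · refine ⟨i, j, n + 2 ^ j * 1, ?_⟩
      have := t_pow_inv_mul_a_zpow j 1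
      rw [zpow_one] at this
      rw [mul_assoc, this, zpow_add]
      group
    · cases j with
      | zero =>
        refine ⟨i + 1, 0, 2 * n, ?_⟩
        have h := t_pow_inv_mul_a_zpow 1 n
        rw [inv_mul_eq_iff_eq_mul, ← mul_assoc, eq_mul_inv_iff_mul_eq, pow_one, pow_one] at h
        rw [pow_zero, inv_one, mul_one, mul_one, mul_assoc, h, pow_succ]
        group
      | succ j =>
        refine ⟨i, j, n, ?_⟩
        rw [pow_succ']
        group
  | mul_inv_cancel x hx y hy ih =>
    obtain ⟨i, j, n, rfl⟩ := ih
    obtain ⟨_ | _, rfl⟩ := hy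
    · refine ⟨i, j, n + 2 ^ j * (-1), ?_⟩
      have := t_pow_inv_mul_a_zpow j (-1)
      rw [zpow_neg_one] at this
      rw [mul_assoc, this, zpow_add]
      group
    · refine ⟨i, j + 1, n, ?_⟩
      rw [pow_succ']
      group

/-- In the normal form of an element that acts trivially, the images of `0` and `1` give `n = 0` and
`i = j`. -/
theorem action_injective : Function.Injective action := by
  rw [injective_iff_map_eq_one]
  intro g hg
  obtain ⟨i, j, n, rfl⟩ := exists_normal_form g
  have h : ∀ x : ℚ, 2 ^ (-(i : ℤ)) * (2 ^ (j : ℤ) * x + n) = x := by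
    intro x
    have := congrArg (fun e : Equiv.Perm ℚ => e x) hg
    simpa only [map_mul, Equiv.Perm.mul_apply, action_t_pow, action_t_pow_inv, action_a_zpow,
      Equiv.Perm.one_apply] using this
  have h0 := h 0
  have hn : n = 0 := by simpa [zpow_ne_zero] using h0
  subst hn
  have h1 := h 1
  rw [Int.cast_zero, add_zero, mul_one, ← zpow_add₀ (by norm_num)] at h1
  have hij : -(i : ℤ) + j = 0 := by
    refine zpow_right_injective₀ (a := (2 : ℚ)) (by norm_num) (by norm_num) ?_
    simpa using h1
  obtain rfl : i = j := by omega
  simp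

theorem toB12_eq_prod (s : PowerSequence Gen) :
    s.toB12 = (s.map fun q => (PresentedGroup.of q.1 : B12) ^ q.2.number).prod := by
  rw [PowerSequence.toB12, PowerSequence.word, map_list_prod, List.map_map]
  congr 2

theorem eq_a_zpow_iff {g : B12} {δ : ℤ} {b : ℚ} (h : ∀ x, action g x = 2 ^ (-δ) * x + b) (p : ℤ) :
    g = PresentedGroup.of Gen.a ^ p ↔ δ = 0 ∧ b = p := by
  constructor
  · rintro rfl
    have h0 := h 0
    have h1 := h 1
    simp only [action_a_zpow] at h0 h1
    have hb : b = p := by linarith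
    refine ⟨?_, hb⟩
    have : -δ = 0 := by
      refine zpow_right_injective₀ (a := (2 : ℚ)) (by norm_num) (by norm_num) ?_
      simp only [zpow_zero]
      linarith
    omega
  · rintro ⟨rfl, rfl⟩
    refine action_injective (Equiv.ext fun x => ?_)
    rw [h, action_a_zpow]
    simp

theorem eq_t_zpow_iff {g : B12} {δ : ℤ} {b : ℚ} (h : ∀ x, action g x = 2 ^ (-δ) * x + b) (p : ℤ) :
    g = PresentedGroup.of Gen.t ^ p ↔ δ = p ∧ b = 0 := by
  constructor
  · rintro rfl
    have h0 := h 0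
    have h1 := h 1
    simp only [action_t_zpow] at h0 h1
    have hb : b = 0 := by linarith
    refine ⟨?_, hb⟩
    have : -δ = -p := by
      refine zpow_right_injective₀ (a := (2 : ℚ)) (by norm_num) (by norm_num) ?_
      simp only
      linarith
    omega
  · rintro ⟨rfl, rfl⟩
    refine action_injective (Equiv.ext fun x => ?_)
    rw [h, action_t_zpow]
    simp

/-! ### Circuits on the natural numbers -/

theorem exists_zpow_nonneg {z m : ℤ} (h : (2 : ℝ) ^ z = m) : 0 ≤ z ∧ m = 2 ^ z.toNat := by
  have hz : 0 ≤ z := by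
    by_contra hz
    have h1 : (2 : ℝ) ^ z < 1 := zpow_lt_one_of_neg₀ (by norm_num) (by omega)
    have h2 : (0 : ℝ) < 2 ^ z := by positivity
    rw [h] at h1 h2
    have h3 : m < 1 := by exact_mod_cast h1
    have h4 : 0 < m := by exact_mod_cast h2
    omega
  refine ⟨hz, ?_⟩
  obtain ⟨n, rfl⟩ := Int.eq_ofNat_of_zero_le hz
  have : (2 : ℝ) ^ n = m := by simpa using h
  exact_mod_cast this.symm

theorem abs_sign_le (s : SignType) : |(s : ℤ)| ≤ 1 := by
  cases s <;> simp

theorem sign_cast_eq_zero {s : SignType} : (s : ℤ) = 0 ↔ s = 0 := by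
  cases s <;> simp

theorem SignedDag.exists_rank (D : SignedDag) :
    ∃ h : Fin D.n → ℕ, (∀ v, h v < D.n) ∧ ∀ v w, D.edge v w ≠ 0 → h w < h v := by
  classical
  let r : Fin D.n → Fin D.n → Prop := Relation.TransGen (fun x y => D.edge x y ≠ 0)
  have hr : ∀ v, ¬ r v v := D.acyclic
  refine ⟨fun v => (Finset.univ.filter fun w => r v w).card, fun v => ?_, fun v w hvw => ?_⟩
  · refine (Finset.card_lt_univ_of_notMem (x := v) ?_).trans_eq (Fintype.card_fin _)
    simpa using hr v
  · have h1 : r v w := Relation.TransGen.single hvw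
    refine Finset.card_lt_card (Finset.ssubset_iff_of_subset ?_ |>.2 ⟨w, ?_, ?_⟩)
    · intro u hu
      simp only [Finset.mem_filter, Finset.mem_univ, true_and] at hu ⊢
      exact h1.trans hu
    · simpa using h1
    · simpa using hr w

namespace PowerCircuit

variable (P : PowerCircuit)

theorem floor_eval (v : Fin P.n) : ((⌊P.eval v⌋ : ℤ) : ℝ) = P.eval v := by
  obtain ⟨z, hz⟩ := P.integral v
  rw [hz, Int.floor_intCast]

theorem floor_eval_leaf {v : Fin P.n} (h : ∀ w, P.edge v w = 0) : ⌊P.eval v⌋ = 0 := by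
  rw [P.eval_eq, if_pos h, Int.floor_zero]

theorem floor_eval_node {v : Fin P.n} (h : ¬ ∀ w, P.edge v w = 0) :
    0 ≤ ∑ w, (P.edge v w : ℤ) * ⌊P.eval w⌋ ∧
      ⌊P.eval v⌋ = 2 ^ (∑ w, (P.edge v w : ℤ) * ⌊P.eval w⌋).toNat := by
  apply exists_zpow_nonneg
  rw [floor_eval, P.eval_eq v, if_neg h, ← Real.rpow_intCast]
  congr 1
  push_cast
  refine Finset.sum_congr rfl fun w _ => ?_
  rw [floor_eval]

/-- The edge labels, extended by `0` to all pairs of natural numbers. -/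
def natEdge (v w : ℕ) : SignType :=
  if h : v < P.n ∧ w < P.n then P.edge ⟨v, h.1⟩ ⟨w, h.2⟩ else 0

/-- The marks, extended by `0` to all natural numbers. -/
def natMark (v : ℕ) : SignType := if h : v < P.n then P.mark ⟨v, h⟩ else 0

/-- The evaluation as an integer, extended by `0` to all natural numbers. -/
noncomputable def natVal (v : ℕ) : ℤ := if h : v < P.n then ⌊P.eval ⟨v, h⟩⌋ else 0

/-- A rank function, extended by `0` to all natural numbers. -/
noncomputable def natRank (v : ℕ) : ℕ :=
  if h : v < P.n then P.exists_rank.choose ⟨v, h⟩ else 0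

theorem natEdge_fin (v w : Fin P.n) : P.natEdge v w = P.edge v w := by simp [natEdge]

theorem natMark_fin (v : Fin P.n) : P.natMark v = P.mark v := by simp [natMark]

theorem natVal_fin (v : Fin P.n) : P.natVal v = ⌊P.eval v⌋ := by simp [natVal]

theorem natEdge_ne_zero {v w : ℕ} (h : P.natEdge v w ≠ 0) : v < P.n ∧ w < P.n := by
  unfold natEdge at h
  split_ifs at h with h'
  · exact h'
  · exact absurd rfl h

theorem natMark_ne_zero {v : ℕ} (h : P.natMark v ≠ 0) : v < P.n := by
  unfold natMark at h
  split_ifs at h with h'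
  · exact h'
  · exact absurd rfl h

theorem natRank_lt {v : ℕ} (h : v < P.n) : P.natRank v < P.n := by
  rw [natRank, dif_pos h]
  exact P.exists_rank.choose_spec.1 _

theorem evaluates :
    Evaluates P.n (fun v w => (P.natEdge v w : ℤ)) P.natVal P.natRank := by
  have hsum : ∀ v : Fin P.n, ∑ w ∈ Finset.range P.n, (P.natEdge v w : ℤ) * P.natVal w =
      ∑ w, (P.edge v w : ℤ) * ⌊P.eval w⌋ := by
    intro v
    rw [Finset.sum_range]
    simp only [natEdge_fin, natVal_fin]
  have hleaf : ∀ v : Fin P.n, (∀ w < P.n, (P.natEdge v w : ℤ) = 0) ↔ ∀ w, P.edge v w = 0 := by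
    intro v
    simp only [sign_cast_eq_zero]
    exact ⟨fun h w => by rw [← natEdge_fin]; exact h w w.2,
      fun h w hw => (P.natEdge_fin v ⟨w, hw⟩).trans (h _)⟩
  have hnode : ∀ v : Fin P.n, ¬ (∀ w < P.n, (P.natEdge v w : ℤ) = 0) →
      0 ≤ ∑ w ∈ Finset.range P.n, (P.natEdge v w : ℤ) * P.natVal w ∧
      P.natVal v = 2 ^ (∑ w ∈ Finset.range P.n, (P.natEdge v w : ℤ) * P.natVal w).toNat := by
    intro v h
    rw [hleaf] at h
    rw [hsum, natVal_fin]
    exact P.floor_eval_node h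
  refine ⟨fun v w => abs_sign_le _, ?_, ?_, ?_, ?_⟩
  · intro v hv w hw hvw
    have := P.exists_rank.choose_spec.2 ⟨v, hv⟩ ⟨w, hw⟩
    simp only [natRank, dif_pos hv, dif_pos hw]
    refine this ?_
    rw [← natEdge_fin]
    exact fun h => hvw (sign_cast_eq_zero.2 h)
  · intro v hv h
    have h' := (hleaf ⟨v, hv⟩).1 h
    exact (P.natVal_fin ⟨v, hv⟩).trans (P.floor_eval_leaf h')
  · intro v hv
    by_cases h : ∀ w < P.n, (P.natEdge v w : ℤ) = 0
    · rw [Finset.sum_eq_zero]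
      intro w hw
      rw [h w (Finset.mem_range.1 hw), zero_mul]
    · exact (hnode ⟨v, hv⟩ h).1
  · intro v hv h
    exact (hnode ⟨v, hv⟩ h).2

theorem number_eq_sum_range :
    P.number = ∑ v ∈ Finset.range P.n, (P.natMark v : ℤ) * P.natVal v := by
  rw [Finset.sum_range]
  simp only [natMark_fin, natVal_fin, number]

theorem numMarked_eq_length :
    P.numMarked = ((List.range P.n).filter fun v => P.natMark v ≠ 0).length := by
  rw [numMarked, ← List.countP_eq_length_filter, ← Multiset.coe_countP,
    Finset.card_def, Finset.filter_val, ← Multiset.countP_eq_card_filter]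
  have : (List.range P.n) = (List.finRange P.n).map (fun i : Fin P.n => (i : ℕ)) := by
    simp
  rw [this, Multiset.coe_countP, List.countP_map]
  change Multiset.countP _ ((List.finRange P.n : List (Fin P.n)) : Multiset (Fin P.n)) = _
  rw [Multiset.coe_countP]
  refine List.countP_congr fun i _ => ?_
  simp [natMark_fin]

end PowerCircuit

/-! ### Circuits whose vertices are the entries of a list -/

section ListCircuit

variable {ι : Type}

/-- The graph on the entries of the list `l`, with the given edge labels and marks. -/
abbrev listDag (l : List ι) (edge : ι → ι → SignType) (mark : ι → SignType) (h : ι → ℕ)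
    (hr : ∀ v ∈ l, ∀ w ∈ l, edge v w ≠ 0 → h w < h v) : SignedDag where
  n := l.length
  edge i j := edge (l.get i) (l.get j)
  mark i := mark (l.get i)
  acyclic v hv := by
    have key : ∀ u w : Fin l.length,
        Relation.TransGen (fun x y : Fin l.length => edge (l.get x) (l.get y) ≠ 0) u w →
          h (l.get w) < h (l.get u) := by
      intro u w huw
      induction huw with
      | single h' => exact hr _ (List.get_mem _ _) _ (List.get_mem _ _) h'
      | tail _ h' ih => exact (hr _ (List.get_mem _ _) _ (List.get_mem _ _) h').trans ih
    exact lt_irrefl _ (key v v hv)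

variable {l : List ι} {edge : ι → ι → SignType} {mark : ι → SignType} {h : ι → ℕ}

theorem length_filter_eq_sum (p : ι → Bool) :
    (l.filter p).length = (l.map fun v => if p v = true then 1 else 0).sum := by
  induction l with
  | nil => rfl
  | cons v l ih =>
    by_cases hv : p v = true
    · simp [hv, ih, add_comm]
    · simp [hv, ih]

theorem sum_fin_get {M : Type*} [AddCommMonoid M] (f : ι → M) :
    ∑ i : Fin l.length, f (l.get i) = (l.map f).sum := by
  rw [← List.sum_ofFn]
  congr 1
  exact List.ofFn_getElem_eq_map l f

theorem listDag_eval (hr : ∀ v ∈ l, ∀ w ∈ l, edge v w ≠ 0 → h w < h v) {E : ι → ℤ}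
    (hleaf : ∀ v ∈ l, (∀ w ∈ l, edge v w = 0) → E v = 0)
    (hnode : ∀ v ∈ l, ¬ (∀ w ∈ l, edge v w = 0) → 0 ≤ (l.map fun w => (edge v w : ℤ) * E w).sum ∧
      E v = 2 ^ ((l.map fun w => (edge v w : ℤ) * E w).sum).toNat) (i : Fin l.length) :
    (listDag l edge mark h hr).eval i = (E (l.get i) : ℝ) := by
  have key : ∀ (m : ℕ) (i : Fin l.length), h (l.get i) < m →
      (listDag l edge mark h hr).eval i = (E (l.get i) : ℝ) := by
    intro m
    induction m with
    | zero => intro i hi; omega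
    | succ m ih =>
      intro i hi
      have hmem : (l.get i) ∈ l := (List.get_mem _ _)
      have hiff : (∀ j, (listDag l edge mark h hr).edge i j = 0) ↔
          ∀ w ∈ l, edge (l.get i) w = 0 := by
        constructor
        · intro h' w hw
          obtain ⟨j, rfl⟩ := List.get_of_mem hw
          exact h' j
        · intro h' j
          exact h' _ (List.get_mem _ _)
      rw [SignedDag.eval_eq]
      by_cases h' : ∀ w ∈ l, edge (l.get i) w = 0
      · rw [if_pos (hiff.2 h'), hleaf _ hmem h', Int.cast_zero]
      · rw [if_neg (fun h'' => h' (hiff.1 h''))]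
        obtain ⟨h1, h2⟩ := hnode _ hmem h'
        have hs : ∑ j, ((listDag l edge mark h hr).edge i j : ℝ) *
            (listDag l edge mark h hr).eval j =
            (((l.map fun w => (edge (l.get i) w : ℤ) * E w).sum : ℤ) : ℝ) := by
          rw [← sum_fin_get, Int.cast_sum]
          refine Finset.sum_congr rfl fun j _ => ?_
          change ((edge (l.get i) (l.get j) : SignType) : ℝ) * _ = _
          by_cases h0 : edge (l.get i) (l.get j) = 0
          · rw [h0]; simp
          · rw [ih j (by have := hr _ hmem _ (List.get_mem _ _) h0; omega)]
            push_cast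
            rfl
        rw [hs, h2, Real.rpow_intCast]
        obtain ⟨n, hn⟩ := Int.eq_ofNat_of_zero_le h1
        rw [hn]
        simp
  exact key _ i (Nat.lt_succ_self _)

/-- A power circuit on the entries of a list, given the values of its vertices. -/
theorem exists_listCircuit {E : ι → ℤ}
    (hr : ∀ v ∈ l, ∀ w ∈ l, edge v w ≠ 0 → h w < h v)
    (hleaf : ∀ v ∈ l, (∀ w ∈ l, edge v w = 0) → E v = 0)
    (hnode : ∀ v ∈ l, ¬ (∀ w ∈ l, edge v w = 0) → 0 ≤ (l.map fun w => (edge v w : ℤ) * E w).sum ∧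
      E v = 2 ^ ((l.map fun w => (edge v w : ℤ) * E w).sum).toNat) :
    ∃ P : PowerCircuit, P.numVertices = l.length ∧
      P.numMarked = (l.filter fun v => mark v ≠ 0).length ∧
      P.number = (l.map fun v => (mark v : ℤ) * E v).sum ∧
      P.encode = (l.length : ℤ) :: ((l.flatMap fun v => l.map fun w => (edge v w : ℤ)) ++
        l.map fun v => (mark v : ℤ)) := by
  have heval := listDag_eval (mark := mark) hr hleaf hnode
  refine ⟨⟨listDag l edge mark h hr, fun v => ⟨_, heval v⟩⟩, rfl, ?_, ?_, ?_⟩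
  · rw [PowerCircuit.numMarked, Finset.card_filter, length_filter_eq_sum]
    simp only [decide_eq_true_eq]
    exact sum_fin_get (fun v => if mark v ≠ 0 then 1 else 0)
  · rw [PowerCircuit.number, ← sum_fin_get]
    refine Finset.sum_congr rfl fun i _ => ?_
    change (mark (l.get i) : ℤ) * ⌊(listDag l edge mark h hr).eval i⌋ = _
    rw [heval, Int.floor_intCast]
  · have h1 : ∀ {β : Type} (f : ι → β), List.ofFn (fun i : Fin l.length => f (l.get i)) = l.map f :=
      fun f => List.ofFn_getElem_eq_map l f
    change (l.length : ℤ) :: ((List.ofFn fun v : Fin l.length =>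
      List.ofFn fun w : Fin l.length => (edge (l.get v) (l.get w) : ℤ)).flatten ++
        List.ofFn fun v : Fin l.length => (mark (l.get v) : ℤ)) = _
    have h2 : ∀ v, (List.ofFn fun w : Fin l.length => (edge v (l.get w) : ℤ)) =
        l.map fun w => (edge v w : ℤ) := fun v => h1 (fun w => (edge v w : ℤ))
    simp only [h1 (fun v => (mark v : ℤ)), h2]
    rw [h1 (fun v => l.map fun w => (edge v w : ℤ)), List.flatMap_def]

end ListCircuit

/-! ### The union of the circuits of a power sequence -/

/-- The disjoint union of the circuits of a power sequence in the letters `a` and `t`, on the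
vertices `0, …, N - 1` in the order of the sequence. The marks of the circuits for `a` and for `t`
are kept apart, as `mm` and `dm`, and `kind` tells whether a vertex belongs to a circuit for `t`.
The values `E` and a rank function `h` are part of the structure. -/
structure Merged where
  N : ℕ
  edge : ℕ → ℕ → SignType
  mm : ℕ → SignType
  dm : ℕ → SignType
  kind : ℕ → Bool
  E : ℕ → ℤ
  h : ℕ → ℕ

/-- Whether a letter is `t`. -/
def Gen.isT : Gen → Bool
  | Gen.a => false
  | Gen.t => true

namespace Merged

/-- The empty union. -/
def empty : Merged :=
  ⟨0, fun _ _ => 0, fun _ => 0, fun _ => 0, fun _ => false, fun _ => 0, fun _ => 0⟩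

/-- The union with one more circuit, whose vertices come last. -/
noncomputable def append (S : Merged) (g : Gen) (P : PowerCircuit) : Merged where
  N := S.N + P.n
  edge v w := if v < S.N ∧ w < S.N then S.edge v w else
    if S.N ≤ v ∧ S.N ≤ w then P.natEdge (v - S.N) (w - S.N) else 0
  mm v := if v < S.N then S.mm v else if g.isT then 0 else P.natMark (v - S.N)
  dm v := if v < S.N then S.dm v else if g.isT then P.natMark (v - S.N) else 0
  kind v := if v < S.N then S.kind v else g.isT
  E v := if v < S.N then S.E v else P.natVal (v - S.N)
  h v := if v < S.N then S.h v else P.natRank (v - S.N)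

/-- The union of the circuits of a power sequence. -/
noncomputable def ofSeq (s : PowerSequence Gen) : Merged :=
  s.foldl (fun S q => S.append q.1 q.2) empty

theorem ofSeq_concat (s : PowerSequence Gen) (q : Gen × PowerCircuit) :
    ofSeq (s ++ [q]) = (ofSeq s).append q.1 q.2 := by
  simp [ofSeq]

variable (S : Merged) (g : Gen) (P : PowerCircuit)

/-- The properties that make the data of a union meaningful. -/
structure Valid : Prop where
  eval : Evaluates S.N (fun v w => (S.edge v w : ℤ)) S.E S.h
  rank_lt : ∀ v < S.N, S.h v < S.N
  edge_ne : ∀ v w, S.edge v w ≠ 0 → v < S.N ∧ w < S.N ∧ S.kind v = S.kind w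
  mm_ne : ∀ v, S.mm v ≠ 0 → v < S.N ∧ S.kind v = false
  dm_ne : ∀ v, S.dm v ≠ 0 → v < S.N ∧ S.kind v = true

section append

theorem append_edge_old {v : ℕ} (hv : v < S.N) (w : ℕ) (hS : S.Valid) :
    (S.append g P).edge v w = S.edge v w := by
  simp only [append]
  by_cases hw : w < S.N
  · simp [hv, hw]
  · rw [if_neg (by omega), if_neg (by omega)]
    by_contra h
    exact hw (hS.edge_ne v w (Ne.symm h)).2.1

theorem append_edge_new (v w : ℕ) :
    (S.append g P).edge (S.N + v) (S.N + w) = P.natEdge v w := by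
  simp [append]

theorem append_edge_new_old {v w : ℕ} (hw : w < S.N) :
    (S.append g P).edge (S.N + v) w = 0 := by
  simp [append, hw]

theorem append_sum_old {v : ℕ} (hv : v < S.N) (hS : S.Valid) :
    ∑ w ∈ Finset.range (S.append g P).N, ((S.append g P).edge v w : ℤ) * (S.append g P).E w =
      ∑ w ∈ Finset.range S.N, (S.edge v w : ℤ) * S.E w := by
  change ∑ w ∈ Finset.range (S.N + P.n), _ = _
  rw [Finset.sum_range_add, Finset.sum_eq_zero (s := Finset.range P.n), add_zero]
  · refine Finset.sum_congr rfl fun w hw => ?_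
    rw [append_edge_old S g P hv w hS]
    simp [append, Finset.mem_range.1 hw]
  · intro w _
    rw [append_edge_old S g P hv _ hS]
    have : S.edge v (S.N + w) = 0 := by
      by_contra h
      have := (hS.edge_ne _ _ h).2.1
      omega
    simp [this]

theorem append_sum_new (v : ℕ) :
    ∑ w ∈ Finset.range (S.append g P).N,
        ((S.append g P).edge (S.N + v) w : ℤ) * (S.append g P).E w =
      ∑ w ∈ Finset.range P.n, (P.natEdge v w : ℤ) * P.natVal w := by
  change ∑ w ∈ Finset.range (S.N + P.n), _ = _
  rw [Finset.sum_range_add, Finset.sum_eq_zero (s := Finset.range S.N), zero_add]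
  · refine Finset.sum_congr rfl fun w hw => ?_
    rw [append_edge_new]
    simp [append]
  · intro w hw
    simp [append_edge_new_old S g P (Finset.mem_range.1 hw)]

theorem append_leaf_old {v : ℕ} (hv : v < S.N) (hS : S.Valid) :
    (∀ w < (S.append g P).N, ((S.append g P).edge v w : ℤ) = 0) ↔
      ∀ w < S.N, (S.edge v w : ℤ) = 0 := by
  simp only [append_edge_old S g P hv _ hS, sign_cast_eq_zero]
  constructor
  · intro h w hw
    exact h w (Nat.lt_add_right _ hw)
  · intro h w _
    by_contra h'
    exact h' (h w (hS.edge_ne _ _ h').2.1)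

theorem append_leaf_new (v : ℕ) :
    (∀ w < (S.append g P).N, ((S.append g P).edge (S.N + v) w : ℤ) = 0) ↔
      ∀ w < P.n, (P.natEdge v w : ℤ) = 0 := by
  constructor
  · intro h w hw
    have := h (S.N + w) (Nat.add_lt_add_left hw _)
    rwa [append_edge_new] at this
  · intro h w hw
    by_cases hw' : w < S.N
    · simp [append_edge_new_old S g P hw']
    · obtain ⟨w, rfl⟩ := Nat.exists_eq_add_of_le (not_lt.1 hw')
      rw [append_edge_new]
      exact h w (Nat.lt_of_add_lt_add_left hw)

theorem Valid.append {S : Merged} (hS : S.Valid) : (S.append g P).Valid := by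
  have hP := P.evaluates
  have hE0 : ∀ v < S.N, (S.append g P).E v = S.E v := fun v hv => by simp [Merged.append, hv]
  have hE1 : ∀ v, (S.append g P).E (S.N + v) = P.natVal v := fun v => by simp [Merged.append]
  have hh0 : ∀ v < S.N, (S.append g P).h v = S.h v := fun v hv => by simp [Merged.append, hv]
  have hh1 : ∀ v, (S.append g P).h (S.N + v) = P.natRank v := fun v => by simp [Merged.append]
  have cases : ∀ v < (S.append g P).N, v < S.N ∨ ∃ u < P.n, v = S.N + u := by
    intro v hv
    by_cases h : v < S.N
    · exact Or.inl h
    · obtain ⟨u, rfl⟩ := Nat.exists_eq_add_of_le (not_lt.1 h)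
      exact Or.inr ⟨u, Nat.lt_of_add_lt_add_left hv, rfl⟩
  refine ⟨⟨fun v w => abs_sign_le _, ?_, ?_, ?_, ?_⟩, ?_, ?_, ?_, ?_⟩
  · intro v hv w hw hvw
    rcases cases v hv with hv | ⟨v, hv', rfl⟩
    · rw [append_edge_old S g P hv _ hS] at hvw
      have h1 := (hS.edge_ne v w (fun h => hvw (sign_cast_eq_zero.2 h))).2.1
      rw [hh0 v hv, hh0 w h1]
      exact hS.eval.rank v hv w h1 hvw
    · rcases cases w hw with hw | ⟨w, hw', rfl⟩
      · simp [append_edge_new_old S g P hw] at hvw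
      · rw [append_edge_new] at hvw
        rw [hh1, hh1]
        exact hP.rank v hv' w hw' hvw
  · intro v hv h
    rcases cases v hv with hv | ⟨v, hv', rfl⟩
    · rw [hE0 v hv, hS.eval.leaf v hv ((append_leaf_old S g P hv hS).1 h)]
    · rw [hE1, hP.leaf v hv' ((append_leaf_new S g P v).1 h)]
  · intro v hv
    rcases cases v hv with hv | ⟨v, hv', rfl⟩
    · rw [append_sum_old S g P hv hS]
      exact hS.eval.exponent_nonneg v hv
    · rw [append_sum_new]
      exact hP.exponent_nonneg v hv'
  · intro v hv h
    rcases cases v hv with hv | ⟨v, hv', rfl⟩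
    · rw [append_sum_old S g P hv hS, hE0 v hv]
      exact hS.eval.node v hv fun h' => h ((append_leaf_old S g P hv hS).2 h')
    · rw [append_sum_new, hE1]
      exact hP.node v hv' fun h' => h ((append_leaf_new S g P v).2 h')
  · intro v hv
    change _ < S.N + P.n
    rcases cases v hv with hv | ⟨v, hv', rfl⟩
    · rw [hh0 v hv]
      have := hS.rank_lt v hv
      omega
    · rw [hh1]
      have := P.natRank_lt hv'
      omega
  · intro v w hvw
    change v < S.N + P.n ∧ w < S.N + P.n ∧ _
    by_cases hv : v < S.N
    · rw [append_edge_old S g P hv w hS] at hvw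
      obtain ⟨-, hw, hk⟩ := hS.edge_ne v w hvw
      exact ⟨by omega, by omega, by simp [Merged.append, hv, hw, hk]⟩
    · by_cases hw : w < S.N
      · simp [Merged.append, hv, hw] at hvw
      · simp only [Merged.append, hv, hw, false_and, if_false] at hvw ⊢
        rw [if_pos (by omega)] at hvw
        have := P.natEdge_ne_zero hvw
        exact ⟨by omega, by omega, trivial⟩
  · intro v hv
    change v < S.N + P.n ∧ _
    by_cases hv' : v < S.N
    · simp only [Merged.append, hv', if_true] at hv ⊢
      exact ⟨by omega, (hS.mm_ne v hv).2⟩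
    · simp only [Merged.append, hv', if_false] at hv ⊢
      cases hg : g.isT
      · simp only [hg, Bool.false_eq_true, if_false] at hv
        have := P.natMark_ne_zero hv
        exact ⟨by omega, rfl⟩
      · simp [hg] at hv
  · intro v hv
    change v < S.N + P.n ∧ _
    by_cases hv' : v < S.N
    · simp only [Merged.append, hv', if_true] at hv ⊢
      exact ⟨by omega, (hS.dm_ne v hv).2⟩
    · simp only [Merged.append, hv', if_false] at hv ⊢
      cases hg : g.isT
      · simp [hg] at hv
      · simp only [hg, if_true] at hv
        have := P.natMark_ne_zero hv
        exact ⟨by omega, rfl⟩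

end append

theorem valid_empty : empty.Valid := by
  refine ⟨⟨?_, ?_, ?_, ?_, ?_⟩, ?_, ?_, ?_, ?_⟩ <;> simp [empty]

theorem valid_ofSeq (s : PowerSequence Gen) : (ofSeq s).Valid := by
  induction s using List.reverseRecOn with
  | nil => exact valid_empty
  | append_singleton s q ih => rw [ofSeq_concat]; exact ih.append _ _

/-- The signed sum of the values of the marked vertices less than `v` of the circuits for `t`. -/
def dsum (v : ℕ) : ℤ := ∑ w ∈ Finset.range v, (S.dm w : ℤ) * S.E w

/-- The translation part of the affine map given by the power sequence. -/
def shift : ℚ :=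
  ∑ v ∈ Finset.range S.N, ((S.mm v : ℤ) * S.E v : ℤ) * (2 : ℚ) ^ (-S.dsum v)

theorem append_dsum {v : ℕ} (hv : v ≤ S.N) : (S.append g P).dsum v = S.dsum v := by
  refine Finset.sum_congr rfl fun w hw => ?_
  have : w < S.N := (Finset.mem_range.1 hw).trans_le hv
  simp [append, this]

theorem append_a_dsum (v : ℕ) : (S.append .a P).dsum (S.N + v) = S.dsum S.N := by
  rw [dsum, Finset.sum_range_add, Finset.sum_eq_zero (s := Finset.range v), add_zero]
  · exact append_dsum S .a P le_rfl
  · intro w _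
    simp [append, Gen.isT]

theorem append_a_shift :
    (S.append .a P).shift = S.shift + 2 ^ (-S.dsum S.N) * (P.number : ℚ) := by
  change ∑ v ∈ Finset.range (S.N + P.n), _ = _
  rw [Finset.sum_range_add]
  congr 1
  · refine Finset.sum_congr rfl fun v hv => ?_
    have hv := Finset.mem_range.1 hv
    rw [append_dsum S .a P hv.le]
    simp [append, hv]
  · rw [P.number_eq_sum_range]
    push_cast
    rw [Finset.mul_sum]
    refine Finset.sum_congr rfl fun v hv => ?_
    rw [append_a_dsum]
    simp [append, Gen.isT]
    ring

theorem append_t_dsum : (S.append .t P).dsum (S.N + P.n) = S.dsum S.N + P.number := by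
  rw [dsum, Finset.sum_range_add]
  congr 1
  · exact append_dsum S .t P le_rfl
  · rw [P.number_eq_sum_range]
    refine Finset.sum_congr rfl fun v hv => ?_
    simp [append, Gen.isT]

theorem append_t_shift : (S.append .t P).shift = S.shift := by
  change ∑ v ∈ Finset.range (S.N + P.n), _ = _
  rw [Finset.sum_range_add, Finset.sum_eq_zero (s := Finset.range P.n), add_zero]
  · refine Finset.sum_congr rfl fun v hv => ?_
    have hv := Finset.mem_range.1 hv
    rw [append_dsum S .t P hv.le]
    simp [append, hv]
  · intro v _
    simp [append, Gen.isT]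

/-- A circuit for `t` rescales the affine map; a circuit for `a` adds its number, scaled by the
circuits for `t` that precede it, to the translation part. -/
theorem action_toB12 (s : PowerSequence Gen) (x : ℚ) :
    action (PowerSequence.toB12 s) x = 2 ^ (-(ofSeq s).dsum (ofSeq s).N) * x + (ofSeq s).shift := by
  induction s using List.reverseRecOn generalizing x with
  | nil => simp [toB12_eq_prod, ofSeq, empty, dsum, shift]
  | append_singleton s q ih =>
    have h : PowerSequence.toB12 (s ++ [q]) =
        PowerSequence.toB12 s * PresentedGroup.of q.1 ^ q.2.number := by
      rw [toB12_eq_prod, toB12_eq_prod]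
      simp
    rw [h, map_mul, Equiv.Perm.mul_apply, ih, ofSeq_concat]
    obtain ⟨_ | _, P⟩ := q
    · rw [action_a_zpow, append_a_shift]
      change _ = 2 ^ (-((ofSeq s).append .a P).dsum ((ofSeq s).N + P.n)) * x + _
      rw [append_a_dsum]
      ring
    · rw [action_t_zpow, append_t_shift]
      change _ = 2 ^ (-((ofSeq s).append .t P).dsum ((ofSeq s).N + P.n)) * x + _
      rw [append_t_dsum, neg_add, zpow_add₀ (by norm_num)]
      ring

theorem ofSeq_N (s : PowerSequence Gen) : (ofSeq s).N = (s.map fun q => q.2.numVertices).sum := by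
  induction s using List.reverseRecOn with
  | nil => rfl
  | append_singleton s q ih =>
    rw [ofSeq_concat]
    change (ofSeq s).N + q.2.n = _
    simp [ih, PowerCircuit.numVertices]

theorem length_filter_range_add (p : ℕ → Bool) (m n : ℕ) :
    ((List.range (m + n)).filter p).length =
      ((List.range m).filter p).length + ((List.range n).filter fun i => p (m + i)).length := by
  rw [List.range_add, List.filter_append, List.length_append, List.filter_map, List.length_map]
  rfl

theorem length_filter_range_congr {p q : ℕ → Bool} {n : ℕ} (h : ∀ i < n, p i = q i) :
    ((List.range n).filter p).length = ((List.range n).filter q).length := by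
  rw [List.filter_congr fun i hi => h i (List.mem_range.1 hi)]

theorem ofSeq_mm (s : PowerSequence Gen) :
    ((List.range (ofSeq s).N).filter fun v => (ofSeq s).mm v ≠ 0).length =
      (s.map fun q => if q.1.isT then 0 else q.2.numMarked).sum := by
  induction s using List.reverseRecOn with
  | nil => rfl
  | append_singleton s q ih =>
    rw [ofSeq_concat]
    change ((List.range ((ofSeq s).N + q.2.n)).filter _).length = _
    rw [length_filter_range_add, List.map_append, List.sum_append, ← ih]
    congr 1
    · exact length_filter_range_congr fun i hi => by simp [append, hi]
    · cases hq : q.1.isT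
      · simp [append, hq, PowerCircuit.numMarked_eq_length]
      · simp [append, hq]

theorem ofSeq_kind (s : PowerSequence Gen) :
    ((List.range (ofSeq s).N).filter (ofSeq s).kind).length =
      (s.map fun q => if q.1.isT then q.2.numVertices else 0).sum := by
  induction s using List.reverseRecOn with
  | nil => rfl
  | append_singleton s q ih =>
    rw [ofSeq_concat]
    change ((List.range ((ofSeq s).N + q.2.n)).filter _).length = _
    rw [length_filter_range_add, List.map_append, List.sum_append, ← ih]
    congr 1
    · exact length_filter_range_congr fun i hi => by simp [append, hi]
    · cases hq : q.1.isT
      · simp [append, hq]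
      · simp [append, hq, PowerCircuit.numVertices]

theorem ofSeq_dm (s : PowerSequence Gen) :
    ((List.range (ofSeq s).N).filter fun v => (ofSeq s).dm v ≠ 0).length =
      (s.map fun q => if q.1.isT then q.2.numMarked else 0).sum := by
  induction s using List.reverseRecOn with
  | nil => rfl
  | append_singleton s q ih =>
    rw [ofSeq_concat]
    change ((List.range ((ofSeq s).N + q.2.n)).filter _).length = _
    rw [length_filter_range_add, List.map_append, List.sum_append, ← ih]
    congr 1
    · exact length_filter_range_congr fun i hi => by simp [append, hi]
    · cases hq : q.1.isT
      · simp [append, hq]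
      · simp [append, hq, PowerCircuit.numMarked_eq_length]

end Merged

/-! ### The circuits in the answers -/

theorem sum_map_range {M : Type*} [AddCommMonoid M] (f : ℕ → M) (n : ℕ) :
    ((List.range n).map f).sum = ∑ i ∈ Finset.range n, f i := by
  induction n with
  | zero => simp
  | succ n ih =>
    rw [List.range_succ, List.map_append, List.sum_append, ih, Finset.sum_range_succ]
    simp

theorem sum_map_filter_range {M : Type*} [AddCommMonoid M] (f : ℕ → M) (p : ℕ → Bool) (n : ℕ) :
    (((List.range n).filter p).map f).sum =
      ∑ i ∈ Finset.range n, if p i = true then f i else 0 := by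
  induction n with
  | zero => simp
  | succ n ih =>
    rw [List.range_succ, List.filter_append, List.map_append, List.sum_append, ih,
      Finset.sum_range_succ]
    by_cases h : p n = true <;> simp [h]

theorem filter_flatMap {α β : Type*} (l : List α) (p : α → Bool) (g : α → List β) :
    (l.filter p).flatMap g = l.flatMap fun v => if p v = true then g v else [] := by
  induction l with
  | nil => rfl
  | cons v l ih =>
    by_cases h : p v = true
    · simp [h, ih]
    · simp [h, ih]

namespace Merged

variable {S : Merged}

/-- The vertex `v` has no successors. -/
def Leaf (S : Merged) (v : ℕ) : Prop := ∀ w < S.N, S.edge v w = 0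

/-- The exponent `x` with `E v = 2 ^ x`, unless `v` has no successors. -/
def expo (S : Merged) (v : ℕ) : ℤ := ∑ w ∈ Finset.range S.N, (S.edge v w : ℤ) * S.E w

/-- The exponent of the contribution `± 2 ^ f` of `v` to the translation part. -/
def fexp (S : Merged) (v : ℕ) : ℤ := S.expo v - S.dsum v

theorem Valid.E_eq (hS : S.Valid) {v : ℕ} (hv : v < S.N) [Decidable (S.Leaf v)] :
    S.E v = if S.Leaf v then 0 else 2 ^ (S.expo v).toNat := by
  split_ifs with h
  · exact hS.eval.leaf v hv fun w hw => sign_cast_eq_zero.2 (h w hw)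
  · exact hS.eval.node v hv fun h' => h fun w hw => sign_cast_eq_zero.1 (h' w hw)

theorem Valid.expo_nonneg (hS : S.Valid) {v : ℕ} (hv : v < S.N) : 0 ≤ S.expo v :=
  hS.eval.exponent_nonneg v hv

theorem Valid.exists_leaf (hS : S.Valid) (h : 0 < S.N) : ∃ v < S.N, S.Leaf v := by
  obtain ⟨v, hv, hmin⟩ := (Finset.range S.N).exists_min_image S.h ⟨0, Finset.mem_range.2 h⟩
  refine ⟨v, Finset.mem_range.1 hv, fun w hw => ?_⟩
  by_contra hvw
  have := hS.eval.rank v (Finset.mem_range.1 hv) w hw fun h' => hvw (sign_cast_eq_zero.1 h')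
  have := hmin w (Finset.mem_range.2 hw)
  omega

theorem Valid.shift_eq (hS : S.Valid) [DecidablePred S.Leaf] :
    S.shift = ∑ v ∈ Finset.range S.N,
      if S.Leaf v then 0 else ((S.mm v : ℤ) : ℚ) * 2 ^ S.fexp v := by
  refine Finset.sum_congr rfl fun v hv => ?_
  have hv := Finset.mem_range.1 hv
  rw [hS.E_eq hv]
  split_ifs with h
  · simp
  · rw [fexp, sub_eq_add_neg, zpow_add₀ (by norm_num)]
    push_cast
    rw [← zpow_natCast, Int.toNat_of_nonneg (hS.expo_nonneg hv)]
    ring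

/-- The circuits for `t`, without the others, form a circuit. -/
theorem Valid.exists_t_circuit (hS : S.Valid) :
    ∃ P : PowerCircuit, P.numVertices = ((List.range S.N).filter S.kind).length ∧
      P.numMarked = ((List.range S.N).filter fun v => S.dm v ≠ 0).length ∧
      P.number = S.dsum S.N ∧
      P.encode = (((List.range S.N).filter S.kind).length : ℤ) ::
        ((((List.range S.N).filter S.kind).flatMap fun v =>
          ((List.range S.N).filter S.kind).map fun w => (S.edge v w : ℤ)) ++
        ((List.range S.N).filter S.kind).map fun v => (S.dm v : ℤ)) := by
  classical
  have hmem : ∀ v ∈ (List.range S.N).filter S.kind, v < S.N ∧ S.kind v = true := by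
    intro v hv
    simpa using hv
  have hsum : ∀ v, S.kind v = true → (((List.range S.N).filter S.kind).map fun w =>
      (S.edge v w : ℤ) * S.E w).sum = S.expo v := by
    intro v hv
    rw [sum_map_filter_range]
    refine Finset.sum_congr rfl fun w _ => ?_
    split_ifs with hw
    · rfl
    · by_cases h : S.edge v w = 0
      · simp [h]
      · exact absurd (((hS.edge_ne v w h).2.2).symm.trans hv) hw
  have hleaf : ∀ v, S.kind v = true →
      ((∀ w ∈ (List.range S.N).filter S.kind, S.edge v w = 0) ↔ S.Leaf v) := by
    intro v hv
    constructor
    · intro h w hw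
      by_contra h'
      exact h' (h w (by simpa [hw] using ((hS.edge_ne v w h').2.2).symm.trans hv))
    · exact fun h w hw => h w (hmem w hw).1
  obtain ⟨P, h1, h2, h3, h4⟩ := exists_listCircuit (l := (List.range S.N).filter S.kind)
    (edge := S.edge) (mark := S.dm) (h := S.h) (E := S.E)
    (by
      intro v hv w hw h
      exact hS.eval.rank v (hmem v hv).1 w (hmem w hw).1 fun h' => h (sign_cast_eq_zero.1 h'))
    (by
      intro v hv h
      rw [hS.E_eq (hmem v hv).1, if_pos ((hleaf v (hmem v hv).2).1 h)])
    (by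
      intro v hv h
      rw [hsum v (hmem v hv).2]
      refine ⟨hS.expo_nonneg (hmem v hv).1, ?_⟩
      rw [hS.E_eq (hmem v hv).1, if_neg fun h' => h ((hleaf v (hmem v hv).2).2 h')])
  refine ⟨P, h1, ?_, ?_, h4⟩
  · rw [h2, List.filter_filter]
    refine length_filter_range_congr fun i _ => ?_
    by_cases h : S.dm i = 0
    · simp [h]
    · simp [h, (hS.dm_ne i h).2]
  · rw [h3, sum_map_filter_range]
    refine Finset.sum_congr rfl fun v _ => ?_
    split_ifs with hv
    · rfl
    · by_cases h : S.dm v = 0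
      · simp [h]
      · exact absurd (hS.dm_ne v h).2 hv

/-- The label of the edge to `w` from the new vertex for `v`, by the type `ty` of `v`: for `ty = 1`
the exponent of the value is `fexp v`, for `ty = 2` the value is `2 ^ 0`, because the edge leads to
a vertex `z` without successors, and otherwise it is `0`. -/
def newEdge (S : Merged) (z ty v w : ℕ) : SignType :=
  if ty = 2 then if w = z then 1 else 0
  else if ty = 1 then
    if S.edge v w ≠ 0 then S.edge v w else if w < v then -S.dm w else 0
  else 0

theorem Valid.newEdge_one (hS : S.Valid) {v : ℕ} (hv : S.mm v ≠ 0) (z w : ℕ) :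
    ((S.newEdge z 1 v w : SignType) : ℤ) = S.edge v w - if w < v then (S.dm w : ℤ) else 0 := by
  simp only [newEdge, if_true, OfNat.one_ne_ofNat, if_false]
  by_cases h : S.edge v w = 0
  · rw [if_neg (not_not.2 h), h]
    split_ifs
    · cases S.dm w <;> simp
    · simp
  -- The edges of `v` stay among the circuits for `a`, and so they do not lead to a mark of `t`.
  · rw [if_pos h]
    have h1 : S.dm w = 0 := by
      by_contra h'
      have h2 := (hS.dm_ne w h').2
      rw [← (hS.edge_ne v w h).2.2, (hS.mm_ne v hv).2] at h2
      exact Bool.false_ne_true h2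
    simp [h1]

/-- The union together with one new vertex for every vertex marked by `mm` is a circuit for the
translation part, if the new vertices with negative exponents, taken together, have been replaced
by vertices of the values `1` and `0`. -/
theorem Valid.exists_a_circuit (hS : S.Valid) [DecidablePred S.Leaf] {z q : ℕ} {ty : ℕ → ℕ}
    {mk : ℕ → SignType} {sg : SignType} (hsg : sg ≠ 0)
    (h1 : ∀ v < S.N, S.mm v ≠ 0 → (ty v = 1 ↔ ¬ S.Leaf v ∧ 0 ≤ S.fexp v))
    (h2 : ∀ v < S.N, S.mm v ≠ 0 → ty v = 2 → ¬ S.Leaf v ∧ S.fexp v < 0)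
    (hmk : ∀ v < S.N, S.mm v ≠ 0 → mk v = if ¬ S.Leaf v ∧ S.fexp v < 0 then sg else S.mm v)
    (hq : (∑ v ∈ Finset.range S.N, if S.mm v ≠ 0 ∧ ty v = 2 then 1 else 0) = q)
    (hz : 0 < S.N → z < S.N ∧ S.Leaf z)
    (hsum : (∑ v ∈ Finset.range S.N, if ¬ S.Leaf v ∧ S.fexp v < 0 then
      ((S.mm v : ℤ) : ℚ) * 2 ^ S.fexp v else 0) = (sg : ℤ) * q) {tl : List ℕ}
    (htl : tl = (List.range S.N).filter fun v => S.mm v ≠ 0) :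
    ∃ P : PowerCircuit, P.numVertices = S.N + tl.length ∧ P.numMarked = tl.length ∧
      (P.number : ℚ) = S.shift ∧
      P.encode = ((S.N + tl.length : ℕ) : ℤ) ::
        (((List.range S.N).flatMap fun v =>
            ((List.range S.N).map fun w => (S.edge v w : ℤ)) ++ tl.map fun _ => 0) ++
          (tl.flatMap fun v =>
            ((List.range S.N).map fun w => (S.newEdge z (ty v) v w : ℤ)) ++ tl.map fun _ => 0) ++
          ((List.range S.N).map fun _ => 0) ++ tl.map fun v => (mk v : ℤ)) := by
  have hmem : ∀ v ∈ tl, v < S.N ∧ S.mm v ≠ 0 := by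
    intro v hv
    simpa [htl] using hv
  let edge : ℕ ⊕ ℕ → ℕ ⊕ ℕ → SignType := fun x y =>
    match x, y with
    | .inl v, .inl w => S.edge v w
    | .inr v, .inl w => S.newEdge z (ty v) v w
    | _, _ => 0
  let val : ℕ → ℤ := fun v => if ty v = 1 then 2 ^ (S.fexp v).toNat else if ty v = 2 then 1 else 0
  have hsum_inl : ∀ (x : ℕ ⊕ ℕ), (((List.range S.N).map Sum.inl ++ tl.map Sum.inr).map fun y =>
      (edge x y : ℤ) * (Sum.elim S.E val y)).sum =
      ∑ w ∈ Finset.range S.N, (edge x (.inl w) : ℤ) * S.E w := by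
    intro x
    rw [List.map_append, List.sum_append, List.map_map, List.map_map, ← sum_map_range,
      List.sum_eq_zero (l := List.map _ tl), add_zero]
    · rfl
    · intro t ht
      obtain ⟨w, -, rfl⟩ := List.mem_map.1 ht
      cases x <;> simp [edge]
  have hleaf_inl : ∀ (x : ℕ ⊕ ℕ), (∀ y ∈ (List.range S.N).map Sum.inl ++ tl.map Sum.inr,
      edge x y = 0) ↔ ∀ w < S.N, edge x (.inl w) = 0 := by
    intro x
    constructor
    · intro h w hw
      exact h _ (by simp [hw])
    · intro h y hy
      rcases y with w | w
      · exact h w (by simpa using hy)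
      · cases x <;> rfl
  obtain ⟨P, e1, e2, e3, e4⟩ := exists_listCircuit
    (l := (List.range S.N).map Sum.inl ++ tl.map Sum.inr) (edge := edge)
    (mark := Sum.elim (fun _ => 0) mk) (h := Sum.elim S.h fun _ => S.N)
    (E := Sum.elim S.E val)
    (by
      intro x hx y hy hxy
      rcases x with v | v <;> rcases y with w | w
      · have hv : v < S.N := by simpa using hx
        have hw : w < S.N := by simpa using hy
        exact hS.eval.rank v hv w hw fun h' => hxy (sign_cast_eq_zero.1 h')
      · exact absurd rfl hxy
      · have hw : w < S.N := by simpa using hy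
        exact hS.rank_lt w hw
      · exact absurd rfl hxy)
    (by
      intro x hx h
      rw [hleaf_inl] at h
      rcases x with v | v
      · have hv : v < S.N := by simpa using hx
        exact (hS.E_eq hv).trans (if_pos h)
      · have hv := hmem v (by simpa using hx)
        have ht1 : ty v ≠ 1 := by
          intro ht
          refine ((h1 v hv.1 hv.2).1 ht).1 fun w hw => ?_
          by_contra hvw
          have := h w hw
          simp [edge, newEdge, ht, hvw] at this
        have ht2 : ty v ≠ 2 := by
          intro ht
          have := h z (hz (by omega)).1
          simp [edge, newEdge, ht] at this
        simp [val, ht1, ht2])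
    (by
      intro x hx h
      rw [hleaf_inl] at h
      rw [hsum_inl]
      rcases x with v | v
      · have hv : v < S.N := by simpa using hx
        refine ⟨hS.expo_nonneg hv, ?_⟩
        exact (hS.E_eq hv).trans (if_neg h)
      · have hv := hmem v (by simpa using hx)
        by_cases ht1 : ty v = 1
        · have hs : ∑ w ∈ Finset.range S.N, (edge (.inr v) (.inl w) : ℤ) * S.E w = S.fexp v := by
            have hd : S.dsum v =
                ∑ w ∈ Finset.range S.N, if w < v then (S.dm w : ℤ) * S.E w else 0 := by
              rw [← Finset.sum_filter]
              refine Finset.sum_congr ?_ fun _ _ => rfl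
              ext w
              have := hv.1
              simp only [Finset.mem_range, Finset.mem_filter]
              omega
            rw [fexp, hd, expo, ← Finset.sum_sub_distrib]
            refine Finset.sum_congr rfl fun w _ => ?_
            change ((S.newEdge z (ty v) v w : SignType) : ℤ) * _ = _
            rw [ht1, hS.newEdge_one hv.2, sub_mul]
            split_ifs <;> simp
          rw [hs]
          refine ⟨((h1 v hv.1 hv.2).1 ht1).2, ?_⟩
          simp [val, ht1]
        · by_cases ht2 : ty v = 2
          · have hz := hz (by omega)
            have hs : ∑ w ∈ Finset.range S.N, (edge (.inr v) (.inl w) : ℤ) * S.E w = 0 := by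
              refine Finset.sum_eq_zero fun w hw => ?_
              by_cases hwz : w = z
              · rw [hwz, hS.E_eq hz.1, if_pos hz.2, mul_zero]
              · simp [edge, newEdge, ht2, hwz]
            rw [hs]
            simp [val, ht2]
          · exact absurd (fun w _ => by simp [edge, newEdge, ht1, ht2]) h)
  refine ⟨P, by simp [e1], ?_, ?_, ?_⟩
  · rw [e2, List.filter_append, List.length_append, List.filter_map, List.filter_map,
      List.length_map, List.length_map, List.filter_eq_nil_iff.2, List.filter_eq_self.2]
    · simp
    · intro v hv
      have : mk v ≠ 0 := by
        rw [hmk v (hmem v hv).1 (hmem v hv).2]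
        split_ifs
        · exact hsg
        · exact (hmem v hv).2
      exact decide_eq_true this
    · simp
  · rw [e3, List.map_append, List.sum_append, List.map_map, List.map_map,
      List.sum_eq_zero (l := List.map _ (List.range S.N)), zero_add, htl, sum_map_filter_range,
      hS.shift_eq, Int.cast_sum]
    · -- The terms with negative exponents are exchanged for `q` terms `sg`.
      have hq' : ((sg : ℤ) : ℚ) * q = ∑ v ∈ Finset.range S.N,
          if S.mm v ≠ 0 ∧ ty v = 2 then ((sg : ℤ) : ℚ) else 0 := by
        rw [← hq]
        push_cast
        rw [Finset.mul_sum]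
        exact Finset.sum_congr rfl fun v _ => by split_ifs <;> simp
      have hs : ∑ v ∈ Finset.range S.N, (if S.Leaf v then 0 else
          ((S.mm v : ℤ) : ℚ) * 2 ^ S.fexp v) =
          (∑ v ∈ Finset.range S.N, if ¬ S.Leaf v ∧ 0 ≤ S.fexp v then
            ((S.mm v : ℤ) : ℚ) * 2 ^ S.fexp v else 0) +
          ∑ v ∈ Finset.range S.N, if S.mm v ≠ 0 ∧ ty v = 2 then ((sg : ℤ) : ℚ) else 0 := by
        rw [← hq', ← hsum, ← Finset.sum_add_distrib]
        refine Finset.sum_congr rfl fun v _ => ?_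
        by_cases hl : S.Leaf v
        · simp [hl]
        · by_cases hf : 0 ≤ S.fexp v
          · simp [hl, hf]
          · simp [hl, hf, not_le.1 hf]
      rw [hs, ← Finset.sum_add_distrib]
      refine Finset.sum_congr rfl fun v hv => ?_
      have hv := Finset.mem_range.1 hv
      by_cases hm : S.mm v = 0
      · simp [hm]
      · simp only [hm, ne_eq, not_false_eq_true, decide_true, if_true, Function.comp_apply,
          Sum.elim_inr, true_and]
        by_cases ht1 : ty v = 1
        · obtain ⟨hl, hf⟩ := (h1 v hv hm).1 ht1
          rw [hmk v hv hm, if_neg (by omega), if_pos ⟨hl, hf⟩, if_neg (by omega), add_zero]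
          simp only [val, ht1, if_true]
          push_cast
          rw [← zpow_natCast, Int.toNat_of_nonneg hf]
        · rw [if_neg (c := ¬ S.Leaf v ∧ 0 ≤ S.fexp v) fun h => ht1 ((h1 v hv hm).2 h), zero_add]
          by_cases ht2 : ty v = 2
          · rw [hmk v hv hm, if_pos (h2 v hv hm ht2)]
            simp [val, ht2]
          · simp [val, ht1, ht2]
    · intro t ht
      obtain ⟨w, -, rfl⟩ := List.mem_map.1 ht
      simp
  · rw [e4]
    simp [List.flatMap_append, List.flatMap_map, List.map_append, List.append_assoc, edge,
      Function.comp_def]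

end Merged

/-! ### Reading the input

The programs use the following arrays: `0` for the input, `1` for the output, `2` for the matrix of
edge labels of the union, with rows of length `N`, `3` and `4` for the marks of the circuits for `a`
and for `t`, `5` for the indicator of the vertices of the latter, `6` for exponents, `7` for
weights, `8` and `9` for the types and the marks of the new vertices.

Registers: `0` is the length of the output, `1` the number of circuits still to be read, `2` the
position in the input, `3` is `N`, `4` the size of the current circuit, `5` and `6` are counters,
`7` is `1` if the current circuit is one for `t`, `8` is the number of vertices read, `9` the start
of a row of the matrix, `10` the number of vertices of the circuits for `t`, `11` the bound `L + 1`
for gaps, `12` the number of exponents to be weighed, `13` the number of new vertices, `14` the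
lower bound for the exponents still to be treated, `15` and `16` are the last exponent treated and
its weight, `17`, `18`, `21` and `22` are counters, `19` is the flag of a search, `20` the next
exponent, `23` the sum of the circuits for `t`, `24` the least exponent, `25` a vertex without
successors, `26` and `27` are the sums of the weighted marks, `28` and `29` are `q` and its sign,
`30` is a multiple of the weight of the anchor, `31` counts the values `1` that are still to be
given to new vertices, and `32`, `33` and `34` are scratch registers.
-/

/-- The list `ℓ` stands in the array `A` from the position `p` on. -/
def ListAt (A : ℤ → ℤ) (p : ℤ) (ℓ : List ℤ) : Prop :=
  ∀ i : ℕ, ∀ h : i < ℓ.length, A (p + i) = ℓ[i]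

theorem ListAt.append {A : ℤ → ℤ} {p : ℤ} {ℓ₁ ℓ₂ : List ℤ} (h : ListAt A p (ℓ₁ ++ ℓ₂)) :
    ListAt A p ℓ₁ ∧ ListAt A (p + ℓ₁.length) ℓ₂ := by
  constructor
  · intro i hi
    rw [h i (by simp; omega), List.getElem_append_left hi]
  · intro i hi
    have := h (ℓ₁.length + i) (by simp; omega)
    rw [List.getElem_append_right (by omega)] at this
    simpa [add_assoc] using this

theorem ListAt.cons {A : ℤ → ℤ} {p z : ℤ} {ℓ : List ℤ} (h : ListAt A p (z :: ℓ)) :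
    A p = z ∧ ListAt A (p + 1) ℓ := by
  have h' := ListAt.append (ℓ₁ := [z]) (ℓ₂ := ℓ) h
  exact ⟨by simpa using h'.1 0 (by simp), by simpa using h'.2⟩

theorem ListAt.map_range {A : ℤ → ℤ} {p : ℤ} {n : ℕ} {f : ℕ → ℤ}
    (h : ListAt A p ((List.range n).map f)) {i : ℕ} (hi : i < n) : A (p + i) = f i := by
  have := h i (by simpa using hi)
  simpa using this

theorem ListAt.flatMap_range {A : ℤ → ℤ} {p : ℤ} {m n : ℕ} {g : ℕ → List ℤ}
    (hg : ∀ v, (g v).length = n) (h : ListAt A p ((List.range m).flatMap g)) {v : ℕ} (hv : v < m) :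
    ListAt A (p + v * n) (g v) := by
  induction m with
  | zero => omega
  | succ m ih =>
    rw [List.range_succ, List.flatMap_append] at h
    obtain ⟨h1, h2⟩ := h.append
    rcases Nat.lt_succ_iff_lt_or_eq.1 hv with hv | rfl
    · exact ih h1 hv
    · have : ((List.range v).flatMap g).length = v * n := by
        simp [List.length_flatMap, hg]
      rw [this] at h2
      simpa using h2

theorem ofFn_eq_map_range {α : Type*} {n : ℕ} (f : ℕ → α) :
    List.ofFn (fun i : Fin n => f i) = (List.range n).map f := by
  refine List.ext_getElem (by simp) fun i h1 h2 => by simp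

theorem PowerCircuit.encode_eq (P : PowerCircuit) :
    P.encode = (P.n : ℤ) :: (((List.range P.n).flatMap fun v =>
      (List.range P.n).map fun w => (P.natEdge v w : ℤ)) ++
        (List.range P.n).map fun v => (P.natMark v : ℤ)) := by
  rw [PowerCircuit.encode, List.flatMap_def, ← ofFn_eq_map_range, ← ofFn_eq_map_range]
  simp only [← natEdge_fin, ← natMark_fin, ← ofFn_eq_map_range]

/-- The circuits of the sequence `s` stand in the array `A` from the position `p` on. -/
def SeqAt (A : ℤ → ℤ) : ℤ → PowerSequence Gen → Prop
  | _, [] => True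
  | p, q :: s => A p = q.2.n ∧
      (∀ v < q.2.n, ∀ w < q.2.n, A (p + 1 + v * q.2.n + w) = q.2.natEdge v w) ∧
      (∀ v < q.2.n, A (p + 1 + q.2.n * q.2.n + v) = q.2.natMark v) ∧
      SeqAt A (p + 1 + q.2.n * q.2.n + q.2.n) s

theorem ListAt.seqAt {A : ℤ → ℤ} {p : ℤ} {s : PowerSequence Gen}
    (h : ListAt A p (s.map fun q => q.2.encode).flatten) : SeqAt A p s := by
  induction s generalizing p with
  | nil => trivial
  | cons q s ih =>
    rw [List.map_cons, List.flatten_cons, PowerCircuit.encode_eq, List.cons_append] at h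
    obtain ⟨h0, h⟩ := h.cons
    rw [List.append_assoc] at h
    obtain ⟨h1, h⟩ := h.append
    obtain ⟨h2, h⟩ := h.append
    simp only [List.length_flatMap, List.length_map, List.length_range, List.map_const',
      List.sum_replicate, smul_eq_mul] at h2 h
    push_cast at h2 h
    refine ⟨h0, fun v hv w hw => ?_, fun v hv => ?_, ih h⟩
    · exact (h1.flatMap_range (n := q.2.n) (by simp) hv).map_range hw
    · exact h2.map_range hv

theorem ListAt_initial (input : List ℤ) : ListAt ((initial input).arr 0) 0 input := by
  intro i hi
  simp [initial, hi]

/-- The letters of the sequence alternate; the first one is `t` if and only if `b` is true. -/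
def Alternates : Bool → PowerSequence Gen → Prop
  | _, [] => True
  | b, q :: s => q.1.isT = b ∧ Alternates (!b) s

theorem alternates_alternating {k : ℕ} (m : Fin (k + 1) → PowerCircuit)
    (d : Fin k → PowerCircuit) : Alternates false (alternating m d) := by
  refine ⟨rfl, ?_⟩
  have h : (List.ofFn fun j : Fin k => [(Gen.t, d j), (Gen.a, m j.succ)]) =
      (List.ofFn fun j => (d j, m j.succ)).map fun x => [(Gen.t, x.1), (Gen.a, x.2)] := by
    rw [List.map_ofFn]; rfl
  rw [h]
  generalize List.ofFn (fun j => (d j, m j.succ)) = l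
  induction l with
  | nil => trivial
  | cons x l ih => exact ⟨rfl, rfl, ih⟩

theorem length_alternating {k : ℕ} (m : Fin (k + 1) → PowerCircuit) (d : Fin k → PowerCircuit) :
    (alternating m d).length = k + k + 1 := by
  simp [alternating, List.length_flatten, List.map_ofFn, Function.comp_def]
  ring

theorem sum_alternating {k : ℕ} (m : Fin (k + 1) → PowerCircuit) (d : Fin k → PowerCircuit)
    (f : Gen × PowerCircuit → ℕ) :
    ((alternating m d).map f).sum = ∑ j, f (Gen.a, m j) + ∑ j, f (Gen.t, d j) := by
  rw [Fin.sum_univ_succ, add_assoc, ← Finset.sum_add_distrib]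
  simp [alternating, List.map_flatten, List.sum_flatten, List.map_ofFn, Function.comp_def,
    List.sum_ofFn, add_comm]

/-! ### Counting the vertices -/

/-- Add the number of vertices of the circuit at the position in register `2` to register `3`, and
move on to the next circuit. -/
def countBody : Prog :=
  .assign 4 (.get 0 (.reg 2)) ;; .assign 3 (.add (.reg 3) (.reg 4)) ;;
  .assign 2 (.add (.add (.reg 2) (.lit 1)) (.reg 4)) ;;
  .forTo 5 4 (.assign 2 (.add (.reg 2) (.reg 4))) ;;
  .assign 1 (.sub (.reg 1) (.lit 1))

theorem spec_flat_seq {p q : Prog} {σ : State} {B₁ B₂ : ℕ} {R : State → Prop}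
    (hp : p.flat = true) (hB : p.time ≤ B₁) (h : Spec q (p.exec σ) B₂ R) :
    Spec (p ;; q) σ (B₁ + B₂) R :=
  Spec.seq (R₁ := fun τ => τ = p.exec σ) (Spec.of_flat hp hB rfl) fun _ _ hτ => hτ ▸ h

theorem spec_countBody {σ : State} {n : ℕ} (hn : σ.arr 0 (σ.reg 2) = n) :
    Spec countBody σ (20 * n + 40) (fun τ => τ.reg 1 = σ.reg 1 - 1 ∧ τ.reg 3 = σ.reg 3 + n ∧
      τ.reg 2 = σ.reg 2 + 1 + n * n + n) := by
  refine Spec.mono (B := 4 + (4 + (6 + ((n * (4 + 8) + 6) + 4)))) (R := fun τ =>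
    τ.reg 1 = σ.reg 1 - 1 ∧ τ.reg 3 = σ.reg 3 + n ∧ τ.reg 2 = σ.reg 2 + 1 + n * n + n) ?_
    (by omega) (fun _ _ h => h)
  refine spec_flat_seq rfl (by decide) (spec_flat_seq rfl (by decide)
    (spec_flat_seq rfl (by decide) ?_))
  refine Spec.seq (R₁ := fun τ => τ.reg 2 = σ.reg 2 + 1 + n * n + n) ?_ ?_
  · refine (Spec.forTo (N := n) (B := 4)
      (fun i τ => τ.reg 2 = σ.reg 2 + 1 + i * n + n) ?_ (by decide) (by decide) ?_ ?_)
    · simp [Prog.exec, Expr.eval, hn]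
    · simp [Prog.exec, Expr.eval, hn]
    · intro j hj τ hF hτ hI
      have h4 : τ.reg 4 = n := by
        rw [hF.1 4 (by decide)]
        simp [Prog.exec, Expr.eval, hn]
      refine Spec.of_flat rfl (by decide) ?_
      simp [Prog.exec, Expr.eval, h4, hI]
      ring
  · intro τ hF hτ
    refine Spec.of_flat rfl (by decide) ?_
    have h1 := hF.1 1 (by decide)
    have h3 := hF.1 3 (by decide)
    simp [Prog.exec, Expr.eval, hn] at h1 h3
    simp [Prog.exec, Expr.eval, h1, h3, hτ]

/-- A loop that treats the circuits of a sequence one by one. -/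
theorem spec_loop_seq {p : Prog} (I : PowerSequence Gen → State → Prop)
    (b : Gen × PowerCircuit → ℕ)
    (hstep : ∀ q s σ, I (q :: s) σ → Spec p σ (b q) (fun τ => I s τ ∧ τ.reg 1 = σ.reg 1 - 1))
    (s : PowerSequence Gen) (σ : State) (hI : I s σ) (hs : σ.reg 1 = s.length) :
    Spec (.loop (.reg 1) p) σ ((s.map fun q => b q + 2).sum + 2) (I []) := by
  induction s generalizing σ with
  | nil => exact ⟨_, σ, .loop_false (by simp [Expr.eval, hs]), by simp [Expr.cost], hI⟩
  | cons q s ih =>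
    obtain ⟨T, τ, h, hT, hτ, hτ1⟩ := hstep q s σ hI
    obtain ⟨U, ρ, h', hU, hρ⟩ := ih τ hτ (by rw [hτ1, hs]; simp)
    refine ⟨_, ρ, .loop_true (by simp [Expr.eval, hs]) h h', ?_, hρ⟩
    simp only [Expr.cost, List.map_cons, List.sum_cons]
    omega

theorem spec_count {σ : State} {s : PowerSequence Gen} (hs : σ.reg 1 = s.length)
    (h2 : SeqAt (σ.arr 0) (σ.reg 2) s) (h3 : σ.reg 3 = 0) :
    Spec (.loop (.reg 1) countBody) σ ((s.map fun q => 20 * q.2.n + 40 + 2).sum + 2)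
      (fun τ => τ.reg 3 = (Merged.ofSeq s).N) := by
  have := spec_loop_seq (p := countBody) (fun s' τ => τ.arr 0 = σ.arr 0 ∧
    SeqAt (σ.arr 0) (τ.reg 2) s' ∧ τ.reg 3 + (s'.map fun q => q.2.numVertices).sum =
      (s.map fun q => q.2.numVertices).sum) (fun q => 20 * q.2.n + 40) ?_ s σ
      ⟨rfl, h2, by simp [h3]⟩ hs
  · refine this.mono le_rfl ?_
    rintro τ - ⟨-, -, h⟩
    rw [Merged.ofSeq_N]
    simpa using h
  · rintro q s' τ ⟨h0, ⟨hn, -, -, hs'⟩, h⟩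
    refine (spec_countBody (n := q.2.n) (by rw [h0, hn])).mono le_rfl ?_
    rintro ρ hF ⟨e1, e3, e2⟩
    refine ⟨⟨(hF.2 0 (by decide)).trans h0, by rwa [e2], ?_⟩, e1⟩
    rw [e3, ← h]
    simp [PowerCircuit.numVertices]
    ring

/-! ### Building the union -/

/-- The matrix of edge labels of `S` stands in array `2`, row by row, with rows of length `N`. -/
def MatrixAt (N : ℕ) (f : ℕ → ℕ → ℤ) (σ : State) : Prop :=
  ∀ v < N, ∀ w < N, σ.arr 2 (v * N + w) = f v w

theorem index_eq_iff {N v w v' w' : ℕ} (hw : w < N) (hw' : w' < N) :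
    (v * N + w : ℤ) = v' * N + w' ↔ v = v' ∧ w = w' := by
  constructor
  · intro h
    have h : v * N + w = v' * N + w' := by exact_mod_cast h
    have h1 : (v * N + w) / N = v := by
      rw [mul_comm, Nat.mul_add_div (by omega), Nat.div_eq_of_lt hw, add_zero]
    have h2 : (v' * N + w') / N = v' := by
      rw [mul_comm, Nat.mul_add_div (by omega), Nat.div_eq_of_lt hw', add_zero]
    have hv : v = v' := by rw [← h1, ← h2, h]
    subst hv
    exact ⟨rfl, by omega⟩
  · rintro ⟨rfl, rfl⟩; rfl

/-- The union `S` has been built: register `8` holds the number of its vertices, register `9` the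
start of the next row in the matrix, array `3` the marks of the circuits for `a`, array `4` those
of the circuits for `t`, and array `5` the indicator of the vertices of the latter, which are
counted in register `10`. -/
structure UnionAt (N : ℕ) (S : Merged) (σ : State) : Prop where
  base : σ.reg 8 = S.N
  row : σ.reg 9 = S.N * N
  count : σ.reg 10 = ((List.range S.N).filter S.kind).length
  edge : MatrixAt N (fun v w => S.edge v w) σ
  mm : ∀ v : ℕ, σ.arr 3 v = S.mm v
  dm : ∀ v : ℕ, σ.arr 4 v = S.dm v
  kind : ∀ v : ℕ, σ.arr 5 v = if v < S.N ∧ S.kind v = true then 1 else 0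

/-- Copy the rows of the current circuit into the matrix. -/
def fillRows : Prog :=
  .forTo 5 4 (.forTo 6 4 (.store 2 (.add (.add (.reg 9) (.reg 8)) (.reg 6)) (.get 0 (.reg 2)) ;;
    .assign 2 (.add (.reg 2) (.lit 1))) ;; .assign 9 (.add (.reg 9) (.reg 3)))

/-- Copy the marks of the current circuit, by its kind in register `7`. -/
def fillMarks : Prog :=
  .forTo 5 4 (.ite (.reg 7)
      (.store 4 (.reg 8) (.get 0 (.reg 2)) ;; .store 5 (.reg 8) (.lit 1) ;;
        .assign 10 (.add (.reg 10) (.lit 1)))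
      (.store 3 (.reg 8) (.get 0 (.reg 2))) ;;
    .assign 2 (.add (.reg 2) (.lit 1)) ;; .assign 8 (.add (.reg 8) (.lit 1)))

/-- Append the circuit at the position in register `2` to the union. -/
def fillBody : Prog :=
  .assign 4 (.get 0 (.reg 2)) ;; .assign 2 (.add (.reg 2) (.lit 1)) ;; fillRows ;; fillMarks ;;
  .assign 7 (.sub (.lit 1) (.reg 7)) ;; .assign 1 (.sub (.reg 1) (.lit 1))

theorem spec_fillRows {σ : State} {N : ℕ} {S : Merged} {g : Gen} {P : PowerCircuit}
    (hS : S.Valid) (hN : S.N + P.n ≤ N) (h3 : σ.reg 3 = N) (h4 : σ.reg 4 = P.n)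
    (h8 : σ.reg 8 = S.N) (h9 : σ.reg 9 = S.N * N)
    (hin : ∀ v < P.n, ∀ w < P.n, σ.arr 0 (σ.reg 2 + v * P.n + w) = P.natEdge v w)
    (hM : MatrixAt N (fun v w => S.edge v w) σ) :
    Spec fillRows σ (P.n * (P.n * 20 + 24) + 6) (fun τ => τ.reg 2 = σ.reg 2 + P.n * P.n ∧
      τ.reg 9 = (S.N + P.n : ℕ) * N ∧ MatrixAt N (fun v w => (S.append g P).edge v w) τ) := by
  set F : ℕ → ℕ → ℕ → ℕ → ℤ := fun i j v w =>
    if v < S.N + i ∨ (v = S.N + i ∧ w < S.N + j) then ((S.append g P).edge v w : ℤ)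
    else S.edge v w with hFdef
  have hold : ∀ v w, v < S.N ∨ w < S.N →
      ((S.append g P).edge v w : ℤ) = S.edge v w := by
    intro v w h
    by_cases hv : v < S.N
    · rw [Merged.append_edge_old S g P hv w hS]
    · have hz : S.edge v w = 0 := by
        by_contra h'
        exact hv (hS.edge_ne v w h').1
      obtain ⟨u, rfl⟩ := Nat.exists_eq_add_of_le (not_lt.1 hv)
      rw [Merged.append_edge_new_old S g P (by omega), hz]
  have hnew : ∀ v w, ¬ (v < S.N + P.n ∧ w < S.N + P.n) → (S.append g P).edge v w = 0 := by
    intro v w h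
    by_contra h'
    have := (hS.append g P).edge_ne v w h'
    exact h ⟨this.1, this.2.1⟩
  refine Spec.mono (B := P.n * ((P.n * (12 + 8) + 6) + 4 + 8) + 6) (R := fun τ =>
    τ.reg 2 = σ.reg 2 + P.n * P.n ∧ τ.reg 9 = (S.N + P.n : ℕ) * N ∧ MatrixAt N (F P.n 0) τ) ?_
    (by nlinarith) ?_
  · refine Spec.forTo (fun i τ => τ.reg 2 = σ.reg 2 + i * P.n ∧ τ.reg 9 = (S.N + i : ℕ) * N ∧
      MatrixAt N (F i 0) τ) h4 (by decide) (by decide) ?_ ?_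
    · refine ⟨by simp, by simp [h9], fun v hv w hw => ?_⟩
      simp only [State.setReg_arr, hM v hv w hw, hFdef]
      split_ifs with h
      · exact (hold v w (by omega)).symm
      · rfl
    · rintro i hi τ hF hτ ⟨e2, e9, eM⟩
      have h0 := hF.2 0 (by decide)
      have e8 := (hF.1 8 (by decide)).trans h8
      have e4 := (hF.1 4 (by decide)).trans h4
      have e3 := (hF.1 3 (by decide)).trans h3
      refine Spec.seq (B₁ := P.n * (12 + 8) + 6) (B₂ := 4)
        (R₁ := fun ρ => ρ.reg 2 = σ.reg 2 + i * P.n + P.n ∧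
          MatrixAt N (F i P.n) ρ) ?_ ?_
      · refine Spec.forTo (N := P.n) (B := 12)
          (fun j ρ => ρ.reg 2 = σ.reg 2 + i * P.n + j ∧ MatrixAt N (F i j) ρ)
          e4 (by decide) (by decide) ?_ ?_
        · exact ⟨by simp [e2], eM⟩
        rintro j hj ρ hG hρ ⟨f2, fM⟩
        have g0 := (hG.2 0 (by decide)).trans h0
        have g8 := (hG.1 8 (by decide)).trans e8
        have g9 := (hG.1 9 (by decide)).trans e9
        refine Spec.of_flat rfl (by decide) ⟨?_, ?_⟩
        · simp [Prog.exec, Expr.eval, f2, add_assoc]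
        · intro v hv w hw
          have hidx : (v * N + w : ℤ) = (S.N + i : ℕ) * N + S.N + j ↔
              v = S.N + i ∧ w = S.N + j := by
            rw [← index_eq_iff hw (show S.N + j < N by omega)]
            push_cast
            rw [add_assoc ((S.N + i : ℤ) * N)]
          have hval : σ.arr 0 (ρ.reg 2) = (S.append g P).edge (S.N + i) (S.N + j) := by
            rw [f2, hin i hi j hj, Merged.append_edge_new]
          simp only [Prog.exec, Expr.eval, State.setReg_arr, State.setArr_arr, hρ, g9, g8, true_and,
            hidx, g0, hval, fM v hv w hw, hFdef]
          by_cases h : v = S.N + i ∧ w = S.N + j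
          · rw [if_pos h, if_pos (by omega), h.1, h.2]
          · rw [if_neg h]
            exact if_congr (by omega) rfl rfl
      · rintro ρ hG ⟨f2, fM⟩
        have g9 := (hG.1 9 (by decide)).trans e9
        have g3 := (hG.1 3 (by decide)).trans e3
        refine Spec.of_flat rfl (by decide) ⟨?_, ?_, ?_⟩
        · simp [Prog.exec, Expr.eval, f2]; ring
        · simp [Prog.exec, Expr.eval, g9, g3]; ring
        · intro v hv w hw
          have := fM v hv w hw
          simp only [Prog.exec, State.setReg_arr, this, hFdef]
          by_cases hw' : w < S.N
          · rw [hold v w (Or.inr hw'), ite_self, ite_self]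
          · by_cases hw'' : w < S.N + P.n
            · exact if_congr (by omega) rfl rfl
            · by_cases hv' : v < S.N
              · rw [hold v w (Or.inl hv'), ite_self, ite_self]
              · have h1 : S.edge v w = 0 := by
                  by_contra h'
                  exact hv' (hS.edge_ne v w h').1
                rw [hnew v w (by omega), h1, ite_self, ite_self]
  · rintro τ - ⟨e2, e9, eM⟩
    refine ⟨e2, e9, fun v hv w hw => ?_⟩
    rw [eM v hv w hw, hFdef]
    dsimp only
    split_ifs with h
    · rfl
    · by_cases hw' : w < S.N
      · exact (hold v w (Or.inr hw')).symm
      · have h1 : S.edge v w = 0 := by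
          by_contra h'
          have := (hS.edge_ne v w h').1
          omega
        rw [hnew v w (by omega), h1]

theorem spec_fillMarks {σ : State} {S : Merged} {g : Gen} {P : PowerCircuit} (hS : S.Valid)
    (h4 : σ.reg 4 = P.n) (h7 : σ.reg 7 = if g.isT then 1 else 0) (h8 : σ.reg 8 = S.N)
    (hin : ∀ v < P.n, σ.arr 0 (σ.reg 2 + v) = P.natMark v)
    (h10 : σ.reg 10 = ((List.range S.N).filter S.kind).length)
    (hmm : ∀ v : ℕ, σ.arr 3 v = S.mm v) (hdm : ∀ v : ℕ, σ.arr 4 v = S.dm v)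
    (hk : ∀ v : ℕ, σ.arr 5 v = if v < S.N ∧ S.kind v = true then 1 else 0) :
    Spec fillMarks σ (P.n * 36 + 6) (fun τ => τ.reg 2 = σ.reg 2 + P.n ∧
      τ.reg 8 = (S.N + P.n : ℕ) ∧
      τ.reg 10 = ((List.range (S.append g P).N).filter (S.append g P).kind).length ∧
      (∀ v : ℕ, τ.arr 3 v = (S.append g P).mm v) ∧ (∀ v : ℕ, τ.arr 4 v = (S.append g P).dm v) ∧
      ∀ v : ℕ, τ.arr 5 v = if v < (S.append g P).N ∧ (S.append g P).kind v = true then 1 else 0)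
    := by
  have hmm0 : ∀ v, S.N ≤ v → S.mm v = 0 := fun v hv => by
    by_contra h
    have := (hS.mm_ne v h).1
    omega
  have hdm0 : ∀ v, S.N ≤ v → S.dm v = 0 := fun v hv => by
    by_contra h
    have := (hS.dm_ne v h).1
    omega
  have hend : ∀ v, ¬ v < S.N + P.n → (S.append g P).mm v = 0 ∧ (S.append g P).dm v = 0 := by
    intro v hv
    constructor
    · by_contra h
      exact hv ((hS.append g P).mm_ne v h).1
    · by_contra h
      exact hv ((hS.append g P).dm_ne v h).1
  refine Spec.mono (B := P.n * (28 + 8) + 6) (R := fun τ => τ.reg 2 = σ.reg 2 + P.n ∧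
    τ.reg 8 = (S.N + P.n : ℕ) ∧
    τ.reg 10 = ((List.range (S.N + P.n)).filter (S.append g P).kind).length ∧
    (∀ v : ℕ, τ.arr 3 v = if v < S.N + P.n then ((S.append g P).mm v : ℤ) else 0) ∧
    (∀ v : ℕ, τ.arr 4 v = if v < S.N + P.n then ((S.append g P).dm v : ℤ) else 0) ∧
    ∀ v : ℕ, τ.arr 5 v = if v < S.N + P.n ∧ (S.append g P).kind v = true then 1 else 0) ?_
    (by omega) ?_
  · refine Spec.forTo (fun i τ => τ.reg 2 = σ.reg 2 + i ∧ τ.reg 8 = (S.N + i : ℕ) ∧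
      τ.reg 10 = ((List.range (S.N + i)).filter (S.append g P).kind).length ∧
      (∀ v : ℕ, τ.arr 3 v = if v < S.N + i then ((S.append g P).mm v : ℤ) else 0) ∧
      (∀ v : ℕ, τ.arr 4 v = if v < S.N + i then ((S.append g P).dm v : ℤ) else 0) ∧
      ∀ v : ℕ, τ.arr 5 v = if v < S.N + i ∧ (S.append g P).kind v = true then 1 else 0)
      h4 (by decide) (by decide) ?_ ?_
    · refine ⟨by simp, by simp [h8], ?_, fun v => ?_, fun v => ?_, fun v => ?_⟩
      · simp only [State.setReg_reg, h10, add_zero]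
        norm_num
        exact (Merged.length_filter_range_congr fun i hi => by simp [Merged.append, hi]).symm
      · simp only [State.setReg_arr, hmm, add_zero]
        split_ifs with h
        · simp [Merged.append, h]
        · simp [hmm0 v (by omega)]
      · simp only [State.setReg_arr, hdm, add_zero]
        split_ifs with h
        · simp [Merged.append, h]
        · simp [hdm0 v (by omega)]
      · simp only [State.setReg_arr, hk, add_zero]
        by_cases h : v < S.N <;> simp [Merged.append, h]
    · rintro i hi τ hF hτ ⟨e2, e8, e10, e3, e4, e5⟩
      have h0 := hF.2 0 (by decide)
      have e7 := (hF.1 7 (by decide)).trans h7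
      have hval : σ.arr 0 (τ.reg 2) = P.natMark i := by rw [e2, hin i hi]
      have hidx : ∀ v : ℕ, ((v : ℤ) = (S.N + i : ℕ)) ↔ v = S.N + i := fun v => by norm_cast
      refine Spec.of_flat rfl (by decide) ?_
      cases hg : g.isT
      · have hk : (S.append g P).kind (S.N + i) = false := by simp [Merged.append, hg]
        simp only [hg, Bool.false_eq_true, if_false] at e7
        refine ⟨?_, ?_, ?_, fun v => ?_, fun v => ?_, fun v => ?_⟩
        · simp [Prog.exec, Expr.eval, e7, e2]; ring
        · simp [Prog.exec, Expr.eval, e7, e8]; ring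
        · rw [← add_assoc, List.range_succ, List.filter_append]
          simp [Prog.exec, Expr.eval, e7, e10, hk]
        · simp only [Prog.exec, Expr.eval, e7, lt_irrefl, if_false, State.setReg_arr,
            State.setArr_arr, e8, h0, hval, hidx, true_and, e3]
          by_cases hv : v = S.N + i
          · subst hv
            simp [Merged.append, hg]
          · rw [if_neg hv]
            exact if_congr (by omega) rfl rfl
        · simp only [Prog.exec, Expr.eval, e7, lt_irrefl, if_false, State.setReg_arr,
            State.setArr_arr, e8, h0, hval, hidx, e4]
          by_cases hv : v = S.N + i
          · subst hv
            simp [Merged.append, hg]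
          · norm_num
            exact if_congr (by omega) rfl rfl
        · simp only [Prog.exec, Expr.eval, e7, lt_irrefl, if_false, State.setReg_arr,
            State.setArr_arr, e8, h0, hval, hidx, e5]
          by_cases hv : v = S.N + i
          · subst hv
            simp [hk]
          · norm_num
            exact if_congr (and_congr_left fun _ => by omega) rfl rfl
      · have hk : (S.append g P).kind (S.N + i) = true := by simp [Merged.append, hg]
        simp only [hg, if_true] at e7
        refine ⟨?_, ?_, ?_, fun v => ?_, fun v => ?_, fun v => ?_⟩
        · simp [Prog.exec, Expr.eval, e7, e2]; ring
        · simp [Prog.exec, Expr.eval, e7, e8]; ring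
        · rw [← add_assoc, List.range_succ, List.filter_append]
          simp [Prog.exec, Expr.eval, e7, e10, hk]
        · simp only [Prog.exec, Expr.eval, e7, zero_lt_one, if_true, State.setReg_arr,
            State.setReg_reg, State.setArr_reg, State.setArr_arr, e8, h0, hval, hidx, e3]
          by_cases hv : v = S.N + i
          · subst hv
            simp [Merged.append, hg]
          · norm_num
            exact if_congr (by omega) rfl rfl
        · simp only [Prog.exec, Expr.eval, e7, zero_lt_one, if_true, State.setReg_arr,
            State.setReg_reg, State.setArr_reg, State.setArr_arr, e8, h0, hval, hidx, e4]
          by_cases hv : v = S.N + i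
          · subst hv
            simp [Merged.append, hg]
          · norm_num [hv]
            exact if_congr (by omega) rfl rfl
        · simp only [Prog.exec, Expr.eval, e7, zero_lt_one, if_true, State.setReg_arr,
            State.setReg_reg, State.setArr_reg, State.setArr_arr, e8, h0, hval, hidx, e5]
          by_cases hv : v = S.N + i
          · subst hv
            simp [hk]
          · norm_num [hv]
            exact if_congr (and_congr_left fun _ => by omega) rfl rfl
  · rintro τ - ⟨e2, e8, e10, e3, e4, e5⟩
    refine ⟨e2, e8, e10, fun v => ?_, fun v => ?_, e5⟩
    · rw [e3]
      split_ifs with h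
      · rfl
      · simp [(hend v h).1]
    · rw [e4]
      split_ifs with h
      · rfl
      · simp [(hend v h).2]

theorem spec_fillBody {σ : State} {N : ℕ} {S : Merged} {q : Gen × PowerCircuit}
    {s : PowerSequence Gen} (hS : S.Valid) (hN : S.N + q.2.n ≤ N) (h3 : σ.reg 3 = N)
    (h7 : σ.reg 7 = if q.1.isT then 1 else 0) (hU : UnionAt N S σ)
    (hin : SeqAt (σ.arr 0) (σ.reg 2) (q :: s)) :
    Spec fillBody σ (20 * (q.2.n * q.2.n) + 60 * q.2.n + 40) (fun τ => τ.reg 1 = σ.reg 1 - 1 ∧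
      τ.reg 7 = 1 - σ.reg 7 ∧ UnionAt N (S.append q.1 q.2) τ ∧ SeqAt (τ.arr 0) (τ.reg 2) s) := by
  obtain ⟨hn, hedge, hmark, hs⟩ := hin
  refine Spec.mono (B := 3 + (4 + ((q.2.n * (q.2.n * 20 + 24) + 6) + ((q.2.n * 36 + 6) + 8))))
    (R := _) ?_ (by nlinarith) (fun _ _ h => h)
  refine spec_flat_seq rfl (by decide) (spec_flat_seq rfl (by decide) ?_)
  refine Spec.seq (spec_fillRows (g := q.1) hS hN ?_ ?_ ?_ ?_ ?_ ?_) ?_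
  · simp [Prog.exec, h3]
  · simp [Prog.exec, Expr.eval, hn]
  · simp [Prog.exec, hU.base]
  · simp [Prog.exec, hU.row]
  · intro v hv w hw
    simpa [Prog.exec, Expr.eval] using hedge v hv w hw
  · exact hU.edge
  · rintro τ hF ⟨e2, e9, eM⟩
    have h4 : τ.reg 4 = q.2.n := by rw [hF.1 4 (by decide)]; simp [Prog.exec, Expr.eval, hn]
    have h1 : τ.reg 1 = σ.reg 1 := by rw [hF.1 1 (by decide)]; simp [Prog.exec]
    have h7' : τ.reg 7 = σ.reg 7 := by rw [hF.1 7 (by decide)]; simp [Prog.exec]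
    have h8 : τ.reg 8 = S.N := by rw [hF.1 8 (by decide)]; simp [Prog.exec, hU.base]
    have h10 : τ.reg 10 = σ.reg 10 := by rw [hF.1 10 (by decide)]; simp [Prog.exec]
    have a0 : τ.arr 0 = σ.arr 0 := by rw [hF.2 0 (by decide)]; simp [Prog.exec]
    have a3 : τ.arr 3 = σ.arr 3 := by rw [hF.2 3 (by decide)]; simp [Prog.exec]
    have a4 : τ.arr 4 = σ.arr 4 := by rw [hF.2 4 (by decide)]; simp [Prog.exec]
    have a5 : τ.arr 5 = σ.arr 5 := by rw [hF.2 5 (by decide)]; simp [Prog.exec]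
    have e2' : τ.reg 2 = σ.reg 2 + 1 + q.2.n * q.2.n := by
      rw [e2]; simp [Prog.exec, Expr.eval]
    refine Spec.seq (spec_fillMarks (g := q.1) hS h4 (h7'.trans h7) h8 ?_ (h10.trans hU.count)
      (by rw [a3]; exact hU.mm) (by rw [a4]; exact hU.dm) (by rw [a5]; exact hU.kind)) ?_
    · intro v hv
      rw [a0, e2']
      exact hmark v hv
    · rintro ρ hG ⟨f2, f8, f10, f3, f4, f5⟩
      have b0 : ρ.arr 0 = σ.arr 0 := (hG.2 0 (by decide)).trans a0
      have b2 : ρ.arr 2 = τ.arr 2 := hG.2 2 (by decide)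
      have b1 := (hG.1 1 (by decide)).trans h1
      have b7 := (hG.1 7 (by decide)).trans h7'
      have b9 := (hG.1 9 (by decide)).trans e9
      refine Spec.of_flat rfl (by decide) ⟨?_, ?_, ⟨?_, ?_, ?_, ?_, f3, f4, f5⟩, ?_⟩
      · simp [Prog.exec, Expr.eval, b1]
      · simp [Prog.exec, Expr.eval, b7]
      · exact f8
      · exact b9
      · simpa [Prog.exec] using f10
      · intro v hv w hw
        rw [← eM v hv w hw, ← b2]
        rfl
      · have : ((.assign 7 (.sub (.lit 1) (.reg 7)) ;; .assign 1 (.sub (.reg 1) (.lit 1))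
            : Prog).exec ρ).reg 2 = ρ.reg 2 := by simp [Prog.exec]
        rw [this, f2, e2']
        change SeqAt (ρ.arr 0) _ s
        rw [b0]
        exact hs

theorem spec_fill {σ : State} {N : ℕ} {s : PowerSequence Gen} {b : Bool} {S : Merged}
    (hS : S.Valid) (hN : (s.foldl (fun S q => S.append q.1 q.2) S).N = N)
    (hb : Alternates b s) (h1 : σ.reg 1 = s.length)
    (h3 : σ.reg 3 = N) (h7 : σ.reg 7 = if b then 1 else 0)
    (hU : UnionAt N S σ) (hin : SeqAt (σ.arr 0) (σ.reg 2) s) :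
    Spec (.loop (.reg 1) fillBody) σ
      ((s.map fun q => 20 * (q.2.n * q.2.n) + 60 * q.2.n + 40 + 2).sum + 2)
      (UnionAt N (s.foldl (fun S q => S.append q.1 q.2) S)) := by
  refine (spec_loop_seq (p := fillBody) (fun s' τ => ∃ (S' : Merged) (b' : Bool), S'.Valid ∧
    s'.foldl (fun S q => S.append q.1 q.2) S' = s.foldl (fun S q => S.append q.1 q.2) S ∧
    Alternates b' s' ∧ τ.reg 3 = N ∧ τ.reg 7 = (if b' then 1 else 0) ∧ UnionAt N S' τ ∧
    SeqAt (τ.arr 0) (τ.reg 2) s') (fun q => 20 * (q.2.n * q.2.n) + 60 * q.2.n + 40) ?_ s σ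
    ⟨S, b, hS, rfl, hb, h3, h7, hU, hin⟩ h1).mono le_rfl ?_
  · rintro q s' τ ⟨S', b', hS', hfold, ⟨hq, hb'⟩, e3, e7, eU, ein⟩
    have hle : S'.N + q.2.n ≤ N := by
      rw [← hN, ← hfold, List.foldl_cons]
      generalize hS'' : S'.append q.1 q.2 = S''
      have : S'.N + q.2.n = S''.N := by rw [← hS'']; rfl
      rw [this]
      clear hb' ein hfold this hS''
      induction s' generalizing S'' with
      | nil => exact le_rfl
      | cons q s' ih => exact (Nat.le_add_right _ _).trans (ih (S''.append q.1 q.2))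
    refine (spec_fillBody (s := s') hS' hle e3 (by rw [e7, hq]) eU ein).mono le_rfl ?_
    rintro ρ hF ⟨f1, f7, fU, fin⟩
    refine ⟨⟨_, !b', hS'.append q.1 q.2, hfold, hb', (hF.1 3 (by decide)).trans e3, ?_, fU, fin⟩,
      f1⟩
    rw [f7, e7]
    cases b' <;> rfl
  · rintro τ - ⟨S', b', -, hfold, -, -, -, eU, -⟩
    rw [← hfold]
    exact eU

/-! ### One round of the computation of the weights -/

/-- Compute the exponents of all vertices, in array `6`, from the weights in array `7`. The
exponent of a vertex without successors is set to `-1`. -/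
def expoProg : Prog :=
  .assign 9 (.lit 0) ;;
  .forTo 5 3 (.assign 32 (.lit 0) ;; .assign 33 (.lit 0) ;;
    .forTo 6 3 (.assign 34 (.get 2 (.add (.reg 9) (.reg 6))) ;;
      .ite (.reg 34) (.assign 32 (.add (.reg 32) (.get 7 (.reg 6))) ;; .assign 33 (.lit 1))
        (.ite (.sub (.lit 0) (.reg 34))
          (.assign 32 (.sub (.reg 32) (.get 7 (.reg 6))) ;; .assign 33 (.lit 1)) .skip)) ;;
    .ite (.reg 33) (.store 6 (.reg 5) (.reg 32)) (.store 6 (.reg 5) (.lit (-1))) ;;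
    .assign 9 (.add (.reg 9) (.reg 3)))

theorem spec_expoProg {σ : State} {N : ℕ} {f : ℕ → ℕ → SignType} (h3 : σ.reg 3 = N)
    (hM : MatrixAt N (fun v w => f v w) σ) :
    Spec expoProg σ (N * (N * 28 + 28) + 8) (fun τ =>
      (∀ v < N, (∀ w < N, f v w = 0) → τ.arr 6 v = -1) ∧
      ∀ v < N, ¬ (∀ w < N, f v w = 0) →
        τ.arr 6 v = ∑ w ∈ Finset.range N, (f v w : ℤ) * σ.arr 7 w) := by
  refine Spec.mono (B := 2 + (N * ((2 + (2 + ((N * (20 + 8) + 6) + (5 + 4)))) + 8) + 6))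
    (R := fun τ => τ.reg 9 = N * N ∧ (∀ v < N, (∀ w < N, f v w = 0) → τ.arr 6 v = -1) ∧
      ∀ v < N, ¬ (∀ w < N, f v w = 0) →
        τ.arr 6 v = ∑ w ∈ Finset.range N, (f v w : ℤ) * σ.arr 7 w) ?_ (by nlinarith)
    (fun τ _ h => h.2)
  refine spec_flat_seq rfl (by decide) ?_
  refine Spec.forTo (B := 2 + (2 + ((N * (20 + 8) + 6) + (5 + 4)))) (fun i τ => τ.reg 9 = i * N ∧
    (∀ v < i, (∀ w < N, f v w = 0) → τ.arr 6 v = -1) ∧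
      ∀ v < i, ¬ (∀ w < N, f v w = 0) →
        τ.arr 6 v = ∑ w ∈ Finset.range N, (f v w : ℤ) * σ.arr 7 w) ?_ (by decide) (by decide) ?_ ?_
  · simp [Prog.exec, h3]
  · simp [Prog.exec, Expr.eval]
  rintro i hi τ hF hτ ⟨e9, eleaf, enode⟩
  have e3 : τ.reg 3 = N := by rw [hF.1 3 (by decide)]; simp [Prog.exec, h3]
  have a2 : τ.arr 2 = σ.arr 2 := by rw [hF.2 2 (by decide)]; simp [Prog.exec]
  have a7 : τ.arr 7 = σ.arr 7 := by rw [hF.2 7 (by decide)]; simp [Prog.exec]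
  refine spec_flat_seq rfl (by decide) (spec_flat_seq rfl (by decide) ?_)
  refine Spec.seq (B₁ := N * (20 + 8) + 6) (B₂ := 5 + 4) (R₁ := fun ρ =>
    ρ.reg 32 = ∑ w ∈ Finset.range N, (f i w : ℤ) * σ.arr 7 w ∧
    ((ρ.reg 33 = 0 ∧ ∀ w < N, f i w = 0) ∨ (ρ.reg 33 = 1 ∧ ∃ w < N, f i w ≠ 0))) ?_ ?_
  · refine Spec.forTo (N := N) (B := 20) (fun j ρ =>
      ρ.reg 32 = ∑ w ∈ Finset.range j, (f i w : ℤ) * σ.arr 7 w ∧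
      ((ρ.reg 33 = 0 ∧ ∀ w < j, f i w = 0) ∨ (ρ.reg 33 = 1 ∧ ∃ w < j, f i w ≠ 0)))
      ?_ (by decide) (by decide) ?_ ?_
    · simp [Prog.exec, e3]
    · simp [Prog.exec, Expr.eval]
    · rintro j hj ρ hG hρ ⟨f32, f33⟩
      have g9 : ρ.reg 9 = i * N := by rw [hG.1 9 (by decide)]; simp [Prog.exec, e9]
      have b2 : ρ.arr 2 = σ.arr 2 := by rw [hG.2 2 (by decide)]; simp [Prog.exec, a2]
      have b7 : ρ.arr 7 = σ.arr 7 := by rw [hG.2 7 (by decide)]; simp [Prog.exec, a7]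
      have hval : σ.arr 2 (i * N + j) = f i j := hM i hi j hj
      refine Spec.of_flat rfl (by decide) ?_
      rw [Finset.sum_range_succ]
      have hsucc : ∀ {p : ℕ → Prop}, (∀ w < j + 1, p w) ↔ (∀ w < j, p w) ∧ p j := fun {p} =>
        ⟨fun h => ⟨fun w hw => h w (by omega), h j (by omega)⟩, fun h w hw => by
          rcases Nat.lt_succ_iff_lt_or_eq.1 hw with hw | rfl
          exacts [h.1 w hw, h.2]⟩
      rcases hs : f i j with _ | _ | _
      · simp only [hs, SignType.zero_eq_zero, SignType.coe_zero] at hval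
        simp only [Prog.exec, Expr.eval, State.setReg_arr, State.setReg_reg, g9, hρ, b2, hval]
        simp only [hsucc, hs]
        refine ⟨by simp [f32], ?_⟩
        rcases f33 with ⟨h1, h2⟩ | ⟨h1, w, hw, h2⟩
        · left; simp [h1]; exact h2
        · right; simp [h1]; exact ⟨w, by omega, h2⟩
      · simp only [hs, SignType.neg_eq_neg_one, SignType.coe_neg_one] at hval
        simp only [Prog.exec, Expr.eval, State.setReg_arr, State.setReg_reg, g9, hρ, b2, b7, hval]
        exact ⟨by simp [f32]; ring, Or.inr ⟨by simp, j, by omega, by rw [hs]; decide⟩⟩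
      · simp only [hs, SignType.pos_eq_one, SignType.coe_one] at hval
        simp only [Prog.exec, Expr.eval, State.setReg_arr, State.setReg_reg, g9, hρ, b2, b7, hval]
        exact ⟨by simp [f32], Or.inr ⟨by simp, j, by omega, by rw [hs]; decide⟩⟩
  · rintro ρ hG ⟨f32, f33⟩
    have g9 : ρ.reg 9 = i * N := by rw [hG.1 9 (by decide)]; simp [Prog.exec, e9]
    have g3 : ρ.reg 3 = N := by rw [hG.1 3 (by decide)]; simp [Prog.exec, e3]
    have g5 : ρ.reg 5 = i := by rw [hG.1 5 (by decide)]; simp [Prog.exec, hτ]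
    have b6 : ρ.arr 6 = τ.arr 6 := by rw [hG.2 6 (by decide)]; simp [Prog.exec]
    refine Spec.of_flat rfl (by decide) ?_
    rcases f33 with ⟨h1, h2⟩ | ⟨h1, h2⟩
    · simp only [Prog.exec, Expr.eval, h1, lt_irrefl, if_false, State.setReg_arr,
        State.setReg_reg, State.setArr_reg, State.setArr_arr, g9, g3, g5, b6, Nat.cast_inj]
      refine ⟨by simp; ring, fun v hv hl => ?_, fun v hv hl => ?_⟩
      · by_cases hvi : v = i
        · simp [hvi]
        · simp [hvi, eleaf v (by omega) hl]
      · by_cases hvi : v = i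
        · subst hvi; exact absurd h2 hl
        · simp [hvi, enode v (by omega) hl]
    · simp only [Prog.exec, Expr.eval, h1, zero_lt_one, if_true, State.setReg_arr,
        State.setReg_reg, State.setArr_reg, State.setArr_arr, g9, g3, g5, b6, Nat.cast_inj]
      refine ⟨by simp; ring, fun v hv hl => ?_, fun v hv hl => ?_⟩
      · by_cases hvi : v = i
        · subst hvi
          obtain ⟨w, hw, h2⟩ := h2
          exact absurd (hl w hw) h2
        · simp [hvi, eleaf v (by omega) hl]
      · by_cases hvi : v = i
        · simp [hvi, f32]
        · simp [hvi, enode v (by omega) hl]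

/-- Find the least exponent, in array `6`, that is not less than register `14`. -/
def findProg : Prog :=
  .assign 19 (.lit 0) ;;
  .forTo 18 12 (.ite (.add (.sub (.get 6 (.reg 18)) (.reg 14)) (.lit 1))
    (.ite (.reg 19)
      (.ite (.sub (.reg 20) (.get 6 (.reg 18))) (.assign 20 (.get 6 (.reg 18))) .skip)
      (.assign 20 (.get 6 (.reg 18)) ;; .assign 19 (.lit 1))) .skip)

theorem spec_findProg {σ : State} {n : ℕ} (h12 : σ.reg 12 = n) :
    Spec findProg σ (n * 38 + 8) (fun τ =>
      (τ.reg 19 = 0 ∧ ∀ i < n, σ.arr 6 i < σ.reg 14) ∨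
      (τ.reg 19 = 1 ∧ σ.reg 14 ≤ τ.reg 20 ∧ (∃ i < n, σ.arr 6 i = τ.reg 20) ∧
        ∀ i < n, σ.reg 14 ≤ σ.arr 6 i → τ.reg 20 ≤ σ.arr 6 i)) := by
  refine Spec.mono (B := 2 + (n * (30 + 8) + 6)) (R := _) ?_ (by omega) (fun _ _ h => h)
  refine spec_flat_seq rfl (by decide) ?_
  refine Spec.forTo (fun j τ =>
      (τ.reg 19 = 0 ∧ ∀ i < j, σ.arr 6 i < σ.reg 14) ∨
      (τ.reg 19 = 1 ∧ σ.reg 14 ≤ τ.reg 20 ∧ (∃ i < j, σ.arr 6 i = τ.reg 20) ∧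
        ∀ i < j, σ.reg 14 ≤ σ.arr 6 i → τ.reg 20 ≤ σ.arr 6 i)) ?_ (by decide) (by decide) ?_ ?_
  · simp [Prog.exec, h12]
  · left; simp [Prog.exec, Expr.eval]
  rintro j hj τ hF hτ hI
  have h14 : τ.reg 14 = σ.reg 14 := by rw [hF.1 14 (by decide)]; simp [Prog.exec]
  have a6 : τ.arr 6 = σ.arr 6 := by rw [hF.2 6 (by decide)]; simp [Prog.exec]
  have hsucc : ∀ {p : ℕ → Prop}, (∀ w < j, p w) → p j → ∀ w < j + 1, p w := fun {p} h h' w hw => by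
    rcases Nat.lt_succ_iff_lt_or_eq.1 hw with hw | rfl
    exacts [h w hw, h']
  refine Spec.of_flat rfl (by decide) ?_
  simp only [Prog.exec, Expr.eval, hτ, a6, h14]
  by_cases h1 : 0 < σ.arr 6 j - σ.reg 14 + 1
  · rw [if_pos h1]
    rcases hI with ⟨h19, hlt⟩ | ⟨h19, hle, ⟨i, hi, hbest⟩, hmin⟩
    · right
      rw [h19, if_neg (lt_irrefl _)]
      refine ⟨by simp, by simp; omega, ⟨j, by omega, by simp⟩, ?_⟩
      refine hsucc (fun i hi hi' => ?_) (fun _ => by simp)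
      have := hlt i hi
      omega
    · right
      rw [h19, if_pos zero_lt_one]
      split_ifs with h2
      · refine ⟨by simp [h19], by simp; omega, ⟨j, by omega, by simp⟩, ?_⟩
        refine hsucc (fun i hi hi' => ?_) (fun _ => by simp)
        have := hmin i hi hi'
        simp; omega
      · refine ⟨by simp [h19], by simpa using hle, ⟨i, by omega, by simpa using hbest⟩, ?_⟩
        refine hsucc (fun i hi hi' => by simpa using hmin i hi hi') (fun _ => by simp; omega)
  · rw [if_neg h1]
    rcases hI with ⟨h19, hlt⟩ | ⟨h19, hle, ⟨i, hi, hbest⟩, hmin⟩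
    · left
      exact ⟨by simp [h19], hsucc hlt (by omega)⟩
    · right
      refine ⟨by simp [h19], by simpa using hle, ⟨i, by omega, by simpa using hbest⟩, ?_⟩
      exact hsucc (fun i hi hi' => by simpa using hmin i hi hi') (fun h => by omega)

/-- Double the weight in register `16` as often as the gap between the registers `15` and `20`
says, but at most as often as register `11` says. -/
def doubleProg : Prog :=
  .forTo 21 11 (.ite (.sub (.sub (.reg 20) (.reg 15)) (.reg 21))
    (.assign 16 (.add (.reg 16) (.reg 16))) .skip)

theorem spec_doubleProg {σ : State} {c g : ℕ} (h11 : σ.reg 11 = c)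
    (hg : σ.reg 20 - σ.reg 15 = g) :
    Spec doubleProg σ (c * 20 + 6) (fun τ => τ.reg 16 = σ.reg 16 * 2 ^ min g c) := by
  refine Spec.mono (B := c * (12 + 8) + 6) (R := _) ?_ (by omega) (fun _ _ h => h)
  refine Spec.forTo (fun j τ => τ.reg 16 = σ.reg 16 * 2 ^ min g j) h11 (by decide) (by decide)
    (by simp) ?_
  rintro j hj τ hF hτ hI
  have h20 := hF.1 20 (by decide)
  have h15 := hF.1 15 (by decide)
  refine Spec.of_flat rfl (by decide) ?_
  simp only [Prog.exec, Expr.eval, hτ, h20, h15, hg]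
  split_ifs with h
  · have : min g (j + 1) = min g j + 1 := by omega
    simp only [State.setReg_reg, this, pow_succ]
    simp [hI]
    ring
  · have : min g (j + 1) = min g j := by omega
    simp [this, hI]

/-- Store the weight in register `16` for all vertices whose exponent is in register `20`. -/
def storeProg : Prog :=
  .forTo 18 12 (.ite (.sub (.get 6 (.reg 18)) (.reg 20)) .skip
    (.ite (.sub (.reg 20) (.get 6 (.reg 18))) .skip (.store 7 (.reg 18) (.reg 16))))

theorem spec_storeProg {σ : State} {n : ℕ} (h12 : σ.reg 12 = n) :
    Spec storeProg σ (n * 28 + 6) (fun τ => ∀ i < n, τ.arr 7 i =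
      if σ.arr 6 i = σ.reg 20 then σ.reg 16 else σ.arr 7 i) := by
  refine Spec.mono (B := n * (20 + 8) + 6) (R := fun τ => ∀ i : ℕ, τ.arr 7 i =
      if i < n ∧ σ.arr 6 i = σ.reg 20 then σ.reg 16 else σ.arr 7 i) ?_ (by omega)
      (fun _ _ h i hi => by rw [h]; simp [hi])
  refine Spec.forTo (fun j τ => ∀ i : ℕ, τ.arr 7 i =
      if i < j ∧ σ.arr 6 i = σ.reg 20 then σ.reg 16 else σ.arr 7 i) h12 (by decide) (by decide)
    (by simp) ?_
  rintro j hj τ hF hτ hI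
  have h20 := hF.1 20 (by decide)
  have h16 := hF.1 16 (by decide)
  have a6 := hF.2 6 (by decide)
  refine Spec.of_flat rfl (by decide) ?_
  intro i
  simp only [Prog.exec, Expr.eval, hτ, h20, h16, a6]
  by_cases hij : i = j
  · subst hij
    by_cases he : σ.arr 6 i = σ.reg 20
    · simp [he]
    · have : 0 < σ.arr 6 i - σ.reg 20 ∨ 0 < σ.reg 20 - σ.arr 6 i := by omega
      rcases this with h | h
      · rw [if_pos h]
        simp [hI, he]
      · rw [if_neg (by omega), if_pos h]
        simp [hI, he]
  · have h1 : (if i < j + 1 ∧ σ.arr 6 i = σ.reg 20 then σ.reg 16 else σ.arr 7 i) = τ.arr 7 i := by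
      rw [hI]
      exact if_congr (and_congr_left fun _ => by omega) rfl rfl
    rw [h1]
    split_ifs <;> simp [hij]

/-- Compute the weights, in array `7`, of the exponents in array `6`: the exponents are visited in
increasing order, and every gap between consecutive exponents is cut down to the number in register
`11`. -/
def passProg : Prog :=
  .forTo 18 12 (.store 7 (.reg 18) (.lit 0)) ;;
  .assign 14 (.lit 0) ;; .assign 15 (.lit 0) ;; .assign 16 (.lit 1) ;;
  .forTo 17 12 (findProg ;; .ite (.reg 19) (doubleProg ;; storeProg ;; .assign 15 (.reg 20) ;;
    .assign 14 (.add (.reg 20) (.lit 1))) .skip)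

/-- The invariant of the computation of the weights: the exponents less than register `14` have
been treated, the greatest of them is in register `15`, and its weight in register `16`. -/
def PassInv (L n : ℕ) (X : ℕ → ℤ) (σ : State) : Prop :=
  ∃ y : ℤ → ℕ, y 0 = 0 ∧ 0 ≤ σ.reg 15 ∧ σ.reg 15 ≤ σ.reg 14 ∧ σ.reg 16 = 2 ^ y (σ.reg 15) ∧
    σ.reg 15 ∈ insert 0 {u | (∃ i < n, X i = u ∧ 0 ≤ u) ∧ u < σ.reg 14} ∧
    (∀ u ∈ insert 0 {u | (∃ i < n, X i = u ∧ 0 ≤ u) ∧ u < σ.reg 14}, u ≤ σ.reg 15) ∧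
    (∀ u ∈ insert 0 {u | (∃ i < n, X i = u ∧ 0 ≤ u) ∧ u < σ.reg 14},
      ∀ v ∈ insert 0 {u | (∃ i < n, X i = u ∧ 0 ≤ u) ∧ u < σ.reg 14},
        Agree L (u - v) (y u - y v)) ∧
    ∀ i < n, σ.arr 7 i = if 0 ≤ X i ∧ X i < σ.reg 14 then 2 ^ y (X i) else 0

/-- If `b` is the least exponent that has not been treated, at a distance `g` from the last one that
has, then its compressed place is at the distance `min g (L + 1)` from that of the last one. -/
theorem PassInv.step {L n : ℕ} {X : ℕ → ℤ} {σ τ : State} {b : ℤ} {g : ℕ}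
    (h : PassInv L n X σ) (hb : σ.reg 14 ≤ b) (hbX : ∃ i < n, X i = b)
    (hmin : ∀ i < n, σ.reg 14 ≤ X i → b ≤ X i) (hg : b - σ.reg 15 = g) (h14 : τ.reg 14 = b + 1)
    (h15 : τ.reg 15 = b) (h16 : τ.reg 16 = σ.reg 16 * 2 ^ min g (L + 1))
    (h7 : ∀ i < n, τ.arr 7 i = if X i = b then τ.reg 16 else σ.arr 7 i) : PassInv L n X τ := by
  obtain ⟨y, hy0, hc0, hc, hw, hcD, hmax, hy, hW⟩ := h
  have hsub : ∀ u, u ∈ insert 0 {u | (∃ i < n, X i = u ∧ 0 ≤ u) ∧ u < τ.reg 14} →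
      u = b ∨ u ∈ insert 0 {u | (∃ i < n, X i = u ∧ 0 ≤ u) ∧ u < σ.reg 14} := by
    rintro u (rfl | ⟨⟨i, hi, rfl, hu⟩, hu'⟩)
    · exact Or.inr (Or.inl rfl)
    · by_cases h : σ.reg 14 ≤ X i
      · have := hmin i hi h
        left; omega
      · exact Or.inr (Or.inr ⟨⟨i, hi, rfl, hu⟩, by omega⟩)
  -- If `b` is the old point in register `15`, both are `0`, and the value at `b` does not change.
  have hyb : b ∈ insert 0 {u | (∃ i < n, X i = u ∧ 0 ≤ u) ∧ u < σ.reg 14} →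
      y b = y (σ.reg 15) + min g (L + 1) := by
    intro hbD
    have := hmax b hbD
    have h1 : b = σ.reg 15 := by omega
    have h2 : g = 0 := by omega
    rw [h1, h2]
    simp
  set y' : ℤ → ℕ := Function.update y b (y (σ.reg 15) + min g (L + 1)) with hy'
  have hold : ∀ u ∈ insert 0 {u | (∃ i < n, X i = u ∧ 0 ≤ u) ∧ u < σ.reg 14}, y' u = y u := by
    intro u hu
    by_cases hub : u = b
    · subst hub
      rw [hy', Function.update_self, hyb hu]
    · rw [hy', Function.update_of_ne hub]
  have hnew : y' b = y (σ.reg 15) + min g (L + 1) := Function.update_self _ _ _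
  have hagree : ∀ u ∈ insert 0 {u | (∃ i < n, X i = u ∧ 0 ≤ u) ∧ u < σ.reg 14},
      Agree L (b - u) (y' b - y' u) := by
    intro u hu
    have h1 := hy _ hcD u hu
    have h2 := hmax u hu
    rw [hold u hu, hnew]
    unfold Agree at *
    omega
  refine ⟨y', ?_, by omega, by omega, ?_, ?_, ?_, ?_, ?_⟩
  · rw [hold 0 (Or.inl rfl), hy0]
  · rw [h16, h15, hnew, pow_add, hw]
  · obtain ⟨i, hi, hib⟩ := hbX
    exact Or.inr ⟨⟨i, hi, by omega, by omega⟩, by omega⟩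
  · intro u hu
    rcases hsub u hu with rfl | hu
    · exact h15.ge
    · have := hmax u hu
      omega
  · intro u hu v hv
    rcases hsub u hu with rfl | hu <;> rcases hsub v hv with rfl | hv
    · simp [Agree.refl]
    · exact hagree v hv
    · have := (hagree u hu).neg
      rwa [neg_sub, neg_sub] at this
    · rw [hold u hu, hold v hv]
      exact hy u hu v hv
  · intro i hi
    rw [h7 i hi, h16, hw, ← pow_add, ← hnew]
    by_cases hib : X i = b
    · rw [if_pos hib, if_pos (by omega), hib]
    · rw [if_neg hib, hW i hi]
      by_cases h : 0 ≤ X i ∧ X i < σ.reg 14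
      · rw [if_pos h, if_pos (by omega), hold _ (Or.inr ⟨⟨i, hi, rfl, h.1⟩, h.2⟩)]
      · rw [if_neg h, if_neg]
        intro h'
        have := hmin i hi (by omega)
        omega

/-- As many searches suffice as there are exponents: every search but an unsuccessful one reduces
the number of the indices whose exponents are still to be treated. -/
theorem spec_passProg {σ : State} {L n : ℕ} (h12 : σ.reg 12 = n) (h11 : σ.reg 11 = (L + 1 : ℕ)) :
    Spec passProg σ (n * (n * 84 + (L + 1) * 20 + 60) + 20)
      (fun τ => Weights L n (fun i => σ.arr 6 i) (fun i => τ.arr 7 i)) := by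
  classical
  refine Spec.mono (B := (n * (10 + 8) + 6) + (2 + (2 + (2 + (n * ((n * 38 + 8) +
    ((1 + 1) + (((L + 1) * 20 + 6) + ((n * 28 + 6) + 10))) + 8) + 6)))))
    (R := fun τ => PassInv L n (fun i => σ.arr 6 i) τ ∧
      ((Finset.range n).filter fun i : ℕ => τ.reg 14 ≤ σ.arr 6 i).card + n ≤ n) ?_ (by nlinarith) ?_
  · refine Spec.seq (B₁ := n * (10 + 8) + 6) (R₁ := fun τ => ∀ i < n, τ.arr 7 i = 0) ?_ ?_
    · refine Spec.forTo (N := n) (B := 10) (fun j τ => ∀ i < j, τ.arr 7 i = 0) h12 (by decide)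
        (by decide) (by simp) ?_
      rintro j hj τ hF hτ hI
      refine Spec.of_flat rfl (by decide) ?_
      intro i hi
      simp only [Prog.exec, Expr.eval, hτ, State.setReg_arr, State.setArr_arr, true_and,
        Nat.cast_inj]
      split_ifs with h
      · rfl
      · exact hI i (by omega)
    intro τ hF h7
    refine spec_flat_seq rfl (by decide) (spec_flat_seq rfl (by decide)
      (spec_flat_seq rfl (by decide) ?_))
    refine Spec.forTo (N := n) (B := (n * 38 + 8) +
      ((1 + 1) + (((L + 1) * 20 + 6) + ((n * 28 + 6) + 10)))) (fun j τ =>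
      PassInv L n (fun i => σ.arr 6 i) τ ∧
      ((Finset.range n).filter fun i : ℕ => τ.reg 14 ≤ σ.arr 6 i).card + j ≤ n)
      ?_ (by decide) (by decide) ?_ ?_
    · have := hF.1 12 (by decide)
      simp [Prog.exec, this, h12]
    · refine ⟨⟨fun _ => 0, ?_⟩, ?_⟩
      · simp [Prog.exec, Expr.eval, Agree]
        intro i hi
        rw [h7 i hi, if_neg (by omega)]
      · simpa using Finset.card_filter_le (Finset.range n) _
    rintro j hj ρ hG hρ ⟨hI, hcard⟩
    have a6 : ρ.arr 6 = σ.arr 6 := by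
      rw [hG.2 6 (by decide)]
      exact hF.2 6 (by decide)
    have r12 : ρ.reg 12 = n := by
      rw [hG.1 12 (by decide), ← h12, ← hF.1 12 (by decide)]
      simp [Prog.exec]
    have r11 : ρ.reg 11 = (L + 1 : ℕ) := by
      rw [hG.1 11 (by decide), ← h11, ← hF.1 11 (by decide)]
      simp [Prog.exec]
    refine Spec.seq (spec_findProg r12) ?_
    rintro φ hφ hfind
    have p14 := hφ.1 14 (by decide)
    have p15 := hφ.1 15 (by decide)
    have p16 := hφ.1 16 (by decide)
    have p12 := (hφ.1 12 (by decide)).trans r12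
    have p11 := (hφ.1 11 (by decide)).trans r11
    have p6 : φ.arr 6 = σ.arr 6 := (hφ.2 6 (by decide)).trans a6
    have p7 := hφ.2 7 (by decide)
    rw [a6] at hfind
    refine Spec.ite ?_ ?_
    · intro h19
      rcases hfind with ⟨h, -⟩ | ⟨-, hle, hex, hmin⟩
      · simp [Expr.eval, h] at h19
      have hI' := hI
      obtain ⟨-, -, hc0, hc, -⟩ := hI'
      obtain ⟨g, hg⟩ := Int.eq_ofNat_of_zero_le (a := φ.reg 20 - φ.reg 15) (by omega)
      refine Spec.seq (spec_doubleProg p11 hg) ?_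
      intro ψ hψ h16
      have q12 := (hψ.1 12 (by decide)).trans p12
      have q20 := hψ.1 20 (by decide)
      have q6 : ψ.arr 6 = σ.arr 6 := (hψ.2 6 (by decide)).trans p6
      have q7 := hψ.2 7 (by decide)
      refine Spec.seq (spec_storeProg q12) ?_
      intro ω hω h7
      have s20 := (hω.1 20 (by decide)).trans q20
      have s16 := hω.1 16 (by decide)
      refine Spec.of_flat rfl (by decide) ⟨?_, ?_⟩
      · refine hI.step (b := φ.reg 20) (g := g) hle hex hmin ?_ ?_ ?_ ?_ ?_
        · rw [← hg, p15]
        · simp [Prog.exec, Expr.eval, s20]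
        · simp [Prog.exec, Expr.eval, s20]
        · simp only [Prog.exec, State.setReg_reg]
          simp [s16, h16, p16]
        · intro i hi
          have := h7 i hi
          rw [q6, q20, q7, p7] at this
          simp only [Prog.exec, State.setReg_reg, State.setReg_arr, this, s16]
          simp
      · have e14 : ((((Prog.assign 15 (.reg 20)) ;;
            .assign 14 (.add (.reg 20) (.lit 1))).exec ω).setReg 17 (j + 1)).reg 14 =
            φ.reg 20 + 1 := by
          simp [Prog.exec, Expr.eval, s20]
        have hlt : ((Finset.range n).filter fun i : ℕ => φ.reg 20 + 1 ≤ σ.arr 6 i).card <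
            ((Finset.range n).filter fun i : ℕ => ρ.reg 14 ≤ σ.arr 6 i).card := by
          obtain ⟨i, hi, hib⟩ := hex
          refine Finset.card_lt_card (Finset.ssubset_iff_of_subset ?_ |>.2 ⟨i, ?_, ?_⟩)
          · intro k hk
            simp only [Finset.mem_filter] at hk ⊢
            exact ⟨hk.1, by omega⟩
          · simp only [Finset.mem_filter, Finset.mem_range]
            exact ⟨hi, by omega⟩
          · simp only [Finset.mem_filter, Finset.mem_range]
            omega
        simp only [e14]
        omega
    · intro h19
      rcases hfind with ⟨-, hall⟩ | ⟨h, -⟩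
      · refine Spec.of_flat rfl (by simp only [Prog.time]; omega) ⟨?_, ?_⟩
        · obtain ⟨y, h⟩ := hI
          refine ⟨y, ?_⟩
          simpa [Prog.exec, p14, p15, p16, p7] using h
        · have hempty : ((Finset.range n).filter fun i : ℕ => ρ.reg 14 ≤ σ.arr 6 i) = ∅ := by
            refine Finset.filter_eq_empty_iff.2 fun i hi => ?_
            have := hall i (Finset.mem_range.1 hi)
            omega
          simp only [Prog.exec, State.setReg_reg, p14]
          norm_num
          rw [hempty]
          simp
          omega
      · simp [Expr.eval, h] at h19
  · rintro τ - ⟨⟨y, hy0, -, -, -, -, -, hy, hW⟩, hcard⟩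
    have hall : ∀ i < n, σ.arr 6 i < τ.reg 14 := by
      intro i hi
      by_contra h
      have : i ∈ ((Finset.range n).filter fun i : ℕ => τ.reg 14 ≤ σ.arr 6 i) := by
        simp only [Finset.mem_filter, Finset.mem_range]
        exact ⟨hi, by omega⟩
      have := Finset.card_pos.2 ⟨i, this⟩
      omega
    have hset : ∀ u, u ∈ insert 0 {u | ∃ i < n, σ.arr 6 i = u ∧ 0 ≤ u} →
        u ∈ insert 0 {u | (∃ i < n, σ.arr 6 i = u ∧ 0 ≤ u) ∧ u < τ.reg 14} := by
      rintro u (rfl | ⟨i, hi, rfl, hu⟩)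
      · exact Or.inl rfl
      · exact Or.inr ⟨⟨i, hi, rfl, hu⟩, hall i hi⟩
    refine ⟨y, ⟨hy0, fun u hu v hv => hy u (hset u hu) v (hset v hv)⟩, fun i hi => ?_⟩
    dsimp only at hW ⊢
    rw [hW i hi]
    have := hall i hi
    by_cases h : σ.arr 6 i < 0
    · rw [if_neg (by omega), if_pos h]
    · rw [if_pos (by omega), if_neg h]

/-- Compute surrogate values of all vertices, in array `7`. -/
def roundsProg : Prog := .forTo 22 3 (expoProg ;; passProg)

theorem spec_roundsProg {σ : State} {S : Merged} {L : ℕ} (hS : S.Valid)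
    (hL : 4 * (S.N : ℤ) ≤ 2 ^ L) (h3 : σ.reg 3 = S.N) (h12 : σ.reg 12 = S.N)
    (h11 : σ.reg 11 = (L + 1 : ℕ)) (hM : MatrixAt S.N (fun v w => S.edge v w) σ) :
    Spec roundsProg σ (S.N * (S.N * (S.N * 112 + (L + 1) * 20 + 88) + 36) + 6)
      (fun τ => Approximates L S.N S.E S.h S.N (fun i => τ.arr 7 i)) := by
  refine Spec.mono (B := S.N * (((S.N * (S.N * 28 + 28) + 8) +
      (S.N * (S.N * 84 + (L + 1) * 20 + 60) + 20)) + 8) + 6) (R := _) ?_ (by nlinarith)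
    (fun _ _ h => h)
  refine Spec.forTo (N := S.N) (B := (S.N * (S.N * 28 + 28) + 8) +
      (S.N * (S.N * 84 + (L + 1) * 20 + 60) + 20))
    (fun r τ => Approximates L S.N S.E S.h r (fun i => τ.arr 7 i)) h3
    (by decide) (by decide) (Approximates.zero _ _ _ _ _) ?_
  rintro j hj τ hF hτ hI
  have h3' := (hF.1 3 (by decide)).trans h3
  have h12' := (hF.1 12 (by decide)).trans h12
  have h11' := (hF.1 11 (by decide)).trans h11
  have a2 := hF.2 2 (by decide)
  refine Spec.seq (spec_expoProg h3' (f := S.edge) (by unfold MatrixAt; rw [a2]; exact hM)) ?_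
  rintro ρ hG ⟨e1, e2⟩
  refine (spec_passProg ((hG.1 12 (by decide)).trans h12')
    ((hG.1 11 (by decide)).trans h11')).mono le_rfl ?_
  rintro φ - hW
  refine Approximates.step hL hS.eval hI (fun v hv h => ?_) (fun v hv h => ?_) hW
  · exact e1 v hv fun w hw => sign_cast_eq_zero.1 (h w hw)
  · exact e2 v hv fun h' => h fun w hw => sign_cast_eq_zero.2 (h' w hw)

/-! ### Deciding the form of the element -/

/-- The numbers `Z` and `W` decide whether the exponents `fexp` are negative, whether the
translation part vanishes, and whether the part of it with negative exponents is a given integer.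
The index `S.N` stands for the exponent `0`. -/
structure Merged.Decides (S : Merged) (Z W : ℕ → ℤ) : Prop where
  leaf : ∀ v < S.N, S.Leaf v → Z v = -1
  nonneg : ∀ v < S.N, ¬ S.Leaf v → 0 ≤ Z v
  anchor : 0 ≤ Z S.N
  sign : ∀ v < S.N, ¬ S.Leaf v → (0 ≤ S.fexp v ↔ Z S.N ≤ Z v)
  total : S.shift = 0 ↔ ∑ v ∈ Finset.range S.N, (S.mm v : ℤ) * W v = 0
  neg : ∀ [DecidablePred S.Leaf] (q : ℤ), |q| ≤ S.N →
    ((∑ v ∈ Finset.range S.N, if ¬ S.Leaf v ∧ S.fexp v < 0 then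
      ((S.mm v : ℤ) : ℚ) * 2 ^ S.fexp v else 0) = q ↔
    (∑ v ∈ Finset.range S.N, if Z v < Z S.N then (S.mm v : ℤ) * W v else 0) = q * W S.N)

theorem Approximates.agree {L : ℕ} {S : Merged} (hS : S.Valid) {W : ℕ → ℤ}
    (hW : Approximates L S.N S.E S.h S.N W) {c : ℕ → ℤ} (hc : ∀ w < S.N, |c w| ≤ 4) :
    Agree L (∑ w ∈ Finset.range S.N, c w * S.E w) (∑ w ∈ Finset.range S.N, c w * W w) :=
  hW c (fun w hw h => absurd (hS.rank_lt w hw) (by omega)) (sum_abs_le hc)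

theorem Approximates.pos_iff {L : ℕ} {S : Merged} (hS : S.Valid) {W : ℕ → ℤ}
    (hW : Approximates L S.N S.E S.h S.N W) {v : ℕ} (hv : v < S.N) : 0 < W v ↔ ¬ S.Leaf v := by
  classical
  have h := hW.agree hS (c := fun w => if w = v then 1 else 0)
    (fun w _ => by split_ifs <;> norm_num)
  simp only [ite_mul, one_mul, zero_mul, Finset.sum_ite_eq', Finset.mem_range, hv, if_true] at h
  rw [hS.E_eq hv] at h
  split_ifs at h with hl
  · simp only [hl, not_true_eq_false, iff_false]
    unfold Agree at h
    omega
  · simp only [hl, not_false_eq_true, iff_true]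
    have : (0 : ℤ) < 2 ^ (S.expo v).toNat := by positivity
    unfold Agree at h
    omega

theorem sum_ite_abs_le {N : ℕ} {p : ℕ → Prop} [DecidablePred p] {c : ℕ → ℤ}
    (h : ∀ v < N, |c v| ≤ 1) : ∑ v ∈ Finset.range N, (if p v then 0 else |c v|) ≤ N := by
  calc ∑ v ∈ Finset.range N, (if p v then 0 else |c v|) ≤ ∑ v ∈ Finset.range N, 1 := by
        refine Finset.sum_le_sum fun v hv => ?_
        split_ifs
        exacts [by norm_num, h v (Finset.mem_range.1 hv)]
    _ = N := by simp

/-- The exponents `fexp` of the vertices with successors, and an anchor of exponent `0` at the index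
`S.N`, form a system to which `sum_zpow_eq_zero_iff` applies: they are sums of values with
coefficients of absolute value at most `2`, and so their differences are covered by the
approximation. -/
theorem decides_of_weights {L : ℕ} {S : Merged} (hS : S.Valid) (hL : 4 * (S.N : ℤ) ≤ 2 ^ L)
    {W Z W' : ℕ → ℤ} (hW : Approximates L S.N S.E S.h S.N W) {mn : ℤ} {F : ℕ → ℤ}
    (hF : ∀ v, F v = ∑ w ∈ Finset.range S.N, (S.edge v w : ℤ) * W w -
      ∑ w ∈ Finset.range v, (S.dm w : ℤ) * W w)
    (hmn : mn ≤ 0) (hmin : ∀ v < S.N, ¬ S.Leaf v → mn ≤ F v)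
    (hmem : mn = 0 ∨ ∃ v < S.N, ¬ S.Leaf v ∧ F v = mn)
    (hZ : ∀ v < S.N, S.Leaf v → Z v = -1) (hZ' : ∀ v < S.N, ¬ S.Leaf v → Z v = F v - mn)
    (hZN : Z S.N = -mn) (hW' : Weights L (S.N + 1) Z W') : S.Decides Z W' := by
  classical
  set f' : ℕ → ℤ := fun i => if i = S.N then 0 else S.fexp i with hf'
  set F' : ℕ → ℤ := fun i => if i = S.N then 0 else F i with hF'
  set s := (Finset.range (S.N + 1)).filter fun i => i = S.N ∨ ¬ S.Leaf i with hs
  have hmems : ∀ i, i ∈ s ↔ i = S.N ∨ (i < S.N ∧ ¬ S.Leaf i) := by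
    intro i
    simp only [hs, Finset.mem_filter, Finset.mem_range]
    constructor
    · rintro ⟨h1, h2 | h2⟩
      · exact Or.inl h2
      · by_cases h : i = S.N
        · exact Or.inl h
        · exact Or.inr ⟨by omega, h2⟩
    · rintro (h | ⟨h1, h2⟩)
      · exact ⟨by omega, Or.inl h⟩
      · exact ⟨by omega, Or.inr h2⟩
  -- The exponents as sums of values with coefficients of absolute value at most `2`.
  let c : ℕ → ℕ → ℤ := fun i w =>
    if i = S.N then 0 else (S.edge i w : ℤ) - if w < i then (S.dm w : ℤ) else 0
  have hsplit : ∀ (U : ℕ → ℤ) (i : ℕ), i < S.N → ∑ w ∈ Finset.range S.N, c i w * U w =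
      ∑ w ∈ Finset.range S.N, (S.edge i w : ℤ) * U w -
        ∑ w ∈ Finset.range i, (S.dm w : ℤ) * U w := by
    intro U i hi
    have h1 : ∑ w ∈ Finset.range i, (S.dm w : ℤ) * U w =
        ∑ w ∈ Finset.range S.N, if w < i then (S.dm w : ℤ) * U w else 0 := by
      rw [← Finset.sum_filter]
      refine Finset.sum_congr ?_ fun _ _ => rfl
      ext w
      simp only [Finset.mem_range, Finset.mem_filter]
      omega
    rw [h1, ← Finset.sum_sub_distrib]
    refine Finset.sum_congr rfl fun w _ => ?_
    simp only [c, hi.ne, if_false]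
    split_ifs <;> ring
  have hcf : ∀ i ∈ s, ∑ w ∈ Finset.range S.N, c i w * S.E w = f' i := by
    intro i hi
    rcases (hmems i).1 hi with rfl | ⟨hi, -⟩
    · simp [c, hf']
    · rw [hsplit _ _ hi, hf']
      simp only [hi.ne, if_false]
      rfl
  have hcF : ∀ i ∈ s, ∑ w ∈ Finset.range S.N, c i w * W w = F' i := by
    intro i hi
    rcases (hmems i).1 hi with rfl | ⟨hi, -⟩
    · simp [c, hF']
    · rw [hsplit _ _ hi, hF']
      simp only [hi.ne, if_false, hF]
  have hcabs : ∀ i w, |c i w| ≤ 2 := by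
    intro i w
    have h1 := abs_le.1 (abs_sign_le (S.edge i w))
    have h2 := abs_le.1 (abs_sign_le (S.dm w))
    simp only [c]
    rw [abs_le]
    split_ifs <;> constructor <;> linarith
  have hagree : ∀ i ∈ s, ∀ j ∈ s, Agree L (f' i - f' j) (F' i - F' j) := by
    intro i hi j hj
    rw [← hcf i hi, ← hcf j hj, ← hcF i hi, ← hcF j hj, ← Finset.sum_sub_distrib,
      ← Finset.sum_sub_distrib]
    simp only [← sub_mul]
    refine hW.agree hS fun w _ => ?_
    have h1 := abs_le.1 (hcabs i w)
    have h2 := abs_le.1 (hcabs j w)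
    rw [abs_le]
    constructor <;> linarith
  have hNs : S.N ∈ s := (hmems _).2 (Or.inl rfl)
  have hvs : ∀ v < S.N, ¬ S.Leaf v → v ∈ s := fun v hv h => (hmems _).2 (Or.inr ⟨hv, h⟩)
  obtain ⟨b, hb, hbmn⟩ : ∃ b ∈ s, F' b = mn := by
    rcases hmem with h | ⟨v, hv, hl, h⟩
    · exact ⟨S.N, hNs, by simp [hF', h]⟩
    · exact ⟨v, hvs v hv hl, by simp [hF', hv.ne, h]⟩
  have hbmin : ∀ i ∈ s, F' b ≤ F' i := by
    intro i hi
    rw [hbmn]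
    rcases (hmems i).1 hi with rfl | ⟨hi, hl⟩
    · simpa [hF'] using hmn
    · simpa [hF', hi.ne] using hmin i hi hl
  have hX : ∀ i ∈ s, Z i = F' i - F' b := by
    intro i hi
    rw [hbmn]
    rcases (hmems i).1 hi with rfl | ⟨hi, hl⟩
    · simp [hF', hZN]
    · simp [hF', hi.ne, hZ' i hi hl]
  have hslt : ∀ i ∈ s, i < S.N + 1 := fun i hi => by
    rcases (hmems i).1 hi with rfl | ⟨hi, -⟩ <;> omega
  have key := fun c => sum_zpow_eq_zero_iff (c := c) (n := S.N + 1) hL hslt hb hbmin hagree hX hW'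
  have hleafW : ∀ v < S.N, S.Leaf v → W' v = 0 := by
    intro v hv hl
    obtain ⟨y, -, hy⟩ := hW'
    rw [hy v (by omega), hZ v hv hl]
    simp
  have hs_eq : s = insert S.N ((Finset.range S.N).filter fun v => ¬ S.Leaf v) := by
    ext i
    rw [hmems]
    simp
  have hsumQ : ∀ g : ℕ → ℚ, ∑ i ∈ s, g i = g S.N + ∑ v ∈ Finset.range S.N,
      if S.Leaf v then 0 else g v := by
    intro g
    rw [hs_eq, Finset.sum_insert (by simp), Finset.sum_filter]
    congr 1
    exact Finset.sum_congr rfl fun v _ => ite_not _ _ _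
  have hsumZ : ∀ g : ℕ → ℤ, ∑ i ∈ s, g i = g S.N + ∑ v ∈ Finset.range S.N,
      if S.Leaf v then 0 else g v := by
    intro g
    rw [hs_eq, Finset.sum_insert (by simp), Finset.sum_filter]
    congr 1
    exact Finset.sum_congr rfl fun v _ => ite_not _ _ _
  have hfv : ∀ v < S.N, f' v = S.fexp v := fun v hv => by simp [hf', hv.ne]
  have hsign : ∀ v < S.N, ¬ S.Leaf v → (0 ≤ S.fexp v ↔ Z S.N ≤ Z v) := by
    intro v hv hl
    have h := (hagree v (hvs v hv hl) S.N hNs).nonneg_iff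
    rw [hX v (hvs v hv hl), hX S.N hNs]
    rw [hfv v hv] at h
    have h0 : f' S.N = 0 := by simp [hf']
    omega
  refine ⟨hZ, fun v hv hl => ?_, by omega, hsign, ?_, ?_⟩
  · have := hbmin v (hvs v hv hl)
    rw [hX v (hvs v hv hl)]
    omega
  · have h := key (fun i => if i = S.N then 0 else (S.mm i : ℤ)) ?_
    · rw [hsumQ, hsumZ] at h
      simp only [if_true, Int.cast_zero, zero_mul, zero_add] at h
      rw [hS.shift_eq]
      convert h using 2
      · refine Finset.sum_congr rfl fun v hv => ?_
        have hv := Finset.mem_range.1 hv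
        rw [hfv v hv, if_neg hv.ne]
      · refine Finset.sum_congr rfl fun v hv => ?_
        have hv := Finset.mem_range.1 hv
        by_cases hl : S.Leaf v
        · rw [if_pos hl, hleafW v hv hl, mul_zero]
        · rw [if_neg hl, if_neg hv.ne]
    · rw [hsumZ]
      have := sum_ite_abs_le (N := S.N) (p := S.Leaf)
        (c := fun v => if v = S.N then 0 else (S.mm v : ℤ)) fun v hv => by
          rw [if_neg hv.ne]; exact abs_sign_le _
      simp only [if_true, abs_zero]
      linarith
  · intro inst q hq
    obtain rfl : inst = fun v => Classical.propDecidable (S.Leaf v) := Subsingleton.elim _ _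
    have h := key (fun i => if i = S.N then -q else if S.fexp i < 0 then (S.mm i : ℤ) else 0) ?_
    · rw [hsumQ, hsumZ] at h
      simp only [if_true] at h
      have e1 : (∑ v ∈ Finset.range S.N, if ¬ S.Leaf v ∧ S.fexp v < 0 then
          ((S.mm v : ℤ) : ℚ) * 2 ^ S.fexp v else 0) = ∑ v ∈ Finset.range S.N,
          if S.Leaf v then 0 else ((if v = S.N then -q else
            if S.fexp v < 0 then (S.mm v : ℤ) else 0 : ℤ) : ℚ) * 2 ^ f' v := by
        refine Finset.sum_congr rfl fun v hv => ?_
        have hv := Finset.mem_range.1 hv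
        rw [hfv v hv, if_neg hv.ne]
        by_cases hl : S.Leaf v <;> by_cases hf : S.fexp v < 0 <;> simp [hl, hf]
      have e2 : (∑ v ∈ Finset.range S.N, if Z v < Z S.N then (S.mm v : ℤ) * W' v else 0) =
          ∑ v ∈ Finset.range S.N, if S.Leaf v then 0 else (if v = S.N then -q else
            if S.fexp v < 0 then (S.mm v : ℤ) else 0) * W' v := by
        refine Finset.sum_congr rfl fun v hv => ?_
        have hv := Finset.mem_range.1 hv
        by_cases hl : S.Leaf v
        · simp [hl, hleafW v hv hl]
        · have := hsign v hv hl
          rw [if_neg hl, if_neg hv.ne]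
          by_cases hf : S.fexp v < 0
          · rw [if_pos (by omega), if_pos hf]
          · rw [if_neg (by omega), if_neg hf, zero_mul]
      have e0 : f' S.N = 0 := by simp [hf']
      rw [← e1, ← e2, e0] at h
      rw [Int.cast_neg, zpow_zero, mul_one, neg_add_eq_zero, neg_mul, neg_add_eq_zero] at h
      rw [eq_comm, h, eq_comm]
    · rw [hsumZ]
      have := sum_ite_abs_le (N := S.N) (p := S.Leaf)
        (c := fun v => if v = S.N then -q else if S.fexp v < 0 then (S.mm v : ℤ) else 0)
        fun v hv => by
          rw [if_neg hv.ne]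
          split_ifs
          exacts [abs_sign_le _, by norm_num]
      simp only [if_true, abs_neg]
      linarith

/-- From the surrogate values, compute the sum of the numbers of the circuits for `t` in register
`23`, the least exponent (or `0`, if that is less) in register `24`, and a vertex without
successors in register `25`; then weigh the shifted exponents. -/
def decideProg : Prog :=
  expoProg ;; .assign 23 (.lit 0) ;; .assign 24 (.lit 0) ;; .assign 25 (.lit 0) ;;
  .forTo 18 3 (.ite (.get 7 (.reg 18))
      (.store 6 (.reg 18) (.sub (.get 6 (.reg 18)) (.reg 23)) ;;
        .ite (.sub (.reg 24) (.get 6 (.reg 18))) (.assign 24 (.get 6 (.reg 18))) .skip)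
      (.assign 25 (.reg 18)) ;;
    .ite (.get 4 (.reg 18)) (.assign 23 (.add (.reg 23) (.get 7 (.reg 18))))
      (.ite (.sub (.lit 0) (.get 4 (.reg 18))) (.assign 23 (.sub (.reg 23) (.get 7 (.reg 18))))
        .skip)) ;;
  .forTo 18 3 (.ite (.get 7 (.reg 18))
    (.store 6 (.reg 18) (.sub (.get 6 (.reg 18)) (.reg 24))) .skip) ;;
  .store 6 (.reg 3) (.sub (.lit 0) (.reg 24)) ;; .assign 12 (.add (.reg 3) (.lit 1)) ;; passProg

theorem spec_decideProg {σ : State} {S : Merged} {L : ℕ} (hS : S.Valid)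
    (hL : 4 * (S.N : ℤ) ≤ 2 ^ L) (h3 : σ.reg 3 = S.N)
    (h11 : σ.reg 11 = (L + 1 : ℕ)) (hM : MatrixAt S.N (fun v w => S.edge v w) σ)
    (h4 : ∀ v : ℕ, σ.arr 4 v = S.dm v)
    (hW : Approximates L S.N S.E S.h S.N (fun i => σ.arr 7 i)) :
    Spec decideProg σ (S.N * (S.N * 28 + 28) + S.N * 100 +
      (S.N + 1) * ((S.N + 1) * 84 + (L + 1) * 20 + 60) + 100)
      (fun τ => S.Decides (fun i => τ.arr 6 i) (fun i => τ.arr 7 i) ∧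
        (τ.reg 23 = 0 ↔ S.dsum S.N = 0) ∧
        ∃ z : ℕ, τ.reg 25 = z ∧ (0 < S.N → z < S.N ∧ S.Leaf z)) := by
  classical
  set F : ℕ → ℤ := fun v => ∑ w ∈ Finset.range S.N, (S.edge v w : ℤ) * σ.arr 7 w -
    ∑ w ∈ Finset.range v, (S.dm w : ℤ) * σ.arr 7 w with hFdef
  have hpos : ∀ v < S.N, (0 < σ.arr 7 v ↔ ¬ S.Leaf v) := fun v hv => hW.pos_iff hS hv
  refine Spec.mono (B := (S.N * (S.N * 28 + 28) + 8) + (2 + (2 + (2 + ((S.N * (40 + 8) + 6) +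
    ((S.N * (20 + 8) + 6) + (10 + (10 +
      ((S.N + 1) * ((S.N + 1) * 84 + (L + 1) * 20 + 60) + 20)))))))))
    (R := _) ?_ (by nlinarith) (fun _ _ h => h)
  refine Spec.seq (spec_expoProg h3 hM) ?_
  rintro τ hτ ⟨e1, e2⟩
  have t3 := (hτ.1 3 (by decide)).trans h3
  have t11 := (hτ.1 11 (by decide)).trans h11
  have t7 := hτ.2 7 (by decide)
  have t4 := hτ.2 4 (by decide)
  refine spec_flat_seq rfl (by decide) (spec_flat_seq rfl (by decide)
    (spec_flat_seq rfl (by decide) ?_))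
  refine Spec.seq (B₁ := S.N * (40 + 8) + 6) (R₁ := fun ρ =>
    ρ.reg 23 = ∑ w ∈ Finset.range S.N, (S.dm w : ℤ) * σ.arr 7 w ∧
    (∀ v < S.N, ρ.arr 6 v = if S.Leaf v then -1 else F v) ∧
    ρ.reg 24 ≤ 0 ∧ (∀ v < S.N, ¬ S.Leaf v → ρ.reg 24 ≤ F v) ∧
    (ρ.reg 24 = 0 ∨ ∃ v < S.N, ¬ S.Leaf v ∧ F v = ρ.reg 24) ∧
    ((∃ z : ℕ, ρ.reg 25 = z ∧ z < S.N ∧ S.Leaf z) ∨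
      (ρ.reg 25 = 0 ∧ ∀ v < S.N, ¬ S.Leaf v))) ?_ ?_
  · refine Spec.forTo (N := S.N) (B := 40) (fun j ρ =>
      ρ.reg 23 = ∑ w ∈ Finset.range j, (S.dm w : ℤ) * σ.arr 7 w ∧
      (∀ v < S.N, ρ.arr 6 v = if S.Leaf v then -1 else
        if v < j then F v else ∑ w ∈ Finset.range S.N, (S.edge v w : ℤ) * σ.arr 7 w) ∧
      ρ.reg 24 ≤ 0 ∧ (∀ v < j, ¬ S.Leaf v → ρ.reg 24 ≤ F v) ∧
      (ρ.reg 24 = 0 ∨ ∃ v < j, ¬ S.Leaf v ∧ F v = ρ.reg 24) ∧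
      ((∃ z : ℕ, ρ.reg 25 = z ∧ z < j ∧ S.Leaf z) ∨
        (ρ.reg 25 = 0 ∧ ∀ v < j, ¬ S.Leaf v))) ?_ (by decide) (by decide) ?_ ?_ |>.mono le_rfl ?_
    · simp [Prog.exec, t3]
    · refine ⟨by simp [Prog.exec, Expr.eval], fun v hv => ?_, by simp [Prog.exec, Expr.eval],
        by simp, Or.inl (by simp [Prog.exec, Expr.eval]),
        Or.inr ⟨by simp [Prog.exec, Expr.eval], by simp⟩⟩
      have : τ.arr 6 v = if S.Leaf v then -1 else
          ∑ w ∈ Finset.range S.N, (S.edge v w : ℤ) * σ.arr 7 w := by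
        split_ifs with hl
        · exact e1 v hv hl
        · exact e2 v hv hl
      simp [Prog.exec, this]
    · rintro j hj ρ hρ hρj ⟨f23, f6, f24, fmin, fmem, f25⟩
      have r7 : ρ.arr 7 = σ.arr 7 := by rw [hρ.2 7 (by decide)]; simp [Prog.exec, t7]
      have r4 : ρ.arr 4 = σ.arr 4 := by rw [hρ.2 4 (by decide)]; simp [Prog.exec, t4]
      have hsucc : ∀ {p : ℕ → Prop}, (∀ w < j, p w) → p j → ∀ w < j + 1, p w :=
        fun {p} h h' w hw => by
          rcases Nat.lt_succ_iff_lt_or_eq.1 hw with hw | rfl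
          exacts [h w hw, h']
      refine Spec.mono (B := 23 + 17) (R := _) ?_ le_rfl (fun _ _ h => h)
      refine Spec.seq (R₁ := fun φ =>
        (∀ v < S.N, φ.arr 6 v = if S.Leaf v then -1 else
          if v < j + 1 then F v else ∑ w ∈ Finset.range S.N, (S.edge v w : ℤ) * σ.arr 7 w) ∧
        φ.reg 24 ≤ 0 ∧ (∀ v < j + 1, ¬ S.Leaf v → φ.reg 24 ≤ F v) ∧
        (φ.reg 24 = 0 ∨ ∃ v < j + 1, ¬ S.Leaf v ∧ F v = φ.reg 24) ∧
        ((∃ z : ℕ, φ.reg 25 = z ∧ z < j + 1 ∧ S.Leaf z) ∨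
          (φ.reg 25 = 0 ∧ ∀ v < j + 1, ¬ S.Leaf v))) ?_ ?_
      · refine Spec.of_flat rfl (by decide) ?_
        by_cases hl : S.Leaf j
        · have h7 : ¬ 0 < σ.arr 7 j := by rw [hpos j hj]; exact not_not.2 hl
          simp only [Prog.exec, Expr.eval, hρj, r7, h7, if_false, State.setReg_arr]
          refine ⟨fun v hv => ?_, by simpa using f24, ?_, ?_, Or.inl ⟨j, by simp, by omega, hl⟩⟩
          · rw [f6 v hv]
            by_cases hvj : v = j
            · subst hvj; simp [hl]
            · exact if_congr Iff.rfl rfl (if_congr (by omega) rfl rfl)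
          · exact hsucc (fun v hv h => by simpa using fmin v hv h) (fun h => absurd hl h)
          · rcases fmem with h | ⟨v, hv, h⟩
            · exact Or.inl (by simpa using h)
            · exact Or.inr ⟨v, by omega, by simpa using h⟩
        · have h7 : 0 < σ.arr 7 j := (hpos j hj).2 hl
          have hX : ρ.arr 6 j - ρ.reg 23 = F j := by
            rw [f6 j hj, if_neg hl, if_neg (lt_irrefl j), f23]
          have h25 : (∃ z : ℕ, ρ.reg 25 = z ∧ z < j + 1 ∧ S.Leaf z) ∨
              (ρ.reg 25 = 0 ∧ ∀ v < j + 1, ¬ S.Leaf v) := by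
            rcases f25 with ⟨z, h1, h2, h3⟩ | ⟨h1, h2⟩
            · exact Or.inl ⟨z, h1, by omega, h3⟩
            · exact Or.inr ⟨h1, hsucc h2 hl⟩
          have h6 : ∀ v < S.N, (if v = j then F j else ρ.arr 6 v) = if S.Leaf v then -1 else
              if v < j + 1 then F v else
                ∑ w ∈ Finset.range S.N, (S.edge v w : ℤ) * σ.arr 7 w := by
            intro v hv
            by_cases hvj : v = j
            · subst hvj; simp [hl]
            · rw [if_neg hvj, f6 v hv]
              exact if_congr Iff.rfl rfl (if_congr (by omega) rfl rfl)
          simp only [Prog.exec, Expr.eval, hρj, r7, h7, if_true, State.setArr_arr,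
            State.setArr_reg, hX, and_self]
          by_cases hlt : 0 < ρ.reg 24 - F j
          · rw [if_pos hlt]
            refine ⟨fun v hv => ?_, by simp; omega, ?_, Or.inr ⟨j, by omega, hl, by simp⟩,
              by simpa using h25⟩
            · simpa using h6 v hv
            · refine hsucc (fun v hv h => ?_) (fun _ => by simp)
              have := fmin v hv h
              simp; omega
          · rw [if_neg hlt]
            refine ⟨fun v hv => by simpa using h6 v hv, by simpa using f24, ?_, ?_,
              by simpa using h25⟩
            · exact hsucc (fun v hv h => by simpa using fmin v hv h) (fun _ => by simp; omega)
            · rcases fmem with h | ⟨v, hv, h⟩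
              · exact Or.inl (by simpa using h)
              · exact Or.inr ⟨v, by omega, by simpa using h⟩
      · rintro φ hφ hI
        have g7 : φ.arr 7 = σ.arr 7 := (hφ.2 7 (by decide)).trans r7
        have g4 : φ.arr 4 = σ.arr 4 := (hφ.2 4 (by decide)).trans r4
        have g18 := (hφ.1 18 (by decide)).trans hρj
        have g23 := (hφ.1 23 (by decide)).trans f23
        refine Spec.of_flat rfl (by decide) ?_
        simp only [Prog.exec, Expr.eval, g18, g7, g4, h4, Finset.sum_range_succ]
        rcases hs : S.dm j with _ | _ | _
        · simpa [hs, g23] using hI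
        · simpa [hs, g23, sub_eq_add_neg] using hI
        · simpa [hs, g23] using hI
    · rintro ρ - ⟨f23, f6, f⟩
      refine ⟨f23, fun v hv => ?_, f⟩
      rw [f6 v hv]
      simp [hv]
  rintro ρ hρ ⟨f23, f6, f24, fmin, fmem, f25⟩
  have r3 : ρ.reg 3 = S.N := by rw [hρ.1 3 (by decide)]; simp [Prog.exec, t3]
  have r11 : ρ.reg 11 = (L + 1 : ℕ) := by
    rw [hρ.1 11 (by decide)]
    simpa [Prog.exec] using t11
  have r7 : ρ.arr 7 = σ.arr 7 := by rw [hρ.2 7 (by decide)]; simp [Prog.exec, t7]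
  refine Spec.seq (B₁ := S.N * (20 + 8) + 6) (R₁ := fun φ =>
    ∀ v < S.N, φ.arr 6 v = if S.Leaf v then -1 else F v - ρ.reg 24) ?_ ?_
  · refine Spec.forTo (N := S.N) (B := 20) (fun j φ => ∀ v < S.N, φ.arr 6 v =
      if S.Leaf v then -1 else if v < j then F v - ρ.reg 24 else F v) r3 (by decide) (by decide)
      ?_ ?_ |>.mono le_rfl ?_
    · simpa using f6
    · rintro j hj φ hφ hφj hI
      have g24 := hφ.1 24 (by decide)
      have g7 : φ.arr 7 = σ.arr 7 := (hφ.2 7 (by decide)).trans r7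
      refine Spec.of_flat rfl (by decide) ?_
      intro v hv
      simp only [Prog.exec, Expr.eval, hφj, g7, g24]
      have hIv := hI v hv
      have hIj := hI j hj
      by_cases hl : S.Leaf j
      · rw [if_neg (by rw [hpos j hj]; exact not_not.2 hl)]
        by_cases hvj : v = j
        · subst hvj
          simpa [hl] using hIv
        · simp only [State.setReg_arr, hIv]
          exact if_congr Iff.rfl rfl (if_congr (by omega) rfl rfl)
      · rw [if_pos ((hpos j hj).2 hl)]
        by_cases hvj : v = j
        · subst hvj
          simp [hl, hIj]
        · simp only [State.setReg_arr, State.setArr_arr, Nat.cast_inj, hvj, and_false, if_false,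
            hIv]
          exact if_congr Iff.rfl rfl (if_congr (by omega) rfl rfl)
    · intro φ _ h v hv
      simp [h v hv, hv]
  intro φ hφ g6
  have g3 := (hφ.1 3 (by decide)).trans r3
  have g11 := (hφ.1 11 (by decide)).trans r11
  have g24 := hφ.1 24 (by decide)
  have g23 := (hφ.1 23 (by decide)).trans f23
  have g25 := hφ.1 25 (by decide)
  refine spec_flat_seq rfl (by decide) (spec_flat_seq rfl (by decide) ?_)
  refine (spec_passProg (n := S.N + 1) (L := L) ?_ ?_).mono le_rfl ?_
  · simp [Prog.exec, Expr.eval, g3]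
  · simpa [Prog.exec] using g11
  intro ψ hψ hWt
  have k6 := hψ.2 6 (by decide)
  have k23 : ψ.reg 23 = φ.reg 23 := by rw [hψ.1 23 (by decide)]; simp [Prog.exec]
  have k25 : ψ.reg 25 = φ.reg 25 := by rw [hψ.1 25 (by decide)]; simp [Prog.exec]
  have k6v : ∀ v < S.N, ψ.arr 6 v = if S.Leaf v then -1 else F v - ρ.reg 24 := by
    intro v hv
    rw [k6, ← g6 v hv]
    simp only [Prog.exec, Expr.eval, State.setReg_arr, State.setArr_arr, g3, Nat.cast_inj, hv.ne,
      and_false, if_false]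
  have k6N : ψ.arr 6 S.N = -ρ.reg 24 := by
    rw [k6]
    simp [Prog.exec, Expr.eval, g3, g24]
  rw [← k6] at hWt
  refine ⟨decides_of_weights hS hL hW (F := F) (fun _ => rfl) f24 fmin fmem (fun v hv hl => ?_)
    (fun v hv hl => ?_) k6N hWt, ?_, ?_⟩
  · simp [k6v v hv, hl]
  · simp [k6v v hv, hl]
  · rw [k23, g23]
    have := hW.agree hS (c := fun w => (S.dm w : ℤ))
      (fun w _ => (abs_sign_le _).trans (by norm_num))
    exact this.eq_zero_iff.symm
  · rcases f25 with ⟨z, h1, h2⟩ | ⟨h1, h2⟩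
    · exact ⟨z, by rw [k25, g25, h1], fun _ => h2⟩
    · refine ⟨0, by rw [k25, g25, h1]; rfl, fun h0 => ?_⟩
      obtain ⟨v, hv, hl⟩ := hS.exists_leaf h0
      exact absurd hl (h2 v hv)

/-! ### The integer part and the new vertices -/

/-- Compute the sums of all the weighted marks, in register `27`, and of those of index less than
that of the anchor, in register `26`. -/
def sumProg : Prog :=
  .assign 26 (.lit 0) ;; .assign 27 (.lit 0) ;;
  .forTo 18 3 (.ite (.get 3 (.reg 18)) (.assign 32 (.get 7 (.reg 18)))
      (.ite (.sub (.lit 0) (.get 3 (.reg 18))) (.assign 32 (.sub (.lit 0) (.get 7 (.reg 18))))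
        (.assign 32 (.lit 0))) ;;
    .assign 27 (.add (.reg 27) (.reg 32)) ;;
    .ite (.sub (.get 6 (.reg 3)) (.get 6 (.reg 18))) (.assign 26 (.add (.reg 26) (.reg 32))) .skip)

theorem spec_sumProg {σ : State} {S : Merged} (h3 : σ.reg 3 = S.N)
    (hmm : ∀ v : ℕ, σ.arr 3 v = S.mm v) :
    Spec sumProg σ (S.N * 40 + 10)
      (fun τ => τ.reg 27 = ∑ v ∈ Finset.range S.N, (S.mm v : ℤ) * σ.arr 7 v ∧
        τ.reg 26 = ∑ v ∈ Finset.range S.N,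
          if σ.arr 6 v < σ.arr 6 S.N then (S.mm v : ℤ) * σ.arr 7 v else 0) := by
  refine Spec.mono (B := 2 + (2 + (S.N * (32 + 8) + 6))) (R := _) ?_ (by omega) (fun _ _ h => h)
  refine spec_flat_seq rfl (by decide) (spec_flat_seq rfl (by decide) ?_)
  refine Spec.forTo (N := S.N) (B := 32) (fun j τ =>
    τ.reg 27 = ∑ v ∈ Finset.range j, (S.mm v : ℤ) * σ.arr 7 v ∧
    τ.reg 26 = ∑ v ∈ Finset.range j,
      if σ.arr 6 v < σ.arr 6 S.N then (S.mm v : ℤ) * σ.arr 7 v else 0) ?_ (by decide) (by decide)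
    ?_ ?_
  · simp [Prog.exec, h3]
  · simp [Prog.exec, Expr.eval]
  · rintro j hj τ hF hτ ⟨i1, i2⟩
    have a3 : τ.arr 3 = σ.arr 3 := by rw [hF.2 3 (by decide)]; simp [Prog.exec]
    have a6 : τ.arr 6 = σ.arr 6 := by rw [hF.2 6 (by decide)]; simp [Prog.exec]
    have a7 : τ.arr 7 = σ.arr 7 := by rw [hF.2 7 (by decide)]; simp [Prog.exec]
    have r3 : τ.reg 3 = S.N := by rw [hF.1 3 (by decide)]; simp [Prog.exec, h3]
    refine Spec.mono (B := 16 + 16) (R := _) ?_ le_rfl (fun _ _ h => h)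
    refine Spec.seq (B₁ := 16) (R₁ := fun ρ => ρ.reg 32 = (S.mm j : ℤ) * σ.arr 7 j) ?_ ?_
    · refine Spec.of_flat rfl (by decide) ?_
      simp only [Prog.exec, Expr.eval, hτ, a3, a7, hmm]
      rcases S.mm j with _ | _ | _ <;> simp
    · intro ρ hρ h32
      have b6 := (hρ.2 6 (by decide)).trans a6
      have q3 := (hρ.1 3 (by decide)).trans r3
      have q18 := (hρ.1 18 (by decide)).trans hτ
      have q27 := (hρ.1 27 (by decide)).trans i1
      have q26 := (hρ.1 26 (by decide)).trans i2
      refine Spec.of_flat rfl (by decide) ?_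
      simp only [Prog.exec, Expr.eval, q18, q3, b6, h32, q27, Finset.sum_range_succ,
        State.setReg_arr, State.setReg_reg]
      by_cases h : σ.arr 6 j < σ.arr 6 S.N
      · simp [h, q26]
      · simp [h, q26]

/-- Search for the integer value of the sum with negative exponents: a number `q`, in register
`28`, and a sign, in register `29`, found if register `19` is `1`. -/
def searchProg : Prog :=
  .assign 19 (.lit 0) ;; .assign 28 (.lit 0) ;; .assign 29 (.lit 1) ;; .assign 30 (.lit 0) ;;
  .forTo 21 12 (.ifZero (.sub (.reg 26) (.reg 30))
      (.assign 19 (.lit 1) ;; .assign 28 (.reg 21) ;; .assign 29 (.lit 1)) .skip ;;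
    .ifZero (.add (.reg 26) (.reg 30))
      (.assign 19 (.lit 1) ;; .assign 28 (.reg 21) ;; .assign 29 (.lit (-1))) .skip ;;
    .assign 30 (.add (.reg 30) (.get 7 (.reg 3))))

theorem exec_ifZero (e : Expr) (p q : Prog) (σ : State) :
    (Prog.ifZero e p q).exec σ = if e.eval σ = 0 then p.exec σ else q.exec σ := by
  simp only [Prog.ifZero, Prog.exec, Expr.eval, zero_sub, Int.neg_pos]
  rcases lt_trichotomy (e.eval σ) 0 with h | h | h
  · rw [if_neg h.not_gt, if_pos h, if_neg h.ne]
  · rw [if_neg h.not_gt, if_neg h.not_lt, if_pos h]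
  · rw [if_pos h, if_neg h.ne']

theorem exec_ifNonzero (e : Expr) (p : Prog) (σ : State) :
    (Prog.ifNonzero e p).exec σ = if e.eval σ = 0 then σ else p.exec σ := by
  simp only [Prog.ifNonzero, Prog.exec, Expr.eval, zero_sub, Int.neg_pos]
  rcases lt_trichotomy (e.eval σ) 0 with h | h | h
  · rw [if_neg h.not_gt, if_pos h, if_neg h.ne]
  · rw [if_neg h.not_gt, if_neg h.not_lt, if_pos h]
  · rw [if_pos h, if_neg h.ne']

theorem spec_searchProg {σ : State} {N n : ℕ} (h3 : σ.reg 3 = N) (h12 : σ.reg 12 = n) :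
    Spec searchProg σ (n * 60 + 20)
      (fun τ => ∃ (q : ℕ) (sg : SignType), sg ≠ 0 ∧ τ.reg 28 = q ∧ τ.reg 29 = sg ∧
        ((τ.reg 19 = 1 ∧ q < n ∧ σ.reg 26 = sg * q * σ.arr 7 N) ∨
        (τ.reg 19 = 0 ∧ ∀ c < n, σ.reg 26 ≠ c * σ.arr 7 N ∧ σ.reg 26 ≠ -(c * σ.arr 7 N)))) := by
  refine Spec.mono (B := 2 + (2 + (2 + (2 + (n * (44 + 8) + 6))))) (R := _) ?_ (by omega)
    (fun _ _ h => h)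
  refine spec_flat_seq rfl (by decide) (spec_flat_seq rfl (by decide)
    (spec_flat_seq rfl (by decide) (spec_flat_seq rfl (by decide) ?_)))
  refine Spec.forTo (N := n) (B := 44) (fun j τ => τ.reg 30 = j * σ.arr 7 N ∧
    ∃ (q : ℕ) (sg : SignType), sg ≠ 0 ∧ τ.reg 28 = q ∧ τ.reg 29 = sg ∧
        ((τ.reg 19 = 1 ∧ q < j ∧ σ.reg 26 = sg * q * σ.arr 7 N) ∨
        (τ.reg 19 = 0 ∧ ∀ c < j, σ.reg 26 ≠ c * σ.arr 7 N ∧ σ.reg 26 ≠ -(c * σ.arr 7 N))))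
    ?_ (by decide) (by decide) ?_ ?_ |>.mono le_rfl (fun _ _ h => h.2)
  · simp [Prog.exec, h12]
  · exact ⟨by simp [Prog.exec, Expr.eval], 0, 1, by decide, by simp [Prog.exec, Expr.eval],
      by simp [Prog.exec, Expr.eval], Or.inr ⟨by simp [Prog.exec, Expr.eval], by simp⟩⟩
  · rintro j hj τ hF hτ ⟨i1, q, sg, hsg, i28, i29, i2⟩
    have a7 : τ.arr 7 = σ.arr 7 := by rw [hF.2 7 (by decide)]; simp [Prog.exec]
    have r3 : τ.reg 3 = N := by rw [hF.1 3 (by decide)]; simp [Prog.exec, h3]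
    have r26 : τ.reg 26 = σ.reg 26 := by rw [hF.1 26 (by decide)]; simp [Prog.exec]
    refine Spec.of_flat rfl (by decide) ?_
    rw [Prog.exec, Prog.exec, exec_ifZero, exec_ifZero]
    by_cases hA : σ.reg 26 - (j : ℤ) * σ.arr 7 N = 0
    · by_cases hB : σ.reg 26 + (j : ℤ) * σ.arr 7 N = 0
      · simp only [Expr.eval, Prog.exec, State.setReg_reg, State.setReg_arr, r26, i1, hA, hB, hτ,
          a7, r3, if_true, Nat.reduceEqDiff, if_false]
        refine ⟨by push_cast; ring, j, -1, by decide, rfl, rfl, Or.inl ⟨trivial, by omega, ?_⟩⟩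
        simp only [SignType.coe_neg_one]
        linarith
      · simp only [Expr.eval, Prog.exec, State.setReg_reg, State.setReg_arr, r26, i1, hA, hB, hτ,
          a7, r3, if_true, Nat.reduceEqDiff, if_false]
        refine ⟨by push_cast; ring, j, 1, by decide, rfl, rfl, Or.inl ⟨trivial, by omega, ?_⟩⟩
        simp only [SignType.coe_one]
        linarith
    · by_cases hB : σ.reg 26 + (j : ℤ) * σ.arr 7 N = 0
      · simp only [Expr.eval, Prog.exec, State.setReg_reg, State.setReg_arr, r26, i1, hA, hB, hτ,
          a7, r3, if_true, Nat.reduceEqDiff, if_false]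
        refine ⟨by push_cast; ring, j, -1, by decide, rfl, rfl, Or.inl ⟨trivial, by omega, ?_⟩⟩
        simp only [SignType.coe_neg_one]
        linarith
      · simp only [Expr.eval, Prog.exec, State.setReg_reg, r26, i1, hA, hB, hτ,
          a7, r3, if_true, Nat.reduceEqDiff, if_false]
        refine ⟨by push_cast; ring, q, sg, hsg, i28, i29, ?_⟩
        rcases i2 with ⟨h, h1, h2⟩ | ⟨h, h'⟩
        · exact Or.inl ⟨h, by omega, h2⟩
        · refine Or.inr ⟨h, fun c hc => ?_⟩
          rcases Nat.lt_succ_iff_lt_or_eq.1 hc with hc | rfl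
          · exact h' c hc
          · exact ⟨fun h => hA (by linarith), fun h => hB (by linarith)⟩

namespace Merged

/-- The number of the marked vertices before `j` whose contribution to the translation part has a
negative exponent. -/
def numNeg (S : Merged) (Z : ℕ → ℤ) (j : ℕ) : ℕ :=
  ∑ v ∈ Finset.range j, if S.mm v ≠ 0 ∧ 0 ≤ Z v ∧ Z v < Z S.N then 1 else 0

/-- The type of the new vertex for `v`, see `newEdge`: of those with negative exponents, the first
`q` get the value `1` and the others the value `0`. -/
def newType (S : Merged) (Z : ℕ → ℤ) (q v : ℕ) : ℕ :=
  if Z v < 0 then 0 else if Z S.N ≤ Z v then 1 else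
    if S.mm v ≠ 0 ∧ S.numNeg Z v < q then 2 else 0

/-- The mark of the new vertex for `v`. -/
def newMark (S : Merged) (Z : ℕ → ℤ) (sg : SignType) (v : ℕ) : SignType :=
  if 0 ≤ Z v ∧ Z v < Z S.N then sg else S.mm v

theorem sum_newType (S : Merged) (Z : ℕ → ℤ) (q j : ℕ) :
    (∑ v ∈ Finset.range j, if S.mm v ≠ 0 ∧ S.newType Z q v = 2 then 1 else 0) =
      min q (S.numNeg Z j) := by
  induction j with
  | zero => simp [numNeg]
  | succ j ih =>
    rw [Finset.sum_range_succ, ih]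
    have h : S.numNeg Z (j + 1) = S.numNeg Z j +
        if S.mm j ≠ 0 ∧ 0 ≤ Z j ∧ Z j < Z S.N then 1 else 0 := Finset.sum_range_succ _ _
    rw [h, newType]
    by_cases h1 : S.mm j = 0
    · simp [h1]
    by_cases h2 : Z j < 0
    · simp [h2, h2.not_ge]
    by_cases h3 : Z S.N ≤ Z j
    · simp [h2, h3, h3.not_gt]
    by_cases h4 : S.numNeg Z j < q
    · simp only [h1, h2, h3, h4, not_lt.1 h2, not_le.1 h3, ne_eq, not_false_eq_true, and_self,
        if_true, if_false]
      omega
    · simp only [h1, h2, h3, h4, not_lt.1 h2, not_le.1 h3, ne_eq, not_false_eq_true, and_self,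
        and_false, if_true, if_false, OfNat.zero_ne_ofNat]
      omega

end Merged

/-- Determine the types, in array `8`, and the marks, in array `9`, of the new vertices, and their
number, in register `13`. -/
def typeProg : Prog :=
  .assign 31 (.reg 28) ;; .assign 13 (.lit 0) ;;
  .forTo 18 3 (.store 8 (.reg 18) (.lit 0) ;; .store 9 (.reg 18) (.get 3 (.reg 18)) ;;
    .ite (.add (.get 6 (.reg 18)) (.lit 1)) (.ite (.sub (.get 6 (.reg 3)) (.get 6 (.reg 18)))
      (.store 9 (.reg 18) (.reg 29) ;; .ifNonzero (.get 3 (.reg 18))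
        (.ite (.reg 31) (.store 8 (.reg 18) (.lit 2) ;; .assign 31 (.sub (.reg 31) (.lit 1)))
          .skip))
      (.store 8 (.reg 18) (.lit 1))) .skip ;;
    .ifNonzero (.get 3 (.reg 18)) (.assign 13 (.add (.reg 13) (.lit 1))))

set_option linter.unusedSimpArgs false in
theorem spec_typeProg {σ : State} {S : Merged} {q : ℕ} {sg : SignType} (h3 : σ.reg 3 = S.N)
    (hmm : ∀ v : ℕ, σ.arr 3 v = S.mm v) (h28 : σ.reg 28 = q) (h29 : σ.reg 29 = sg) :
    Spec typeProg σ (S.N * 70 + 10)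
      (fun τ => (∀ v < S.N, τ.arr 8 v = S.newType (fun i => σ.arr 6 i) q v ∧
          τ.arr 9 v = S.newMark (fun i => σ.arr 6 i) sg v) ∧
        τ.reg 13 = ((List.range S.N).filter fun v => S.mm v ≠ 0).length) := by
  refine Spec.mono (B := 2 + (2 + (S.N * (62 + 8) + 6))) (R := _) ?_ (by omega) (fun _ _ h => h)
  refine spec_flat_seq rfl (by decide) (spec_flat_seq rfl (by decide) ?_)
  refine Spec.forTo (N := S.N) (B := 62) (fun j τ =>
    (∀ v < j, τ.arr 8 v = S.newType (fun i => σ.arr 6 i) q v ∧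
          τ.arr 9 v = S.newMark (fun i => σ.arr 6 i) sg v) ∧
    τ.reg 13 = ((List.range j).filter fun v => S.mm v ≠ 0).length ∧
    τ.reg 31 = (q - S.numNeg (fun i => σ.arr 6 i) j : ℕ)) ?_ (by decide) (by decide)
    ?_ ?_ |>.mono le_rfl (fun _ _ h => ⟨h.1, h.2.1⟩)
  · simp [Prog.exec, h3]
  · simp [Prog.exec, Expr.eval, h28, Merged.numNeg]
  · rintro j hj τ hF hτ ⟨i1, i2, i3⟩
    have a3 : τ.arr 3 = σ.arr 3 := by rw [hF.2 3 (by decide)]; simp [Prog.exec]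
    have a6 : τ.arr 6 = σ.arr 6 := by rw [hF.2 6 (by decide)]; simp [Prog.exec]
    have r3 : τ.reg 3 = S.N := by rw [hF.1 3 (by decide)]; simp [Prog.exec, h3]
    have r29 : τ.reg 29 = sg := by rw [hF.1 29 (by decide)]; simp [Prog.exec, h29]
    set Z : ℕ → ℤ := fun i => σ.arr 6 i with hZ
    have hnum : S.numNeg Z (j + 1) = S.numNeg Z j +
        if S.mm j ≠ 0 ∧ 0 ≤ Z j ∧ Z j < Z S.N then 1 else 0 := Finset.sum_range_succ _ _
    have hlt : ∀ {P : ℕ → Prop}, (∀ v < j, P v) → P j → ∀ v < j + 1, P v := by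
      intro P h h' v hv
      rcases Nat.lt_succ_iff_lt_or_eq.1 hv with hv | rfl
      exacts [h v hv, h']
    have hne : ∀ v < j, (v : ℤ) ≠ j := fun v hv => by exact_mod_cast hv.ne
    have hR : ∀ ρ : State,
        ((∀ i, ρ.arr 8 i = if i = j then (S.newType Z q j : ℤ) else τ.arr 8 i) ∧
        (∀ i, ρ.arr 9 i = if i = j then (S.newMark Z sg j : ℤ) else τ.arr 9 i) ∧
        ρ.reg 13 = τ.reg 13 + (if S.mm j = 0 then 0 else 1) ∧
        ρ.reg 31 = (q - S.numNeg Z (j + 1) : ℕ)) →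
        (∀ v < j + 1, (ρ.setReg 18 (j + 1)).arr 8 v = S.newType Z q v ∧
          (ρ.setReg 18 (j + 1)).arr 9 v = S.newMark Z sg v) ∧
        (ρ.setReg 18 (j + 1)).reg 13 =
          ((List.range (j + 1)).filter fun v => S.mm v ≠ 0).length ∧
        (ρ.setReg 18 (j + 1)).reg 31 = (q - S.numNeg Z (j + 1) : ℕ) := by
      rintro ρ ⟨g1, g2, g3, g4⟩
      refine ⟨hlt (fun v hv => ?_) ?_, ?_, by simpa using g4⟩
      · simpa [g1, g2, hne v hv] using i1 v hv
      · simp [g1, g2]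
      · by_cases hm : S.mm j = 0
        · simp [g3, i2, List.range_succ, hm]
        · simp [g3, i2, List.range_succ, hm]
    refine Spec.of_flat rfl (by decide) (hR _ ?_)
    have hzj : τ.arr 6 j = Z j := by rw [a6]
    have hzN : τ.arr 6 S.N = Z S.N := by rw [a6]
    have hmj : τ.arr 3 j = S.mm j := by rw [a3, hmm]
    simp only [Prog.exec, exec_ifNonzero, Expr.eval, State.setReg_reg, State.setArr_reg,
      State.setReg_arr, State.setArr_arr, hτ, r3, r29, i3, hnum, Merged.newType, Merged.newMark,
      Nat.reduceEqDiff, false_and, if_false, hzj, hzN, hmj, sign_cast_eq_zero]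
    have hif : ∀ i x y z : ℤ, (if i = j then x else if i = j then y else z) =
        if i = j then x else z := fun i x y z => by split_ifs <;> rfl
    by_cases h2 : Z j < 0
    · have e1 : ¬ 0 < Z j + 1 := by omega
      by_cases h1 : S.mm j = 0 <;> simp [e1, h1, h2, h2.not_ge, hmj, hτ, sign_cast_eq_zero, hif, i3]
    have e1 : 0 < Z j + 1 := by omega
    have h2' := not_lt.1 h2
    by_cases h3 : Z S.N ≤ Z j
    · have e2 : ¬ 0 < Z S.N - Z j := by omega
      by_cases h1 : S.mm j = 0 <;> simp [e1, e2, h1, h2, h2', h3, h3.not_gt, hmj, hτ,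
          sign_cast_eq_zero, hif, i3]
    have e2 : 0 < Z S.N - Z j := by omega
    have h3' := not_le.1 h3
    by_cases h1 : S.mm j = 0
    · simp [e1, e2, h1, h2, h2', h3, h3', hmj, hτ, sign_cast_eq_zero, hif, i3]
    by_cases h4 : S.numNeg Z j < q
    · have e3 : 0 < ((q - S.numNeg Z j : ℕ) : ℤ) := by omega
      simp [e1, e2, e3, h1, h2, h2', h3, h3', h4, hmj, hτ, sign_cast_eq_zero, hif, i3]
      omega
    · have e3 : ¬ 0 < ((q - S.numNeg Z j : ℕ) : ℤ) := by omega
      simp [e1, e2, e3, h1, h2, h2', h3, h3', h4, hmj, hτ, sign_cast_eq_zero, hif, i3]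
      omega

/-! ### Writing the answers -/

theorem Spec.ifNonzero {e : Expr} {p : Prog} {σ : State} {B B' : ℕ} {R : State → Prop}
    (hB : 1 ≤ B) (hB' : 2 * e.cost + 4 + B ≤ B') (h : e.eval σ ≠ 0 → Spec p σ B R)
    (h' : e.eval σ = 0 → R σ) : Spec (Prog.ifNonzero e p) σ B' R := by
  refine Spec.mono (B := e.cost + 1 + ((Expr.sub (.lit 0) e).cost + 1 + B)) (R := R) ?_
    (by simp only [Expr.cost]; omega) (fun _ _ h => h)
  refine Spec.ite (fun he => (h he.ne').mono (by omega) fun _ _ h => h) fun he => ?_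
  refine Spec.ite (fun he' => ?_) fun he' => ?_
  · simp only [Expr.eval] at he'
    exact h (by omega)
  · simp only [Expr.eval] at he'
    exact Spec.of_flat rfl hB (h' (by omega))

theorem Spec.ifZero {e : Expr} {p q : Prog} {σ : State} {B B' : ℕ} {R : State → Prop}
    (hB' : 2 * e.cost + 4 + B ≤ B') (h : e.eval σ = 0 → Spec p σ B R)
    (h' : e.eval σ ≠ 0 → Spec q σ B R) : Spec (Prog.ifZero e p q) σ B' R := by
  refine Spec.mono (B := e.cost + 1 + ((Expr.sub (.lit 0) e).cost + 1 + B)) (R := R) ?_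
    (by simp only [Expr.cost]; omega) (fun _ _ h => h)
  refine Spec.ite (fun he => (h' he.ne').mono (by omega) fun _ _ h => h) fun he => ?_
  refine Spec.ite (fun he' => ?_) fun he' => ?_
  · simp only [Expr.eval] at he'
    exact h' (by omega)
  · simp only [Expr.eval] at he'
    exact h (by omega)

/-- Append the values of an expression for `w = 0, …, N - 1` to the output. -/
theorem Spec.emit_row {e : Expr} {σ : State} {x n N : ℕ} {ℓ : List ℤ} (g : ℕ → ℤ)
    (hn : σ.reg n = N) (hx : x ≠ 0) (hn0 : n ≠ 0) (hnx : n ≠ x) (h : Out σ ℓ)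
    (hg : ∀ j < N, ∀ τ, Frame (Prog.forTo x n (Prog.emit e)) σ τ → τ.reg x = j →
      e.eval τ = g j) :
    Spec (Prog.forTo x n (Prog.emit e)) σ (N * (e.cost + 6 + 8) + 6)
      (fun τ => Out τ (ℓ ++ (List.range N).map g)) := by
  refine (Spec.forTo_emit (B := e.cost + 6) (fun j => [g j]) (fun _ _ => True) hn ?_ ?_ hx h trivial
    ?_).mono le_rfl fun τ _ h => ?_
  · simp [Prog.emit, Prog.wregs, hx]
  · simp [Prog.emit, Prog.wregs, Prog.forTo, hn0, hnx]
  · intro j hj τ ℓ' hF hτ _ hO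
    exact (Spec.emit hO e (hg j hj τ hF hτ) le_rfl).mono le_rfl fun ρ _ h => ⟨trivial, h⟩
  · rw [List.map_eq_flatMap]
    exact h.2

theorem map_zero_eq {l : List ℕ} {M : ℕ} (h : l.length = M) :
    (List.range M).map (fun _ => (0 : ℤ)) = l.map fun _ => 0 := by
  rw [List.map_const', List.map_const', List.length_range, h]

/-- Append the edges of the vertices of the union, for the answer for `a`. -/
def emitOld : Prog :=
  .assign 9 (.lit 0) ;;
  .forTo 18 3 (.forTo 6 3 (.emit (.get 2 (.add (.reg 9) (.reg 6)))) ;;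
    .forTo 6 13 (.emit (.lit 0)) ;;
    .assign 9 (.add (.reg 9) (.reg 3)))

theorem spec_emitOld {σ : State} {N : ℕ} {f : ℕ → ℕ → ℤ} {ℓ : List ℤ} {tl : List ℕ}
    (h3 : σ.reg 3 = N) (h13 : σ.reg 13 = tl.length) (hM : MatrixAt N f σ) (h : Out σ ℓ)
    (htl : tl.length ≤ N) :
    Spec emitOld σ (N * (N * 40 + 40) + 10) (fun τ => Out τ (ℓ ++ (List.range N).flatMap fun v =>
      ((List.range N).map fun w => f v w) ++ tl.map fun _ => 0)) := by
  refine Spec.mono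
    (B := 2 + (N * (((N * (4 + 6 + 8) + 6) + ((tl.length * (1 + 6 + 8) + 6) + 4)) + 8) + 6))
    (R := _) ?_ (by nlinarith) (fun _ _ h => h)
  refine spec_flat_seq rfl (by decide) ?_
  refine (Spec.forTo_emit (fun v => ((List.range N).map fun w => f v w) ++ tl.map fun _ => (0 : ℤ))
    (fun j τ => τ.reg 9 = j * N) ?_ (by decide) (by decide) (by decide) ?_ ?_ ?_).mono le_rfl
    fun τ _ h => h.2
  · simp [Prog.exec, h3]
  · exact h.congr (by simp [Prog.exec]) rfl
  · simp [Prog.exec, Expr.eval]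
  · intro j hj τ ℓ' hF hτ h9 hO
    have a2 : τ.arr 2 = σ.arr 2 := by rw [hF.2 2 (by decide)]; simp [Prog.exec]
    have r3 : τ.reg 3 = N := by rw [hF.1 3 (by decide)]; simp [Prog.exec, h3]
    have r13 : τ.reg 13 = tl.length := by rw [hF.1 13 (by decide)]; simp [Prog.exec, h13]
    refine Spec.seq (Spec.emit_row (fun w => f j w) r3 (by decide) (by decide) (by decide) hO ?_) ?_
    · intro w hw ρ hG hρ
      simp only [Expr.eval, hρ, hG.1 9 (by decide), h9, hG.2 2 (by decide), a2]
      exact hM j hj w hw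
    · intro ρ hG hO
      refine Spec.seq (Spec.emit_row (fun _ => 0) ((hG.1 13 (by decide)).trans r13) (by decide)
        (by decide) (by decide) hO fun _ _ _ _ _ => rfl) ?_
      intro φ hH hO
      refine Spec.of_flat rfl (by decide) ⟨?_, ?_⟩
      · simp only [Prog.exec, Expr.eval, State.setReg_reg, hH.1 9 (by decide), hG.1 9 (by decide),
          h9, hH.1 3 (by decide), hG.1 3 (by decide), r3]
        simp
        ring
      · refine Out.congr (σ := φ) ?_ (by simp [Prog.exec]) rfl
        rw [map_zero_eq rfl] at hO
        simpa using hO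

/-- Append the edges of the new vertices of the answer for `a`. -/
def emitNew : Prog :=
  .assign 9 (.lit 0) ;;
  .forTo 18 3 (.ifNonzero (.get 3 (.reg 18))
      (.forTo 6 3 (.assign 33 (.lit 0) ;;
          .ite (.sub (.get 8 (.reg 18)) (.lit 1))
            (.ifZero (.sub (.reg 6) (.reg 25)) (.assign 33 (.lit 1)) .skip)
            (.ite (.get 8 (.reg 18)) (.assign 33 (.get 2 (.add (.reg 9) (.reg 6))) ;;
                .ifZero (.reg 33) (.ite (.sub (.reg 18) (.reg 6))
                  (.assign 33 (.sub (.lit 0) (.get 4 (.reg 6)))) .skip) .skip) .skip) ;;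
          .emit (.reg 33)) ;;
        .forTo 6 13 (.emit (.lit 0))) ;;
    .assign 9 (.add (.reg 9) (.reg 3)))

theorem spec_emitNew {σ : State} {S : Merged} {z : ℕ} {ty : ℕ → ℕ} {ℓ : List ℤ} {tl : List ℕ}
    (h3 : σ.reg 3 = S.N) (h13 : σ.reg 13 = tl.length) (h25 : σ.reg 25 = z)
    (hM : MatrixAt S.N (fun v w => S.edge v w) σ) (hmm : ∀ v : ℕ, σ.arr 3 v = S.mm v)
    (hdm : ∀ v : ℕ, σ.arr 4 v = S.dm v) (h8 : ∀ v < S.N, σ.arr 8 v = ty v)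
    (hty : ∀ v < S.N, ty v ≤ 2) (h : Out σ ℓ) (hlen : tl.length ≤ S.N)
    (htl : tl = (List.range S.N).filter fun v => S.mm v ≠ 0) :
    Spec emitNew σ (S.N * (S.N * 75 + 50) + 10) (fun τ => Out τ (ℓ ++ tl.flatMap fun v =>
      ((List.range S.N).map fun w => (S.newEdge z (ty v) v w : ℤ)) ++ tl.map fun _ => 0)) := by
  refine Spec.mono (B := 2 + (S.N * (((S.N * (49 + 8) + 6 + (tl.length * (1 + 6 + 8) + 6) + 8) + 4)
    + 8) + 6)) (R := _) ?_ (by nlinarith) (fun _ _ h => h)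
  refine spec_flat_seq rfl (by decide) ?_
  refine (Spec.forTo_emit (ℓ := ℓ)
    (B := (S.N * (49 + 8) + 6 + (tl.length * (1 + 6 + 8) + 6) + 8) + 4)
    (fun v => if S.mm v ≠ 0 then
      ((List.range S.N).map fun w => (S.newEdge z (ty v) v w : ℤ)) ++ tl.map fun _ => (0 : ℤ)
      else []) (fun j τ => τ.reg 9 = j * S.N) ?_ (by decide) (by decide) (by decide) ?_ ?_
      ?_).mono le_rfl fun τ _ h => ?_
  · simp [Prog.exec, h3]
  · exact h.congr (by simp [Prog.exec]) rfl
  · simp [Prog.exec, Expr.eval]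
  · intro j hj τ ℓ' hF hτ h9 hO
    have a2 : τ.arr 2 = σ.arr 2 := by rw [hF.2 2 (by decide)]; simp [Prog.exec]
    have a3 : τ.arr 3 = σ.arr 3 := by rw [hF.2 3 (by decide)]; simp [Prog.exec]
    have a4 : τ.arr 4 = σ.arr 4 := by rw [hF.2 4 (by decide)]; simp [Prog.exec]
    have a8 : τ.arr 8 = σ.arr 8 := by rw [hF.2 8 (by decide)]; simp [Prog.exec]
    have r3 : τ.reg 3 = S.N := by rw [hF.1 3 (by decide)]; simp [Prog.exec, h3]
    have r13 : τ.reg 13 = tl.length := by rw [hF.1 13 (by decide)]; simp [Prog.exec, h13]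
    have r25 : τ.reg 25 = z := by rw [hF.1 25 (by decide)]; simp [Prog.exec, h25]
    refine Spec.seq (R₁ := fun ρ => Out ρ (ℓ' ++ if S.mm j ≠ 0 then
      ((List.range S.N).map fun w => (S.newEdge z (ty j) j w : ℤ)) ++ tl.map fun _ => (0 : ℤ)
      else [])) ?_ ?_
    · refine Spec.ifNonzero (B := S.N * (49 + 8) + 6 + (tl.length * (1 + 6 + 8) + 6)) (by omega)
        (by simp only [Expr.cost]; omega) ?_ ?_
      · intro hm
        have hm : S.mm j ≠ 0 := by simpa [Expr.eval, hτ, a3, hmm, sign_cast_eq_zero] using hm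
        rw [if_pos hm]
        refine Spec.seq (R₁ := fun ρ => Out ρ (ℓ' ++
          (List.range S.N).map fun w => (S.newEdge z (ty j) j w : ℤ))) ?_ ?_
        · refine (Spec.forTo_emit (ℓ := ℓ') (B := 49) (fun w => [(S.newEdge z (ty j) j w : ℤ)])
            (fun _ _ => True) r3 (by decide) (by decide) (by decide) hO trivial ?_).mono le_rfl
            fun ρ _ h => ?_
          · intro w hw ρ ℓ'' hG hρ _ hO
            refine Spec.mono (B := 2 + (40 + 7)) (R := _) ?_ le_rfl fun _ _ h => ⟨trivial, h⟩
            refine spec_flat_seq rfl (by decide) ?_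
            refine Spec.seq (R₁ := fun φ => φ.reg 33 = (S.newEdge z (ty j) j w : ℤ)) ?_ ?_
            · refine Spec.of_flat rfl (by decide) ?_
              have b2 := (hG.2 2 (by decide)).trans a2
              have b4 := (hG.2 4 (by decide)).trans a4
              have b8 := (hG.2 8 (by decide)).trans a8
              have q18 := (hG.1 18 (by decide)).trans hτ
              have q25 := (hG.1 25 (by decide)).trans r25
              have q9 := (hG.1 9 (by decide)).trans h9
              have hMj : σ.arr 2 (j * S.N + w) = S.edge j w := hM j hj w hw
              simp only [Prog.exec, exec_ifZero, Expr.eval, State.setReg_reg, State.setReg_arr,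
                Nat.reduceEqDiff, if_false, if_true, q18, q25, q9, hρ, b2, b4, b8, hMj, hdm,
                h8 j hj, sub_eq_zero, Nat.cast_inj, sign_cast_eq_zero]
              have hj2 := hty j hj
              interval_cases hj' : ty j
              · simp [Merged.newEdge]
              · by_cases he : S.edge j w = 0
                · by_cases hwj : w < j
                  · simp [Merged.newEdge, he, hwj]
                  · simp [Merged.newEdge, he, hwj]
                · simp [Merged.newEdge, he]
              · by_cases hwz : w = z
                · simp [Merged.newEdge, hwz]
                · simp [Merged.newEdge, hwz]
            · intro φ hφ h33
              refine Spec.emit (Out.congr hO ?_ ?_) _ h33 (by decide)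
              · rw [hφ.1 0 (by decide)]
                simp [Prog.exec]
              · rw [hφ.2 1 (by decide)]
                simp [Prog.exec]
          · rw [List.map_eq_flatMap]
            exact h.2
        · intro ρ hG hO
          refine (Spec.emit_row (fun _ => 0) ((hG.1 13 (by decide)).trans r13) (by decide)
            (by decide) (by decide) hO fun _ _ _ _ _ => rfl).mono le_rfl fun φ _ h => ?_
          rw [map_zero_eq rfl, List.append_assoc] at h
          exact h
      · intro hm
        have hm : S.mm j = 0 := by simpa [Expr.eval, hτ, a3, hmm, sign_cast_eq_zero] using hm
        simpa [hm] using hO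
    · intro ρ hG hO
      refine Spec.of_flat rfl (by decide) ⟨?_, ?_⟩
      · simp only [Prog.exec, Expr.eval, State.setReg_reg, hG.1 9 (by decide),
          h9, hG.1 3 (by decide), r3]
        simp
        ring
      · exact Out.congr hO (by simp [Prog.exec]) rfl
  · have hg := filter_flatMap (List.range S.N) (fun v => decide (S.mm v ≠ 0)) fun v =>
      ((List.range S.N).map fun w => (S.newEdge z (ty v) v w : ℤ)) ++ tl.map fun _ => (0 : ℤ)
    rw [← htl] at hg
    rw [hg]
    simpa using h.2

/-- Append the values of an expression for the `j < N` with a given property to the output. -/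
theorem Spec.emit_filter {c e : Expr} {σ : State} {x n N : ℕ} {ℓ : List ℤ} (p : ℕ → Bool)
    (g : ℕ → ℤ) (hn : σ.reg n = N) (hx : x ≠ 0) (hn0 : n ≠ 0) (hnx : n ≠ x) (h : Out σ ℓ)
    (hg : ∀ j < N, ∀ τ, Frame (Prog.forTo x n (Prog.ifNonzero c (Prog.emit e))) σ τ →
      τ.reg x = j → (c.eval τ = 0 ↔ p j = false) ∧ e.eval τ = g j) :
    Spec (Prog.forTo x n (Prog.ifNonzero c (Prog.emit e))) σ
      (N * ((2 * c.cost + 4 + (e.cost + 6)) + 8) + 6)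
      (fun τ => Out τ (ℓ ++ ((List.range N).filter p).map g)) := by
  refine (Spec.forTo_emit (B := 2 * c.cost + 4 + (e.cost + 6)) (ℓ := ℓ)
    (fun j => if p j = true then [g j] else []) (fun _ _ => True) hn ?_ ?_ hx h trivial
    ?_).mono le_rfl fun τ _ h => ?_
  · simp [Prog.ifNonzero, Prog.emit, Prog.wregs, hx]
  · simp [Prog.ifNonzero, Prog.emit, Prog.wregs, Prog.forTo, hn0, hnx]
  · intro j hj τ ℓ' hF hτ _ hO
    obtain ⟨h1, h2⟩ := hg j hj τ hF hτ
    refine Spec.ifNonzero (B := e.cost + 6) (by omega) le_rfl (fun hc => ?_) fun hc => ?_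
    · rw [if_pos (by simpa [h1] using hc)]
      exact (Spec.emit hO e h2 le_rfl).mono le_rfl fun ρ _ h => ⟨trivial, h⟩
    · rw [if_neg (by simpa using h1.1 hc), List.append_nil]
      exact ⟨trivial, hO⟩
  · rw [List.map_eq_flatMap, filter_flatMap]
    exact h.2

/-- Append the answer "yes" for `a`. -/
def emitA : Prog :=
  .emit (.lit 1) ;; .emit (.add (.reg 3) (.reg 13)) ;; emitOld ;; emitNew ;;
  .forTo 18 3 (.emit (.lit 0)) ;;
  .forTo 18 3 (.ifNonzero (.get 3 (.reg 18)) (.emit (.get 9 (.reg 18))))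

theorem spec_emitA {σ : State} {S : Merged} {z : ℕ} {ty : ℕ → ℕ} {mk : ℕ → SignType} {ℓ : List ℤ}
    {tl : List ℕ}
    (h3 : σ.reg 3 = S.N) (h13 : σ.reg 13 = tl.length) (h25 : σ.reg 25 = z)
    (hM : MatrixAt S.N (fun v w => S.edge v w) σ) (hmm : ∀ v : ℕ, σ.arr 3 v = S.mm v)
    (hdm : ∀ v : ℕ, σ.arr 4 v = S.dm v) (h8 : ∀ v < S.N, σ.arr 8 v = ty v ∧ σ.arr 9 v = mk v)
    (hty : ∀ v < S.N, ty v ≤ 2) (h : Out σ ℓ) (hlen : tl.length ≤ S.N)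
    (htl : tl = (List.range S.N).filter fun v => S.mm v ≠ 0) :
    Spec emitA σ (S.N * (S.N * 115 + 150) + 100) (fun τ => Out τ (ℓ ++ 1 ::
      ((S.N + tl.length : ℕ) : ℤ) ::
        (((List.range S.N).flatMap fun v =>
            ((List.range S.N).map fun w => (S.edge v w : ℤ)) ++ tl.map fun _ => 0) ++
          (tl.flatMap fun v =>
            ((List.range S.N).map fun w => (S.newEdge z (ty v) v w : ℤ)) ++ tl.map fun _ => 0) ++
          ((List.range S.N).map fun _ => 0) ++ tl.map fun v => (mk v : ℤ)))) := by
  refine Spec.mono (B := 20 + (20 + ((S.N * (S.N * 40 + 40) + 10) + ((S.N * (S.N * 75 + 50) + 10) +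
    ((S.N * (1 + 6 + 8) + 6) + (S.N * ((2 * 2 + 4 + (2 + 6)) + 8) + 6)))))) (R := _) ?_
    (by nlinarith) (fun _ _ h => h)
  refine Spec.seq (Spec.emit h (z := 1) _ rfl (by decide)) fun τ1 hF h1 => ?_
  have hF1 : Frame emitA σ τ1 := hF.weaken (by decide) (by decide)
  refine Spec.seq (Spec.emit h1 (z := ((S.N + tl.length : ℕ) : ℤ)) _ ?_ (by decide))
    fun τ2 hF h2 => ?_
  · simp [Expr.eval, hF1.1 3 (by decide), hF1.1 13 (by decide), h3, h13]
  have hF2 : Frame emitA σ τ2 := hF1.trans (hF.weaken (by decide) (by decide))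
  refine Spec.seq (spec_emitOld (f := fun v w => S.edge v w) ((hF2.1 3 (by decide)).trans h3)
    ((hF2.1 13 (by decide)).trans h13) ?_ h2 hlen) fun τ3 hF h3' => ?_
  · unfold MatrixAt
    rwa [hF2.2 2 (by decide)]
  have hF3 : Frame emitA σ τ3 := hF2.trans (hF.weaken (by decide) (by decide))
  refine Spec.seq (spec_emitNew ((hF3.1 3 (by decide)).trans h3)
    ((hF3.1 13 (by decide)).trans h13) ((hF3.1 25 (by decide)).trans h25) ?_ ?_ ?_
    (ty := ty) ?_ hty h3' hlen htl) fun τ4 hF h4 => ?_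
  · unfold MatrixAt
    rwa [hF3.2 2 (by decide)]
  · rwa [hF3.2 3 (by decide)]
  · rwa [hF3.2 4 (by decide)]
  · rw [hF3.2 8 (by decide)]
    exact fun v hv => (h8 v hv).1
  have hF4 : Frame emitA σ τ4 := hF3.trans (hF.weaken (by decide) (by decide))
  refine Spec.seq (Spec.emit_row (fun _ => 0) ((hF4.1 3 (by decide)).trans h3) (by decide)
    (by decide) (by decide) h4 fun _ _ _ _ _ => rfl) fun τ5 hF h5 => ?_
  have hF5 : Frame emitA σ τ5 := hF4.trans (hF.weaken (by decide) (by decide))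
  refine (Spec.emit_filter (fun v => S.mm v ≠ 0) (fun v => (mk v : ℤ))
    ((hF5.1 3 (by decide)).trans h3) (by decide) (by decide) (by decide) h5 ?_).mono le_rfl
    fun τ6 _ h6 => ?_
  · intro j hj ρ hG hρ
    have b3 := (hG.2 3 (by decide)).trans (hF5.2 3 (by decide))
    have b9 := (hG.2 9 (by decide)).trans (hF5.2 9 (by decide))
    simp [Expr.eval, hρ, b3, b9, hmm, (h8 j hj).2, sign_cast_eq_zero]
  · rw [← htl] at h6
    simpa only [List.append_assoc, List.cons_append, List.nil_append] using h6

/-- Append the answer "yes" for `t`. -/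
def emitT : Prog :=
  .emit (.lit 1) ;; .emit (.reg 10) ;; .assign 9 (.lit 0) ;;
  .forTo 18 3 (.ifNonzero (.get 5 (.reg 18))
      (.forTo 6 3 (.ifNonzero (.get 5 (.reg 6)) (.emit (.get 2 (.add (.reg 9) (.reg 6)))))) ;;
    .assign 9 (.add (.reg 9) (.reg 3))) ;;
  .forTo 18 3 (.ifNonzero (.get 5 (.reg 18)) (.emit (.get 4 (.reg 18))))

theorem spec_emitT {σ : State} {S : Merged} {ℓ : List ℤ} {tl : List ℕ}
    (h3 : σ.reg 3 = S.N) (h10 : σ.reg 10 = tl.length)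
    (hM : MatrixAt S.N (fun v w => S.edge v w) σ) (hk : ∀ v < S.N, σ.arr 5 v = 0 ↔ S.kind v = false)
    (hdm : ∀ v : ℕ, σ.arr 4 v = S.dm v) (h : Out σ ℓ)
    (htl : tl = (List.range S.N).filter S.kind) :
    Spec emitT σ (S.N * (S.N * 115 + 150) + 100) (fun τ => Out τ (ℓ ++ 1 :: (tl.length : ℤ) ::
        ((tl.flatMap fun v => tl.map fun w => (S.edge v w : ℤ)) ++
          tl.map fun v => (S.dm v : ℤ)))) := by
  refine Spec.mono
    (B := 20 + (20 + (2 + ((S.N * ((((S.N * ((2 * 2 + 4 + (4 + 6)) + 8) + 6) + 8) + 4) + 8)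
      + 6) + (S.N * ((2 * 2 + 4 + (2 + 6)) + 8) + 6))))) (R := _) ?_
    (by nlinarith) (fun _ _ h => h)
  refine Spec.seq (Spec.emit h (z := 1) _ rfl (by decide)) fun τ1 hF h1 => ?_
  have hF1 : Frame emitT σ τ1 := hF.weaken (by decide) (by decide)
  refine Spec.seq (Spec.emit h1 (z := tl.length) _ ?_ (by decide)) fun τ2 hF h2 => ?_
  · simp [Expr.eval, hF1.1 10 (by decide), h10]
  have hF2 : Frame emitT σ τ2 := hF1.trans (hF.weaken (by decide) (by decide))
  refine spec_flat_seq rfl (by decide) ?_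
  refine Spec.seq (R₁ := fun τ => Out τ (ℓ ++ [1] ++ [(tl.length : ℤ)] ++
    tl.flatMap fun v => tl.map fun w => (S.edge v w : ℤ))) ?_ ?_
  · refine (Spec.forTo_emit (B := (((S.N * ((2 * 2 + 4 + (4 + 6)) + 8) + 6) + 8) + 4))
      (ℓ := ℓ ++ [1] ++ [(tl.length : ℤ)])
      (fun v => if S.kind v = true then tl.map fun w => (S.edge v w : ℤ) else [])
      (fun j τ => τ.reg 9 = j * S.N) ?_ (by decide) (by decide) (by decide) ?_ ?_
      ?_).mono le_rfl fun τ _ h => ?_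
    · simp [Prog.exec, h3, hF2.1 3 (by decide)]
    · exact h2.congr (by simp [Prog.exec]) rfl
    · simp [Prog.exec, Expr.eval]
    · intro j hj τ ℓ' hF hτ h9 hO
      have a2 : τ.arr 2 = σ.arr 2 := by
        rw [hF.2 2 (by decide)]; simp [Prog.exec, hF2.2 2 (by decide)]
      have a5 : τ.arr 5 = σ.arr 5 := by
        rw [hF.2 5 (by decide)]; simp [Prog.exec, hF2.2 5 (by decide)]
      have r3 : τ.reg 3 = S.N := by
        rw [hF.1 3 (by decide)]; simp [Prog.exec, hF2.1 3 (by decide), h3]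
      refine Spec.seq (R₁ := fun ρ => Out ρ (ℓ' ++
        if S.kind j = true then tl.map fun w => (S.edge j w : ℤ) else [])) ?_ ?_
      · refine Spec.ifNonzero (B := S.N * ((2 * 2 + 4 + (4 + 6)) + 8) + 6) (by omega)
          (by simp only [Expr.cost]; omega) ?_ ?_
        · intro hm
          have hm : S.kind j = true := by simpa [Expr.eval, hτ, a5, hk j hj] using hm
          rw [if_pos hm, htl]
          refine Spec.emit_filter S.kind (fun w => (S.edge j w : ℤ)) r3 (by decide) (by decide)
            (by decide) hO ?_
          intro w hw ρ hG hρ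
          have b5 := (hG.2 5 (by decide)).trans a5
          have b2 := (hG.2 2 (by decide)).trans a2
          have q9 := (hG.1 9 (by decide)).trans h9
          refine ⟨?_, ?_⟩
          · simp only [Expr.eval, hρ, b5, hk w hw]
          · simp only [Expr.eval, hρ, b2, q9]
            exact hM j hj w hw
        · intro hm
          have hm : S.kind j = false := by simpa [Expr.eval, hτ, a5, hk j hj] using hm
          simpa [hm] using hO
      · intro ρ hG hO
        refine Spec.of_flat rfl (by decide) ⟨?_, ?_⟩
        · simp only [Prog.exec, Expr.eval, State.setReg_reg, hG.1 9 (by decide),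
            h9, hG.1 3 (by decide), r3]
          simp
          ring
        · exact Out.congr hO (by simp [Prog.exec]) rfl
    · have hg := filter_flatMap (List.range S.N) S.kind fun v =>
        tl.map fun w => (S.edge v w : ℤ)
      rw [← htl] at hg
      rw [hg]
      exact h.2
  · intro τ hF h'
    have a4 : τ.arr 4 = σ.arr 4 := by
      rw [hF.2 4 (by decide)]; simp [Prog.exec, hF2.2 4 (by decide)]
    have a5 : τ.arr 5 = σ.arr 5 := by
      rw [hF.2 5 (by decide)]; simp [Prog.exec, hF2.2 5 (by decide)]
    have r3 : τ.reg 3 = S.N := by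
      rw [hF.1 3 (by decide)]; simp [Prog.exec, hF2.1 3 (by decide), h3]
    refine (Spec.emit_filter S.kind (fun v => (S.dm v : ℤ)) r3 (by decide) (by decide)
      (by decide) h' ?_).mono le_rfl fun τ6 _ h6 => ?_
    · intro j hj ρ hG hρ
      have b5 := (hG.2 5 (by decide)).trans a5
      have b4 := (hG.2 4 (by decide)).trans a4
      simp only [Expr.eval, hρ, b5, b4, hk j hj, hdm, true_and]
    · rw [← htl] at h6
      simpa only [List.append_assoc, List.cons_append, List.nil_append] using h6

/-- Write the two answers. -/
def answerProg : Prog :=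
  .ifZero (.reg 23) (.ite (.reg 19) emitA (.emit (.lit 0))) (.emit (.lit 0)) ;;
  .ifZero (.reg 27) emitT (.emit (.lit 0))

/-! ### Correctness of the answers -/

namespace Merged.Decides

variable {S : Merged} {Z W : ℕ → ℤ}

theorem neg_iff (D : S.Decides Z W) {v : ℕ} (hv : v < S.N) :
    ¬ S.Leaf v ∧ S.fexp v < 0 ↔ 0 ≤ Z v ∧ Z v < Z S.N := by
  by_cases hl : S.Leaf v
  · have := D.leaf v hv hl
    simp only [hl, not_true_eq_false, false_and, false_iff]
    omega
  · have h1 := D.nonneg v hv hl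
    have h2 := D.sign v hv hl
    simp only [hl, not_false_eq_true, true_and]
    omega

theorem nonneg_iff (D : S.Decides Z W) {v : ℕ} (hv : v < S.N) :
    ¬ S.Leaf v ∧ 0 ≤ S.fexp v ↔ Z S.N ≤ Z v := by
  have h0 := D.anchor
  by_cases hl : S.Leaf v
  · have := D.leaf v hv hl
    simp only [hl, not_true_eq_false, false_and, false_iff]
    omega
  · have h2 := D.sign v hv hl
    simp only [hl, not_false_eq_true, true_and]
    omega

/-- The part with negative exponents is at most the number of its terms. -/
theorem abs_neg_le (D : S.Decides Z W) [DecidablePred S.Leaf] :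
    |∑ v ∈ Finset.range S.N, if ¬ S.Leaf v ∧ S.fexp v < 0 then
      ((S.mm v : ℤ) : ℚ) * 2 ^ S.fexp v else 0| ≤ S.numNeg Z S.N := by
  refine (Finset.abs_sum_le_sum_abs _ _).trans ?_
  rw [Merged.numNeg, Nat.cast_sum]
  refine Finset.sum_le_sum fun v hv => ?_
  have hv := Finset.mem_range.1 hv
  have hn := D.neg_iff hv
  by_cases h : ¬ S.Leaf v ∧ S.fexp v < 0
  · rw [if_pos h]
    by_cases hm : S.mm v = 0
    · simp [hm]
    · rw [if_pos ⟨hm, hn.1 h⟩, abs_mul, abs_zpow, Nat.cast_one]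
      have h1 : |((S.mm v : ℤ) : ℚ)| ≤ 1 := by exact_mod_cast abs_sign_le (S.mm v)
      have h2 : |(2 : ℚ)| ^ S.fexp v ≤ 1 := by
        rw [abs_of_pos two_pos]
        exact zpow_le_one_of_nonpos₀ (by norm_num) h.2.le
      exact mul_le_one₀ h1 (by positivity) h2
  · rw [if_neg h, abs_zero]
    positivity

theorem numNeg_le : S.numNeg Z S.N ≤ S.N := by
  refine (Finset.sum_le_sum (g := fun _ => 1) fun v _ => ?_).trans (by simp)
  split_ifs <;> omega

/-- The part with nonnegative exponents is an integer, and the other part is at most `S.N`, so that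
only the integers up to this bound have to be tested. -/
theorem shift_int_iff (hS : S.Valid) (D : S.Decides Z W) :
    (∃ p : ℤ, S.shift = p) ↔ ∃ c : ℤ, |c| ≤ S.N ∧
      (∑ v ∈ Finset.range S.N, if Z v < Z S.N then (S.mm v : ℤ) * W v else 0) = c * W S.N := by
  classical
  have hsplit : S.shift = (((∑ v ∈ Finset.range S.N, if ¬ S.Leaf v ∧ 0 ≤ S.fexp v then
      (S.mm v : ℤ) * 2 ^ (S.fexp v).toNat else 0 : ℤ)) : ℚ) +
      ∑ v ∈ Finset.range S.N, if ¬ S.Leaf v ∧ S.fexp v < 0 then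
        ((S.mm v : ℤ) : ℚ) * 2 ^ S.fexp v else 0 := by
    rw [hS.shift_eq, Int.cast_sum, ← Finset.sum_add_distrib]
    refine Finset.sum_congr rfl fun v _ => ?_
    by_cases hl : S.Leaf v
    · simp [hl]
    · by_cases hf : 0 ≤ S.fexp v
      · rw [if_neg hl, if_pos ⟨hl, hf⟩, if_neg (by omega), add_zero, Int.cast_mul, Int.cast_pow,
          ← zpow_natCast, Int.toNat_of_nonneg hf]
        norm_num
      · rw [if_neg hl, if_neg (by omega), if_pos ⟨hl, not_le.1 hf⟩, Int.cast_zero, zero_add]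
  constructor
  · rintro ⟨p, hp⟩
    rw [hsplit, ← eq_sub_iff_add_eq', ← Int.cast_sub] at hp
    have hle : |p - ∑ v ∈ Finset.range S.N, if ¬ S.Leaf v ∧ 0 ≤ S.fexp v then
        (S.mm v : ℤ) * 2 ^ (S.fexp v).toNat else 0| ≤ S.N := by
      have h := D.abs_neg_le
      rw [hp] at h
      have h' := h.trans (Nat.cast_le.2 (numNeg_le (S := S) (Z := Z)))
      exact_mod_cast h'
    exact ⟨_, hle, (D.neg _ hle).1 hp⟩
  · rintro ⟨c, hc, h⟩
    rw [hsplit, (D.neg c hc).2 h]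
    exact ⟨_, (Int.cast_add _ _).symm⟩

theorem exists_a_circuit (hS : S.Valid) (D : S.Decides Z W) {z q : ℕ} {sg : SignType}
    (hsg : sg ≠ 0) (hq : q ≤ S.N) (hz : 0 < S.N → z < S.N ∧ S.Leaf z)
    (hsum : (∑ v ∈ Finset.range S.N, if Z v < Z S.N then (S.mm v : ℤ) * W v else 0) =
      sg * q * W S.N) {tl : List ℕ} (htl : tl = (List.range S.N).filter fun v => S.mm v ≠ 0) :
    ∃ P : PowerCircuit, P.numVertices = S.N + tl.length ∧ P.numMarked = tl.length ∧
      (P.number : ℚ) = S.shift ∧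
      P.encode = ((S.N + tl.length : ℕ) : ℤ) ::
        (((List.range S.N).flatMap fun v =>
            ((List.range S.N).map fun w => (S.edge v w : ℤ)) ++ tl.map fun _ => 0) ++
          (tl.flatMap fun v => ((List.range S.N).map fun w =>
            (S.newEdge z (S.newType Z q v) v w : ℤ)) ++ tl.map fun _ => 0) ++
          ((List.range S.N).map fun _ => 0) ++ tl.map fun v => (S.newMark Z sg v : ℤ)) := by
  classical
  have habs : |(sg : ℤ)| = 1 := by
    rcases sg with _ | _ | _
    · exact absurd rfl hsg
    · rfl
    · rfl
  have hneg := (D.neg (sg * q) (by rw [abs_mul, habs]; simpa using hq)).2 hsum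
  have hle : q ≤ S.numNeg Z S.N := by
    have h := D.abs_neg_le
    rw [hneg] at h
    have h : |((sg : ℤ) * q : ℤ)| ≤ (S.numNeg Z S.N : ℤ) := by exact_mod_cast h
    rw [abs_mul, habs] at h
    simpa using h
  refine hS.exists_a_circuit hsg (fun v hv hm => ?_) (fun v hv hm h => ?_) (fun v hv hm => ?_)
    ?_ hz (by rw [hneg]; push_cast; rfl) htl
  · have h0 := D.anchor
    rw [newType, D.nonneg_iff hv]
    split_ifs <;> simp <;> omega
  · rw [D.neg_iff hv]
    rw [newType] at h
    split_ifs at h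
    all_goals omega
  · rw [newMark]
    exact if_congr (D.neg_iff hv).symm rfl rfl
  · rw [S.sum_newType, min_eq_left hle]

end Merged.Decides

/-! ### The algorithm -/

/-- What is known before the answers are written. -/
structure Analysed (S : Merged) (σ : State) : Prop where
  zero_iff : σ.reg 23 = 0 ↔ S.dsum S.N = 0
  total_iff : σ.reg 27 = 0 ↔ S.shift = 0
  found_iff : 0 < σ.reg 19 ↔ ∃ p : ℤ, S.shift = p
  circuit : ∃ (z : ℕ) (ty : ℕ → ℕ) (mk : ℕ → SignType) (tl : List ℕ),
    tl = ((List.range S.N).filter fun v => S.mm v ≠ 0) ∧ σ.reg 13 = tl.length ∧ σ.reg 25 = z ∧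
    (∀ v < S.N, σ.arr 8 v = ty v ∧ σ.arr 9 v = mk v) ∧ (∀ v < S.N, ty v ≤ 2) ∧
    (0 < σ.reg 19 → ∃ P : PowerCircuit, P.numVertices = S.N + tl.length ∧
      P.numMarked = tl.length ∧ (P.number : ℚ) = S.shift ∧
      P.encode = ((S.N + tl.length : ℕ) : ℤ) ::
        (((List.range S.N).flatMap fun v =>
            ((List.range S.N).map fun w => (S.edge v w : ℤ)) ++ tl.map fun _ => 0) ++
          (tl.flatMap fun v => ((List.range S.N).map fun w =>
            (S.newEdge z (ty v) v w : ℤ)) ++ tl.map fun _ => 0) ++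
          ((List.range S.N).map fun _ => 0) ++ tl.map fun v => (mk v : ℤ)))

/-- Decide the form of the element, and prepare the answers. -/
def analyseProg : Prog :=
  .assign 12 (.reg 3) ;; .assign 11 (.add (.reg 3) (.lit 4)) ;; roundsProg ;; decideProg ;;
  sumProg ;; .assign 12 (.add (.reg 3) (.lit 1)) ;; searchProg ;; typeProg

theorem spec_analyseProg {σ : State} {S : Merged} (hS : S.Valid) (h3 : σ.reg 3 = S.N)
    (hU : UnionAt S.N S σ) :
    Spec analyseProg σ (2000 * (S.N + 1) ^ 3) (Analysed S) := by
  -- The bound `L` for the agreement is `S.N + 3`; register `11` holds `L + 1`.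
  have hL : 4 * (S.N : ℤ) ≤ 2 ^ (S.N + 3) := by
    have h : (S.N : ℤ) < 2 ^ S.N := by exact_mod_cast Nat.lt_two_pow_self
    rw [pow_add]
    omega
  refine Spec.mono (B := 2 + (4 + ((S.N * (S.N * (S.N * 112 + (S.N + 3 + 1) * 20 + 88) + 36) + 6) +
    ((S.N * (S.N * 28 + 28) + S.N * 100 +
      (S.N + 1) * ((S.N + 1) * 84 + (S.N + 3 + 1) * 20 + 60) + 100) +
    ((S.N * 40 + 10) + (4 + (((S.N + 1) * 60 + 20) + (S.N * 70 + 10)))))))) (R := _) ?_ ?_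
    (fun _ _ h => h)
  swap
  · nlinarith [Nat.zero_le (S.N ^ 2), Nat.zero_le (S.N ^ 3)]
  refine spec_flat_seq rfl (by decide) (spec_flat_seq rfl (by decide) ?_)
  set σ' := (Prog.assign 11 (.add (.reg 3) (.lit 4))).exec ((Prog.assign 12 (.reg 3)).exec σ)
    with hσ'
  have s3 : σ'.reg 3 = S.N := by simp [hσ', Prog.exec, h3]
  have s12 : σ'.reg 12 = S.N := by simp [hσ', Prog.exec, Expr.eval, h3]
  have s11 : σ'.reg 11 = (S.N + 3 + 1 : ℕ) := by simp [hσ', Prog.exec, Expr.eval, h3]; ring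
  have sM : MatrixAt S.N (fun v w => S.edge v w) σ' := hU.edge
  have s3a : ∀ v : ℕ, σ'.arr 3 v = S.mm v := hU.mm
  have s4a : ∀ v : ℕ, σ'.arr 4 v = S.dm v := hU.dm
  refine Spec.seq (spec_roundsProg hS hL s3 s12 s11 sM) fun τ1 h1 hW => ?_
  refine Spec.seq (spec_decideProg hS hL ((h1.1 3 (by decide)).trans s3)
    ((h1.1 11 (by decide)).trans s11) (by unfold MatrixAt; rw [h1.2 2 (by decide)]; exact sM)
    (by rw [h1.2 4 (by decide)]; exact s4a) hW) ?_
  rintro τ2 h2 ⟨D, hd, z, hz, hz'⟩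
  have t3 : τ2.reg 3 = S.N := (h2.1 3 (by decide)).trans ((h1.1 3 (by decide)).trans s3)
  have t3a : ∀ v : ℕ, τ2.arr 3 v = S.mm v := by
    rw [h2.2 3 (by decide), h1.2 3 (by decide)]; exact s3a
  refine Spec.seq (spec_sumProg t3 t3a) ?_
  rintro τ3 hF3 ⟨hT, hR⟩
  refine spec_flat_seq rfl (by decide) ?_
  set τ3' := (Prog.assign 12 (.add (.reg 3) (.lit 1))).exec τ3 with hτ3'
  have u3 : τ3'.reg 3 = S.N := by simp [hτ3', Prog.exec, hF3.1 3 (by decide), t3]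
  have u12 : τ3'.reg 12 = (S.N + 1 : ℕ) := by
    simp [hτ3', Prog.exec, Expr.eval, hF3.1 3 (by decide), t3]
  have u26 : τ3'.reg 26 = τ3.reg 26 := by simp [hτ3', Prog.exec]
  have u27 : τ3'.reg 27 = τ3.reg 27 := by simp [hτ3', Prog.exec]
  have u23 : τ3'.reg 23 = τ2.reg 23 := by simp [hτ3', Prog.exec, hF3.1 23 (by decide)]
  have u25 : τ3'.reg 25 = τ2.reg 25 := by simp [hτ3', Prog.exec, hF3.1 25 (by decide)]
  have ua : ∀ A, A ∉ sumProg.warrs → τ3'.arr A = τ2.arr A := fun A hA => hF3.2 A hA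
  refine Spec.seq (spec_searchProg u3 u12) ?_
  rintro τ4 h4 ⟨q, sg, hsg, h28, h29, hq⟩
  rw [u26, hR, ua 7 (by decide)] at hq
  refine (spec_typeProg ((h4.1 3 (by decide)).trans u3)
    (by rw [h4.2 3 (by decide), ua 3 (by decide)]; exact t3a) h28 h29).mono le_rfl ?_
  rintro τ5 h5 ⟨hty, h13⟩
  have w19 : τ5.reg 19 = τ4.reg 19 := h5.1 19 (by decide)
  have w6 : τ4.arr 6 = τ2.arr 6 := (h4.2 6 (by decide)).trans (ua 6 (by decide))
  refine ⟨?_, ?_, ?_, z, S.newType (fun i => τ2.arr 6 i) q, S.newMark (fun i => τ2.arr 6 i) sg, _,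
    rfl, h13, ?_, ?_, ?_, ?_⟩
  · rw [h5.1 23 (by decide), h4.1 23 (by decide), u23, hd]
  · rw [h5.1 27 (by decide), h4.1 27 (by decide), u27, hT, D.total]
  · rw [w19, D.shift_int_iff hS]
    rcases hq with ⟨hf, hq, h⟩ | ⟨hf, h⟩
    · refine ⟨fun _ => ⟨sg * q, ?_, h⟩, fun _ => by rw [hf]; norm_num⟩
      rw [abs_mul, Nat.abs_cast]
      have h1 := abs_sign_le sg
      have h2 : (q : ℤ) ≤ S.N := by omega
      have h3 : (0 : ℤ) ≤ q := Int.natCast_nonneg q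
      nlinarith
    · refine ⟨fun h => by omega, ?_⟩
      rintro ⟨c, hc, hc'⟩
      exfalso
      have habs : (c.natAbs : ℤ) = |c| := Int.natCast_natAbs c
      obtain ⟨h1, h2⟩ := h c.natAbs (by omega)
      rcases Int.natAbs_eq c with h' | h'
      · exact h1 (by rw [hc', ← h'])
      · refine h2 (by rw [hc', ← neg_mul, ← h'])
  · rw [h5.1 25 (by decide), h4.1 25 (by decide), u25, hz]
  · rw [w6] at hty
    exact hty
  · intro v _
    rw [Merged.newType]
    split_ifs <;> omega
  · intro hf
    rw [w19] at hf
    rcases hq with ⟨-, hq, h⟩ | ⟨h0, -⟩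
    · exact D.exists_a_circuit hS hsg (by omega) hz' h rfl
    · omega

/-- What the two answers for a power sequence have to satisfy, in terms of the union of its
circuits. -/
structure IsAnswer (s : PowerSequence Gen) (ansA ansT : Option PowerCircuit) : Prop where
  a_iff : ansA.isSome ↔ ∃ p : ℤ, s.toB12 = (PresentedGroup.of Gen.a : B12) ^ p
  t_iff : ansT.isSome ↔ ∃ p : ℤ, s.toB12 = (PresentedGroup.of Gen.t : B12) ^ p
  a : ∀ P, ansA = some P → s.toB12 = PowerSequence.toB12 [(Gen.a, P)] ∧
    P.numVertices = (Merged.ofSeq s).N +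
      ((List.range (Merged.ofSeq s).N).filter fun v => (Merged.ofSeq s).mm v ≠ 0).length ∧
    P.numMarked =
      ((List.range (Merged.ofSeq s).N).filter fun v => (Merged.ofSeq s).mm v ≠ 0).length
  t : ∀ P, ansT = some P → s.toB12 = PowerSequence.toB12 [(Gen.t, P)] ∧
    P.numVertices = ((List.range (Merged.ofSeq s).N).filter (Merged.ofSeq s).kind).length ∧
    P.numMarked =
      ((List.range (Merged.ofSeq s).N).filter fun v => (Merged.ofSeq s).dm v ≠ 0).length

theorem spec_answerProg {σ : State} {s : PowerSequence Gen} {S : Merged} (hs : S = Merged.ofSeq s)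
    (h3 : σ.reg 3 = S.N) (h10 : σ.reg 10 = ((List.range S.N).filter S.kind).length)
    (hM : MatrixAt S.N (fun v w => S.edge v w) σ) (hmm : ∀ v : ℕ, σ.arr 3 v = S.mm v)
    (hdm : ∀ v : ℕ, σ.arr 4 v = S.dm v)
    (hk : ∀ v : ℕ, σ.arr 5 v = if v < S.N ∧ S.kind v = true then 1 else 0)
    (hA : Analysed S σ) (hO : Out σ []) :
    Spec answerProg σ (S.N * (S.N * 230 + 300) + 300) (fun τ =>
      ∃ ansA ansT, Out τ (encodeAnswer ansA ++ encodeAnswer ansT) ∧ IsAnswer s ansA ansT) := by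
  classical
  have hS : S.Valid := hs ▸ Merged.valid_ofSeq s
  have hact : ∀ x, action s.toB12 x = 2 ^ (-S.dsum S.N) * x + S.shift := by
    rw [hs]; exact Merged.action_toB12 s
  have hsingle : ∀ (g : Gen) (P : PowerCircuit),
      PowerSequence.toB12 [(g, P)] = PresentedGroup.of g ^ P.number := by
    intro g P
    simp [toB12_eq_prod]
  obtain ⟨z, ty, mk, tl, htl, h13, h25, h8, hty, hP⟩ := hA.circuit
  obtain ⟨Q, hQ1, hQ2, hQ3, hQ4⟩ := hS.exists_t_circuit
  have hlen : tl.length ≤ S.N := by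
    rw [htl]
    exact (List.length_filter_le _ _).trans (by simp)
  -- The answer for `a`, as a statement about the first half of the program.
  obtain ⟨ansA, hA1, hA2, hA3⟩ : ∃ ansA : Option PowerCircuit,
      Spec (.ifZero (.reg 23) (.ite (.reg 19) emitA (.emit (.lit 0))) (.emit (.lit 0))) σ
        (S.N * (S.N * 115 + 150) + 120) (fun τ => Out τ (encodeAnswer ansA)) ∧
      (ansA.isSome ↔ ∃ p : ℤ, s.toB12 = (PresentedGroup.of Gen.a : B12) ^ p) ∧
      (∀ P, ansA = some P → s.toB12 = PowerSequence.toB12 [(Gen.a, P)] ∧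
        P.numVertices = S.N + ((List.range S.N).filter fun v => S.mm v ≠ 0).length ∧
        P.numMarked = ((List.range S.N).filter fun v => S.mm v ≠ 0).length) := by
    by_cases h : σ.reg 23 = 0 ∧ 0 < σ.reg 19
    · obtain ⟨P, hP1, hP2, hP3, hP4⟩ := hP h.2
      have hg : s.toB12 = PresentedGroup.of Gen.a ^ P.number :=
        (eq_a_zpow_iff hact _).2 ⟨hA.zero_iff.1 h.1, hP3.symm⟩
      refine ⟨some P, ?_, ⟨fun _ => ⟨_, hg⟩, fun _ => rfl⟩, ?_⟩
      · refine Spec.ifZero (B := 2 + (S.N * (S.N * 115 + 150) + 100))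
          (by simp only [Expr.cost]; omega) (fun _ => ?_) (fun h' => absurd h.1 h')
        refine Spec.ite (fun _ => ?_) (fun h' => absurd h.2 h')
        refine (spec_emitA h3 h13 h25 hM hmm hdm h8 hty hO hlen htl).mono le_rfl
          fun τ _ h => ?_
        rw [encodeAnswer, hP4]
        exact h
      · rintro P' hP'
        obtain rfl := Option.some.inj hP'
        rw [hsingle, ← htl]
        exact ⟨hg, hP1, hP2⟩
    · refine ⟨none, ?_, ?_, by simp⟩
      · refine Spec.ifZero (B := 2 + 10) (by simp only [Expr.cost]; omega) (fun h0 => ?_)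
          (fun _ => (Spec.emit hO (z := 0) _ rfl le_rfl).mono (by simp [Expr.cost]) fun _ _ h => h)
        exact Spec.ite (fun h1 => absurd ⟨h0, h1⟩ h)
          (fun _ => Spec.emit hO (z := 0) _ rfl (by simp [Expr.cost]))
      · simp only [Option.isSome_none, Bool.false_eq_true, false_iff]
        rintro ⟨p, hp⟩
        obtain ⟨h1, h2⟩ := (eq_a_zpow_iff hact p).1 hp
        exact h ⟨hA.zero_iff.2 h1, hA.found_iff.2 ⟨p, h2⟩⟩
  obtain ⟨ansT, hT1, hT2, hT3⟩ : ∃ ansT : Option PowerCircuit,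
      (∀ τ, Frame (.ifZero (.reg 23) (.ite (.reg 19) emitA (.emit (.lit 0))) (.emit (.lit 0))) σ τ →
        Out τ (encodeAnswer ansA) →
        Spec (.ifZero (.reg 27) emitT (.emit (.lit 0))) τ (S.N * (S.N * 115 + 150) + 120)
          (fun τ => Out τ (encodeAnswer ansA ++ encodeAnswer ansT))) ∧
      (ansT.isSome ↔ ∃ p : ℤ, s.toB12 = (PresentedGroup.of Gen.t : B12) ^ p) ∧
      (∀ P, ansT = some P → s.toB12 = PowerSequence.toB12 [(Gen.t, P)] ∧
        P.numVertices = ((List.range S.N).filter S.kind).length ∧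
        P.numMarked = ((List.range S.N).filter fun v => S.dm v ≠ 0).length) := by
    by_cases h : σ.reg 27 = 0
    · have hg : s.toB12 = PresentedGroup.of Gen.t ^ Q.number :=
        (eq_t_zpow_iff hact _).2 ⟨hQ3.symm, hA.total_iff.1 h⟩
      refine ⟨some Q, ?_, ⟨fun _ => ⟨_, hg⟩, fun _ => rfl⟩, ?_⟩
      · intro τ hF hOτ
        refine Spec.ifZero (B := S.N * (S.N * 115 + 150) + 100)
          (by simp only [Expr.cost]; omega) (fun _ => ?_)
          (fun h' => absurd ((hF.1 27 (by decide)).trans h) h')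
        refine (spec_emitT ((hF.1 3 (by decide)).trans h3) ((hF.1 10 (by decide)).trans h10)
          ?_ (fun v hv => ?_) ?_ hOτ rfl).mono le_rfl fun τ _ h => ?_
        · unfold MatrixAt
          rw [hF.2 2 (by decide)]
          exact hM
        · rw [hF.2 5 (by decide), hk]
          simp [hv]
        · rw [hF.2 4 (by decide)]
          exact hdm
        · rw [encodeAnswer, hQ4]
          exact h
      · rintro P' hP'
        obtain rfl := Option.some.inj hP'
        rw [hsingle]
        exact ⟨hg, hQ1, hQ2⟩
    · refine ⟨none, ?_, ?_, by simp⟩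
      · intro τ hF hOτ
        exact Spec.ifZero (B := 10) (by simp only [Expr.cost]; omega)
          (fun h' => absurd ((hF.1 27 (by decide)).symm.trans h') h)
          (fun _ => Spec.emit hOτ (z := 0) _ rfl (by simp [Expr.cost]))
      · simp only [Option.isSome_none, Bool.false_eq_true, false_iff]
        rintro ⟨p, hp⟩
        exact h (hA.total_iff.2 ((eq_t_zpow_iff hact p).1 hp).2)
  refine (Spec.seq hA1 hT1).mono (by nlinarith) fun τ _ h => ⟨ansA, ansT, h, ?_⟩
  subst hs
  exact ⟨hA2, hT2, hA3, hT3⟩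

/-- The whole program: read the input twice, first to count the vertices and then to form the union
of the circuits, decide, and answer. -/
def mainProg : Prog :=
  .assign 2 (.lit 1) ;; .assign 1 (.add (.add (.get 0 (.lit 0)) (.get 0 (.lit 0))) (.lit 1)) ;;
  .loop (.reg 1) countBody ;;
  .assign 2 (.lit 1) ;; .assign 1 (.add (.add (.get 0 (.lit 0)) (.get 0 (.lit 0))) (.lit 1)) ;;
  .loop (.reg 1) fillBody ;; analyseProg ;; answerProg

theorem sum_sq_le {α : Type*} (l : List α) (f : α → ℕ) :
    (l.map fun x => f x * f x).sum ≤ (l.map f).sum * (l.map f).sum := by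
  induction l with
  | nil => simp
  | cons x l ih =>
    simp only [List.map_cons, List.sum_cons]
    nlinarith [Nat.zero_le (f x * (l.map f).sum)]

theorem spec_mainProg {k : ℕ} (m : Fin (k + 1) → PowerCircuit) (d : Fin k → PowerCircuit) {N : ℕ}
    (hN : (Merged.ofSeq (alternating m d)).N = N) :
    Spec mainProg (initial (encodeInput m d)) (4000 * (N + 1) ^ 3 + 200 * k) (fun τ =>
      ∃ ansA ansT, Out τ (encodeAnswer ansA ++ encodeAnswer ansT) ∧
        IsAnswer (alternating m d) ansA ansT) := by
  set s := alternating m d with hs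
  have hlen : s.length = k + k + 1 := length_alternating m d
  obtain ⟨hk, hin⟩ := (ListAt_initial (encodeInput m d)).cons
  rw [zero_add] at hin
  have hin := hin.seqAt
  rw [← hs] at hin
  have hsum : (s.map fun q => q.2.n).sum = N := by
    rw [← hN, Merged.ofSeq_N]
    rfl
  have hsq := sum_sq_le s fun q => q.2.n
  rw [hsum] at hsq
  have hB1 : (s.map fun q => 20 * q.2.n + 40 + 2).sum + 2 = 20 * N + 42 * (k + k + 1) + 2 := by
    simp only [add_assoc, List.sum_map_add, List.sum_map_mul_left, hsum, List.map_const',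
      List.sum_replicate, hlen, smul_eq_mul]
    ring
  have hB2 : (s.map fun q => 20 * (q.2.n * q.2.n) + 60 * q.2.n + 40 + 2).sum + 2 ≤
      20 * (N * N) + 60 * N + 42 * (k + k + 1) + 2 := by
    simp only [add_assoc, List.sum_map_add, List.sum_map_mul_left, hsum, List.map_const',
      List.sum_replicate, hlen, smul_eq_mul]
    omega
  refine Spec.mono (B := 2 + (8 + ((20 * N + 42 * (k + k + 1) + 2) + (2 + (8 +
    ((20 * (N * N) + 60 * N + 42 * (k + k + 1) + 2) + (2000 * (N + 1) ^ 3 +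
      (N * (N * 230 + 300) + 300)))))))) (R := _) ?_
    (by nlinarith [Nat.zero_le (N ^ 2), Nat.zero_le (N ^ 3)]) (fun _ _ h => h)
  refine spec_flat_seq rfl (by decide) (spec_flat_seq rfl (by decide) ?_)
  refine Spec.seq ((spec_count (s := s) ?_ ?_ ?_).mono hB1.le fun _ _ h => h) fun τ1 h1 h3 => ?_
  · simp [Prog.exec, Expr.eval, hk, hlen]
  · simpa [Prog.exec, Expr.eval] using hin
  · simp [Prog.exec, initial]
  have a1 : ∀ A, A ∉ countBody.warrs → τ1.arr A = (initial (encodeInput m d)).arr A :=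
    fun A hA => h1.2 A hA
  have r1 : ∀ x, x ∉ (Prog.seq (.assign 1 (.lit 0)) (.seq (.assign 2 (.lit 0)) countBody)).wregs →
      τ1.reg x = 0 := by
    intro x hx
    simp only [Prog.wregs, List.cons_append, List.nil_append, List.mem_cons, not_or] at hx
    rw [h1.1 x hx.2.2]
    simp [Prog.exec, hx.1, hx.2.1, initial]
  rw [hN] at h3
  refine spec_flat_seq rfl (by decide) (spec_flat_seq rfl (by decide) ?_)
  refine Spec.seq (R₁ := fun τ => UnionAt N (Merged.ofSeq s) τ)
    ((spec_fill (S := Merged.empty) (b := false) (N := N) (s := s) Merged.valid_empty hN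
      (alternates_alternating m d) ?_ ?_ ?_ ?_ ?_).mono hB2 fun _ _ h => h) fun τ2 h2 hU => ?_
  · simp [Prog.exec, Expr.eval, a1 0 (by decide), hk, hlen]
  · simp [Prog.exec, h3]
  · simp [Prog.exec, r1 7 (by decide)]
  · refine ⟨?_, ?_, ?_, ?_, ?_, ?_, ?_⟩
    · simp [Prog.exec, r1 8 (by decide), Merged.empty]
    · simp [Prog.exec, r1 9 (by decide), Merged.empty]
    · simp [Prog.exec, r1 10 (by decide), Merged.empty]
    · intro v hv w hw
      simp [Prog.exec, a1 2 (by decide), Merged.empty, initial]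
    · simp [Prog.exec, a1 3 (by decide), Merged.empty, initial]
    · simp [Prog.exec, a1 4 (by decide), Merged.empty, initial]
    · simp [Prog.exec, a1 5 (by decide), Merged.empty, initial]
  · simpa [Prog.exec, Expr.eval, a1 0 (by decide)] using hin
  have k3 : τ2.reg 3 = N := by
    rw [h2.1 3 (by decide)]
    simp [Prog.exec, h3]
  have k0 : τ2.reg 0 = 0 := by
    rw [h2.1 0 (by decide)]
    simp [Prog.exec, r1 0 (by decide)]
  subst hN
  refine Spec.seq (spec_analyseProg (Merged.valid_ofSeq s) k3 hU) fun τ3 hF hA => ?_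
  exact spec_answerProg rfl ((hF.1 3 (by decide)).trans k3)
    ((hF.1 10 (by decide)).trans hU.count)
    (by unfold MatrixAt; rw [hF.2 2 (by decide)]; exact hU.edge)
    (by rw [hF.2 3 (by decide)]; exact hU.mm) (by rw [hF.2 4 (by decide)]; exact hU.dm)
    (by rw [hF.2 5 (by decide)]; exact hU.kind) hA
    ⟨(hF.1 0 (by decide)).trans k0, by simp⟩

end PowerBS

theorem mainTheorem5 :
    ∃ (prog : PowerBS.Prog) (C : ℕ),
      ∀ (k : ℕ) (m : Fin (k + 1) → PowerBS.PowerCircuit) (d : Fin k → PowerBS.PowerCircuit),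
        ∃ (ansA ansT : Option PowerBS.PowerCircuit) (T : ℕ),
          PowerBS.Computes prog (PowerBS.encodeInput m d)
            (PowerBS.encodeAnswer ansA ++ PowerBS.encodeAnswer ansT) T ∧
          T ≤ C * (max k 1 * (max (PowerBS.size m d) 1) ^ 3) ∧
          (ansA.isSome ↔ ∃ p : ℤ, (PowerBS.alternating m d).toB12 =
            (PresentedGroup.of PowerBS.Gen.a : PowerBS.B12) ^ p) ∧
          (ansT.isSome ↔ ∃ p : ℤ, (PowerBS.alternating m d).toB12 =
            (PresentedGroup.of PowerBS.Gen.t : PowerBS.B12) ^ p) ∧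
          (∀ P, ansA = some P →
            (PowerBS.alternating m d).toB12 =
              PowerBS.PowerSequence.toB12 [(PowerBS.Gen.a, P)] ∧
            P.numVertices ≤ ∑ j, ((m j).numVertices + (m j).numMarked) +
              ∑ j, (d j).numVertices ∧
            P.numMarked = ∑ j, (m j).numMarked) ∧
          (∀ P, ansT = some P →
            (PowerBS.alternating m d).toB12 =
              PowerBS.PowerSequence.toB12 [(PowerBS.Gen.t, P)] ∧
            P.numVertices = ∑ j, (d j).numVertices ∧
            P.numMarked = ∑ j, (d j).numMarked) := by
  open PowerBS in
  refine ⟨mainProg, 40000, fun k m d => ?_⟩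
  obtain ⟨T, τ, hruns, hT, ansA, ansT, hO, h⟩ := spec_mainProg m d rfl
  have hN := Merged.ofSeq_N (alternating m d)
  have hmm := Merged.ofSeq_mm (alternating m d)
  have hkind := Merged.ofSeq_kind (alternating m d)
  have hdm := Merged.ofSeq_dm (alternating m d)
  rw [sum_alternating] at hN hmm hkind hdm
  simp only [Gen.isT, Bool.false_eq_true, if_true, if_false, Finset.sum_const_zero, add_zero,
    zero_add] at hmm hkind hdm
  have hN : (Merged.ofSeq (alternating m d)).N = ∑ j, (m j).numVertices +
      ∑ j, (d j).numVertices := hN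
  have hsize : (Merged.ofSeq (alternating m d)).N ≤ size m d := by
    rw [hN, size, Finset.sum_add_distrib]
    omega
  refine ⟨ansA, ansT, T, ⟨τ, hruns, hO⟩, hT.trans ?_, h.a_iff, h.t_iff, fun P hP => ?_,
    fun P hP => ?_⟩
  · have hX : 1 ≤ max (size m d) 1 := le_max_right _ _
    have hK : 1 ≤ max k 1 := le_max_right _ _
    have hk : k ≤ max k 1 := le_max_left _ _
    have hle : (Merged.ofSeq (alternating m d)).N + 1 ≤ 2 * max (size m d) 1 := by
      have := le_max_left (size m d) 1
      omega
    have h3 := Nat.pow_le_pow_left hle 3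
    rw [mul_pow] at h3
    have h1 : 1 ≤ max (size m d) 1 ^ 3 := Nat.one_le_pow _ _ hX
    generalize max (size m d) 1 ^ 3 = Y at *
    generalize max k 1 = K at *
    nlinarith
  · obtain ⟨h1, h2, h3⟩ := h.a P hP
    refine ⟨h1, ?_, h3.trans hmm⟩
    rw [h2, hmm, hN, Finset.sum_add_distrib]
    omega
  · obtain ⟨h1, h2, h3⟩ := h.t P hP
    exact ⟨h1, h2.trans hkind, h3.trans hdm⟩
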